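/- **Proposition 2.5 (pushforward of the Lebesgue measure).** Let $\Sigma=\Gamma\backslash\mathbb H^2$ be a closed oriented hyperbolic surface, with covering map $\mathrm{pr}:\mathbb H^2\to\Sigma$, Riemannian area $\mathrm{vol}$ and distance $d$. Let $B>0$, $0<E<E_c:=\tfrac12B^2$, and let $(\Phi_t)$ be the magnetic flow on $T^*\Sigma$: the Hamiltonian flow of $p(x,\xi)=\tfrac12|\xi|^2$ for the twisted symplectic form $\Omega=\omega_0+B\,\pi^*\mathrm{vol}$, where $\omega_0$ is the Liouville form and $\pi:T^*\Sigma\to\Sigma$ the footpoint projection. Put $T_E=2\pi(B^2-2E)^{-1/2}$ and let $R_E\ge0$ satisfy $\cosh R_E=\frac{B^2+2E}{B^2-2E}$. Let $x_0\in\Sigma$, let $\xi_0\in T^*_{x_0}\Sigma$ with $p(x_0,\xi_0)=E$, let $R_\theta$ be the fiberwise rotation by $\theta$, and let $\mathrm{Leb}_{\mathbb T^2}$ be the measure $d\theta\otimes dt$ on the torus $\mathbb T^2(x_0,E)$ parametrized by $(\theta,t)\mapsto\Phi_t(x_0,R_\theta\xi_0)$, $\theta\in[0,2\pi]$, $t\in[0,T_E]$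 (that is, the image of $d\theta\otimes dt$ under this map). Fix a lift $z_0\in\mathbb H^2$ of $x_0$, let $\mathbb D(x_0,R_E)=\{x: d(x_0,x)\le R_E\}$, and let $\gamma_E\subset\Sigma$ be the immersed curve $\mathrm{pr}(\{z:d(z,z_0)=R_E\})$. For $y\in\Sigma$ set $$\alpha(y)=\frac1{2E}\sum_{(\theta,t)}\frac{(B^2-2E)^{1/2}}{|\sin((B^2-2E)^{1/2}t)|},$$ where the sum runs over all $(\theta,t)$ with $\theta\in\mathbb R/2\pi\mathbb Z$, $t\in(0,T_E)\setminus\{T_E/2\}$ and $\pi(\Phi_t(x_0,R_\theta\xi_0))=y$. For $\varepsilon>0$ let $\gamma_E^-$ and $\gamma_E^+$ be the images under $\mathrm{pr}$ of the annuli $\{R_E-\varepsilon<d(z,z_0)<R_E\}$ and $\{R_E<d(z,z_0)<R_E+\varepsilon\}$. For $y_0\in\gamma_E$ let $w_1,\dots,w_{J(y_0)}$ be the lifts of $y_0$ on the circle $\{d(z,z_0)=R_E\}$ (there are finitely many), and for $r>0$ let $\gamma_j$ and $\gamma_j^-$ be the images under $\mathrm{pr}$ of the intersections of the ball $B(w_j,r)$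 with this circle and with the inner annulus $\{R_E-\varepsilon<d(z,z_0)<R_E\}$. Put $$S_{y_0}(x)=\sum_{j=1}^{J(y_0)}\frac{\mathbf 1_{\gamma_j^-}(x)}{d(x,\gamma_j)^{1/2}},\qquad C=\frac1E\Big(\frac{\sqrt{2E}\,(B^2-2E)}{4B}\Big)^{1/2}.$$ Then the sum defining $\alpha(y)$ is finite for every $y\in\Sigma$, $\alpha\in L^1(\Sigma,\mathrm{vol})$, and $\pi_*\mathrm{Leb}_{\mathbb T^2}=\alpha\,\mathrm{vol}$. The support of $\alpha$ (the closure of $\{\alpha\neq0\}$, and also the support of the measure $\alpha\,\mathrm{vol}$) is $\mathbb D(x_0,R_E)$, and $\alpha$ is upper semicontinuous on $\Sigma\setminus(\{x_0\}\cup\gamma_E)$. In addition: * Near $x_0$: if $x_0\notin\gamma_E$, then $\alpha(x)\sim\dfrac{\sqrt{2/E}}{d(x_0,x)}$ as $x\to x_0$, $x\ne x_0$. If $x_0\in\gamma_E$, then for all sufficiently small $\varepsilon$ and, given $\varepsilon$, all sufficiently small $r$, $\alpha(x)\sim\dfrac{\sqrt{2/E}}{d(x_0,x)}+C\,S_{x_0}(x)$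 as $x\to x_0$, $x\neq x_0$. * Near $y_0\in\gamma_E$ with $y_0\ne x_0$: for all sufficiently small $\varepsilon$ (depending on $y_0$), $\alpha(x)=\mathcal O(1)$ as $x\to y_0$, $x\in\gamma_E^+\setminus\gamma_E^-$; and, for all sufficiently small $r$, $\alpha(x)\sim C\,S_{y_0}(x)$ as $x\to y_0$, $x\in\gamma_E^-$. -/

import Mathlib

open MeasureTheory Filter Set
open scoped Topology UpperHalfPlane MatrixGroups ComplexConjugate Asymptotics

namespace MagneticTorus

/-! ### Closed hyperbolic surfaces as quotients of the upper half-plane -/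

/-- `Γ` is the (lifted) deck group of a closed oriented hyperbolic surface: it is discrete in
`SL(2, ℝ)`, acts freely on `ℍ` (up to `± 1`, which acts trivially), and `Γ \ ℍ` is compact. -/
structure IsClosedSurfaceGroup (Γ : Subgroup SL(2, ℝ)) : Prop where
  discrete : DiscreteTopology Γ
  free : ∀ γ ∈ Γ, ∀ z : ℍ, γ • z = z → γ = 1 ∨ γ = -1
  cocompact : CompactSpace (MulAction.orbitRel.Quotient Γ ℍ)

/-- The surface `Σ = Γ \ ℍ`. -/
def Surface (Γ : Subgroup SL(2, ℝ)) : Type := MulAction.orbitRel.Quotient Γ ℍ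

namespace Surface

variable (Γ : Subgroup SL(2, ℝ))

/-- The covering map `ℍ → Σ`. -/
noncomputable def proj (z : ℍ) : Surface Γ := Quotient.mk (MulAction.orbitRel Γ ℍ) z

instance : TopologicalSpace (Surface Γ) :=
  inferInstanceAs (TopologicalSpace (MulAction.orbitRel.Quotient Γ ℍ))

instance : MeasurableSpace (Surface Γ) := borel _

instance : BorelSpace (Surface Γ) := ⟨rfl⟩

variable {Γ} in
/-- The hyperbolic distance of `Σ`: the least distance between lifts. -/
noncomputable def sdist (x y : Surface Γ) : ℝ :=
  sInf {d | ∃ z w : ℍ, proj Γ z = x ∧ proj Γ w = y ∧ d = dist z w}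

variable {Γ} in
/-- The distance from a point of `Σ` to a subset of `Σ`. -/
noncomputable def sdistSet (x : Surface Γ) (S : Set (Surface Γ)) : ℝ :=
  sInf {d | ∃ y ∈ S, d = sdist x y}

/-- The hyperbolic area of `Σ`: the measure for which the covering map is locally measure
preserving. The area of `A` is the largest area of a measurable set of `ℍ` that `proj` maps
injectively into `A`. -/
noncomputable def vol : Measure (Surface Γ) :=
  ⨆ (U : Set ℍ) (_ : MeasurableSet U) (_ : InjOn (proj Γ) U),
    ((volume : Measure ℍ).restrict U).map (proj Γ)

variable {Γ} in
/-- The geodesic disk `𝔻(x, R)`. -/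
def disk (x : Surface Γ) (R : ℝ) : Set (Surface Γ) := {y | sdist x y ≤ R}

end Surface

/-! ### The cotangent bundle -/

/-- The cotangent bundle `T*ℍ`; the covector `ξ₁ dx + ξ₂ dy` at `z` is the pair
`(z, ξ₁ + i ξ₂)`. -/
def CotangentPlane : Type := ℍ × ℂ

namespace CotangentPlane

noncomputable instance : TopologicalSpace CotangentPlane := inferInstanceAs (TopologicalSpace (ℍ × ℂ))

/-- The global chart of `T*ℍ` in `ℂ × ℂ`. -/
def coord (q : CotangentPlane) : ℂ × ℂ := ((q.1 : ℂ), q.2)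

/-- The action of `SL(2, ℝ)` on covectors, `γ · (z, ξ) = (γ z, ξ ∘ (dγ_z)⁻¹)`. As `dγ_z` is the
multiplication by `(c z + d)⁻²` and `ξ` pairs with `v` as `Re (conj ξ * v)`, the covector is
multiplied by the conjugate of `(c z + d)²`. -/
noncomputable instance : MulAction SL(2, ℝ) CotangentPlane where
  smul γ q := (γ • q.1, conj (UpperHalfPlane.denom (γ : GL (Fin 2) ℝ) q.1) ^ 2 * q.2)
  one_smul q := by
    change ((1 : SL(2, ℝ)) • q.1,
      conj (UpperHalfPlane.denom ((1 : SL(2, ℝ)) : GL (Fin 2) ℝ) q.1) ^ 2 * q.2) = (q : ℍ × ℂ)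
    refine Prod.ext ?_ ?_ <;> simp
  mul_smul γ δ q := by
    change ((γ * δ) • q.1,
      conj (UpperHalfPlane.denom ((γ * δ : SL(2, ℝ)) : GL (Fin 2) ℝ) q.1) ^ 2 * q.2) =
      ((γ • δ • q.1, conj (UpperHalfPlane.denom (γ : GL (Fin 2) ℝ) ((δ • q.1 : ℍ) : ℂ)) ^ 2 *
        (conj (UpperHalfPlane.denom (δ : GL (Fin 2) ℝ) q.1) ^ 2 * q.2)) : ℍ × ℂ)
    have h : UpperHalfPlane.denom ((γ * δ : SL(2, ℝ)) : GL (Fin 2) ℝ) q.1 =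
        UpperHalfPlane.denom (γ : GL (Fin 2) ℝ) ((δ • q.1 : ℍ) : ℂ) *
          UpperHalfPlane.denom (δ : GL (Fin 2) ℝ) q.1 := by
      simp only [map_mul, UpperHalfPlane.denom_cocycle _ _ (q.1 : ℍ).im_ne_zero]
      congr 2
      rw [UpperHalfPlane.specialLinearGroup_apply]
      simp [UpperHalfPlane.num, UpperHalfPlane.denom]
    rw [h, mul_smul]
    refine Prod.ext rfl ?_
    simp only [map_mul]
    ring

theorem smul_fst (γ : SL(2, ℝ)) (q : CotangentPlane) : (γ • q).1 = γ • q.1 := rfl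

theorem smul_snd (γ : SL(2, ℝ)) (q : CotangentPlane) :
    (γ • q).2 = conj (UpperHalfPlane.denom (γ : GL (Fin 2) ℝ) q.1) ^ 2 * q.2 := rfl

/-- The fiberwise rotation `R_θ` by the angle `θ`. -/
noncomputable def rotate (θ : ℝ) (q : CotangentPlane) : CotangentPlane :=
  (q.1, Complex.exp (θ * Complex.I) * q.2)

/-- The Hamiltonian `p(z, ξ) = |ξ|² / 2` for the metric `(dx² + dy²) / y²`, in the chart. -/
noncomputable def hamiltonian (q : ℂ × ℂ) : ℝ := 1 / 2 * (q.1.im ^ 2 * ‖q.2‖ ^ 2)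

/-- The twisted symplectic form `Ω = dξ ∧ dx + B · vol` at the point `q` of the chart, where `vol`
is the pullback of the area form `dx ∧ dy / y²`. Tangent vectors of `T*ℍ` are pairs
`(horizontal part, derivative of the covector)`. -/
noncomputable def twistedForm (B : ℝ) (q : ℂ × ℂ) (Y V : ℂ × ℂ) : ℝ :=
  ((conj Y.2 * V.1).re - (conj V.2 * Y.1).re) +
    B * ((Y.1.re * V.1.im - Y.1.im * V.1.re) / q.1.im ^ 2)

/-- `c` is a trajectory of the magnetic flow on `T*ℍ`: it is an integral curve, defined for all
times, of the vector field `H` with `Ω(Y, H) = dp(Y)` for all `Y`. -/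
def IsMagneticTrajectory (B : ℝ) (c : ℝ → CotangentPlane) : Prop :=
  ∀ t : ℝ, ∃ H : ℂ × ℂ, HasDerivAt (fun s => coord (c s)) H t ∧
    ∀ Y : ℂ × ℂ, twistedForm B (coord (c t)) Y H = fderiv ℝ hamiltonian (coord (c t)) Y

theorem rotate_smul (θ : ℝ) (γ : SL(2, ℝ)) (q : CotangentPlane) :
    rotate θ (γ • q) = γ • rotate θ q :=
  Prod.ext rfl (by
    change _ * (_ * _) = _ * (_ * _)
    simp only [rotate]
    ring)

theorem hamiltonian_smul (γ : SL(2, ℝ)) (q : CotangentPlane) :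
    hamiltonian (coord (γ • q)) = hamiltonian (coord q) := by
  have h : Complex.normSq (UpperHalfPlane.denom (γ : GL (Fin 2) ℝ) q.1) ≠ 0 :=
    UpperHalfPlane.normSq_denom_ne_zero _ q.1.im_ne_zero
  have him : (γ • q.1 : ℍ).im =
      q.1.im / Complex.normSq (UpperHalfPlane.denom (γ : GL (Fin 2) ℝ) q.1) := by
    change ((γ : GL (Fin 2) ℝ) • q.1 : ℍ).im = _
    rw [UpperHalfPlane.im_smul_eq_div_normSq]
    simp
  simp only [hamiltonian, coord, smul_fst, smul_snd, UpperHalfPlane.coe_im, him, norm_mul, norm_pow,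
    RCLike.norm_conj, Complex.normSq_eq_norm_sq] at h ⊢
  field_simp

end CotangentPlane

/-- The cotangent bundle `T*Σ = Γ \ T*ℍ`. -/
def CotangentSurface (Γ : Subgroup SL(2, ℝ)) : Type :=
  MulAction.orbitRel.Quotient Γ CotangentPlane

namespace CotangentSurface

variable (Γ : Subgroup SL(2, ℝ))

/-- The covering map `T*ℍ → T*Σ`. -/
noncomputable def proj (q : CotangentPlane) : CotangentSurface Γ :=
  Quotient.mk (MulAction.orbitRel Γ CotangentPlane) q

instance : TopologicalSpace (CotangentSurface Γ) :=
  inferInstanceAs (TopologicalSpace (MulAction.orbitRel.Quotient Γ CotangentPlane))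

instance : MeasurableSpace (CotangentSurface Γ) := borel _

instance : BorelSpace (CotangentSurface Γ) := ⟨rfl⟩

variable {Γ}

/-- The footpoint projection `π : T*Σ → Σ`. -/
noncomputable def footpoint (q : CotangentSurface Γ) : Surface Γ :=
  Quotient.lift (fun q : CotangentPlane => Surface.proj Γ q.1)
    (by
      rintro a b ⟨γ, rfl⟩
      exact Quotient.sound ⟨γ, rfl⟩) q

/-- The Hamiltonian `p = |ξ|² / 2` on `T*Σ`. -/
noncomputable def energy (q : CotangentSurface Γ) : ℝ :=
  Quotient.lift (fun q : CotangentPlane => CotangentPlane.hamiltonian q.coord)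
    (by
      rintro a b ⟨γ, rfl⟩
      exact CotangentPlane.hamiltonian_smul (γ : SL(2, ℝ)) b) q

/-- The fiberwise rotation `R_θ` of `T*Σ`. -/
noncomputable def rotate (θ : ℝ) (q : CotangentSurface Γ) : CotangentSurface Γ :=
  Quotient.lift (fun q : CotangentPlane => proj Γ (CotangentPlane.rotate θ q))
    (by
      rintro a b ⟨γ, rfl⟩
      exact Quotient.sound ⟨γ, (CotangentPlane.rotate_smul θ (γ : SL(2, ℝ)) b).symm⟩) q

open Classical in
/-- The magnetic flow `Φ_t` on `T*Σ`, the Hamiltonian flow of `p` for the twisted symplectic form.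
The form and `p` on `T*ℍ` are the lifts of those of `T*Σ`, so the trajectory of `q` is the image
of a trajectory on `T*ℍ` that starts at a lift of `q`. The default value is never used, as the
flow is complete, and the choice does not matter, as integral curves are unique and `Γ` permutes
them. -/
noncomputable def magneticFlow (B t : ℝ) (q : CotangentSurface Γ) : CotangentSurface Γ :=
  if h : ∃ c : ℝ → CotangentPlane, CotangentPlane.IsMagneticTrajectory B c ∧ proj Γ (c 0) = q
  then proj Γ (h.choose t) else q

end CotangentSurface

/-! ### The torus and the density -/

open CotangentSurface

/-- The period `T_E = 2π (B² - 2E)^(-1/2)`. -/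
noncomputable def period (B E : ℝ) : ℝ := 2 * Real.pi / √(B ^ 2 - 2 * E)

/-- The radius `R_E ≥ 0` with `cosh R_E = (B² + 2E) / (B² - 2E)`. -/
noncomputable def radius (B E : ℝ) : ℝ := Real.arcosh ((B ^ 2 + 2 * E) / (B ^ 2 - 2 * E))

variable {Γ : Subgroup SL(2, ℝ)}

/-- The parametrization `(θ, t) ↦ Φ_t(R_θ ξ₀)` of the torus `𝕋²(x₀, E)`, where `ξ₀` is a covector
at `x₀` with energy `E`. -/
noncomputable def torusMap (B : ℝ) (ξ₀ : CotangentSurface Γ) (q : ℝ × ℝ) : CotangentSurface Γ :=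
  magneticFlow B q.2 (rotate q.1 ξ₀)

/-- The Lebesgue measure `dθ ⊗ dt` of the torus, as a measure on `T*Σ`. -/
noncomputable def torusMeasure (B E : ℝ) (ξ₀ : CotangentSurface Γ) :
    Measure (CotangentSurface Γ) :=
  ((volume : Measure (ℝ × ℝ)).restrict (Icc 0 (2 * Real.pi) ×ˢ Icc 0 (period B E))).map
    (torusMap B ξ₀)

/-- The preimages of `y` under `Ψ(θ, t) = π(Φ_t(R_θ ξ₀))`, where `θ` ranges over
`ℝ / 2πℤ ≃ [0, 2π)` and `t` over `(0, T_E) \ {T_E / 2}`. -/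
def preimages (B E : ℝ) (ξ₀ : CotangentSurface Γ) (y : Surface Γ) : Set (ℝ × ℝ) :=
  {q | q.1 ∈ Ico 0 (2 * Real.pi) ∧ q.2 ∈ Ioo 0 (period B E) ∧ q.2 ≠ period B E / 2 ∧
    footpoint (torusMap B ξ₀ q) = y}

/-- The density `α(y) = (2E)⁻¹ ∑ (B² - 2E)^(1/2) / |sin ((B² - 2E)^(1/2) t)|`, the sum running over
the preimages `(θ, t)` of `y` under `Ψ`. -/
noncomputable def density (B E : ℝ) (ξ₀ : CotangentSurface Γ) (y : Surface Γ) : ℝ :=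
  1 / (2 * E) * ∑ᶠ q ∈ preimages B E ξ₀ y,
    √(B ^ 2 - 2 * E) / |Real.sin (√(B ^ 2 - 2 * E) * q.2)|

/-! ### The boundary curve and its branches

Here `z₀ : ℍ` is a lift of the center of the disk and `R` is the radius. -/

variable (Γ) in
/-- The immersed curve `γ_E`, the image in `Σ` of the circle of radius `R` about `z₀`. -/
def boundaryCurve (z₀ : ℍ) (R : ℝ) : Set (Surface Γ) :=
  Surface.proj Γ '' {z | dist z z₀ = R}

variable (Γ) in
/-- The inner half neighborhood `γ_E⁻`, the image of the annulus `R - ε < d(z₀, z) < R`. -/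
def innerCollar (z₀ : ℍ) (R ε : ℝ) : Set (Surface Γ) :=
  Surface.proj Γ '' {z | R - ε < dist z z₀ ∧ dist z z₀ < R}

variable (Γ) in
/-- The outer half neighborhood `γ_E⁺`, the image of the annulus `R < d(z₀, z) < R + ε`. -/
def outerCollar (z₀ : ℍ) (R ε : ℝ) : Set (Surface Γ) :=
  Surface.proj Γ '' {z | R < dist z z₀ ∧ dist z z₀ < R + ε}

/-- The lifts of `y` to the circle of radius `R` about `z₀`. They index the branches of the
boundary curve at `y`, and their number is the order `J(y)`. -/
def boundaryLifts (z₀ : ℍ) (R : ℝ) (y : Surface Γ) : Set ℍ :=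
  {w | Surface.proj Γ w = y ∧ dist w z₀ = R}

variable (Γ) in
/-- The branch `γ_w` of the boundary curve: the image of the arc of the circle in the ball of
radius `r` about its point `w`. -/
def branch (z₀ : ℍ) (R r : ℝ) (w : ℍ) : Set (Surface Γ) :=
  Surface.proj Γ '' ({z | dist z z₀ = R} ∩ Metric.ball w r)

variable (Γ) in
/-- The inner side `γ_w⁻` of the branch `γ_w`. -/
def innerBranch (z₀ : ℍ) (R ε r : ℝ) (w : ℍ) : Set (Surface Γ) :=
  Surface.proj Γ '' ({z | R - ε < dist z z₀ ∧ dist z z₀ < R} ∩ Metric.ball w r)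

/-- The sum `∑_w 1_{γ_w⁻}(x) / d(x, γ_w)^(1/2)` over the branches at `y`. -/
noncomputable def branchSum (z₀ : ℍ) (R ε r : ℝ) (y x : Surface Γ) : ℝ :=
  ∑ᶠ w ∈ boundaryLifts z₀ R y,
    (innerBranch Γ z₀ R ε r w).indicator
      (fun x => 1 / √(Surface.sdistSet x (branch Γ z₀ R r w))) x

/-- The constant `E⁻¹ ((2E)^(1/2) (B² - 2E) / (4B))^(1/2)`. -/
noncomputable def boundaryConstant (B E : ℝ) : ℝ :=
  1 / E * √(√(2 * E) * (B ^ 2 - 2 * E) / (4 * B))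

end MagneticTorus

open MagneticTorus

/-! ### Lifts, deck transformations and distance on the quotient -/

namespace MagneticTorus

namespace Surface

variable {Γ : Subgroup SL(2, ℝ)}

/-! Everything is computed on `ℍ` and then summed over the lifts of a point.

The level set of energy `E` in `T*ℍ` is a single orbit of `SL(2, ℝ)`, and on it the magnetic flow is
right multiplication by the one-parameter group `flowMatrix`. For `2E < B²` its generator is
elliptic, with frequency `ω = √(B² - 2E)`. Hence the distance `d` from the starting point obeys
`cosh d = 1 + (2E/ω²)(1 - cos ωt)` (`cosh_dist_orbitPoint`). It rises from `0` to `R_E` in the first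
half period and falls back in the second. Rotating the initial covector rotates the orbit, so each
half period covers the punctured open disk exactly once (`bijOn_orbitPoint`). Thus each lift in that
disk has two preimages, and `α` is a finite sum over lifts of an explicit function `weight` of the
distance (`density_eq`, `density_eq_sum`).

Differentiating the formula for `cosh d` gives `sinh d dd = (2E/ω) sin ωt dt`. Since the area is
`sinh d dd dθ`, each half period pushes `dθ dt` to `ω/(2E |sin ωt|)` times the area, and the two
together give `weight` (`lintegral_orbitPoint`). Summing over the deck group transfers this to `Σ`
(`map_proj_withDensity`), and finiteness of the total mass gives integrability.

For the asymptotics, near a given point the density is a sum over a fixed finite set of deck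
translates (`exists_local_lifts`). The function `weight` is singular only at `d = 0`, like
`√(2/E)/d`, and on the inner side of `d = R_E`, like `C (R_E - d)^(-1/2)`. All leading terms are
nonnegative, so they cannot cancel, and they absorb the bounded remainder once their sum tends to
infinity (`isEquivalent_sum`, `isEquivalent_density`). For a point close to a branch of the boundary
curve and on its inner side, `R_E - d` is the distance to the branch (`sdistSet_branch`), which
identifies the sum of leading terms with `branchSum`. -/

theorem proj_eq_iff {z w : ℍ} : proj Γ z = proj Γ w ↔ ∃ γ ∈ Γ, γ • w = z := by
  refine Quotient.eq.trans ⟨?_, ?_⟩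
  · rintro ⟨γ, h⟩
    exact ⟨γ, γ.2, h⟩
  · rintro ⟨γ, hγ, h⟩
    exact ⟨⟨γ, hγ⟩, h⟩

theorem proj_smul {γ : SL(2, ℝ)} (hγ : γ ∈ Γ) (z : ℍ) : proj Γ (γ • z) = proj Γ z :=
  proj_eq_iff.2 ⟨γ, hγ, rfl⟩

theorem proj_surjective : Function.Surjective (proj Γ) := Quotient.mk_surjective

theorem continuous_proj : Continuous (proj Γ) := continuous_quotient_mk'

theorem isOpenMap_proj : IsOpenMap (proj Γ) :=
  isOpenMap_quotient_mk'_mul (Γ := Γ) (T := ℍ)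

theorem secondCountableTopology : SecondCountableTopology (Surface Γ) :=
  ContinuousConstSMul.secondCountableTopology (Γ := Γ) (T := ℍ)

theorem t2Space (hΓ : IsClosedSurfaceGroup Γ) : T2Space (Surface Γ) := by
  have := hΓ.discrete
  exact t2Space_of_properlyDiscontinuousSMul_of_t2Space (Γ := Γ) (T := ℍ)

theorem map_nhdsWithin_preimage_proj (z : ℍ) (A : Set (Surface Γ)) :
    map (proj Γ) (𝓝[proj Γ ⁻¹' A] z) = 𝓝[A] (proj Γ z) := by
  rw [nhdsWithin, nhdsWithin, Filter.map_inf_principal_preimage,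
    isOpenMap_proj.map_nhds_eq continuous_proj.continuousAt]

/-- By proper discontinuity only finitely many elements move `i` by at most `n`; these sets exhaust
`Γ`. -/
theorem countable (hΓ : IsClosedSurfaceGroup Γ) : Countable Γ := by
  have := hΓ.discrete
  rw [← Set.countable_univ_iff]
  refine (Set.countable_iUnion (t := fun n : ℕ => {γ : Γ | ((γ • ·) '' {UpperHalfPlane.I} ∩
    Metric.closedBall UpperHalfPlane.I (n : ℝ)).Nonempty}) fun n =>
    (ProperlyDiscontinuousSMul.finite_disjoint_inter_image (isCompact_singleton)
      (isCompact_closedBall _ _)).countable).mono ?_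
  intro γ _
  obtain ⟨n, hn⟩ := exists_nat_ge (dist (γ • UpperHalfPlane.I) UpperHalfPlane.I)
  exact mem_iUnion.2 ⟨n, _, ⟨_, rfl, rfl⟩, hn⟩

/-- Only finitely many lifts of a point lie in a given ball. -/
theorem finite_lifts (hΓ : IsClosedSurfaceGroup Γ) (y : Surface Γ) (z₀ : ℍ) (r : ℝ) :
    {v | proj Γ v = y ∧ dist v z₀ ≤ r}.Finite := by
  have := hΓ.discrete
  obtain ⟨v₀, rfl⟩ := proj_surjective y
  have h := ProperlyDiscontinuousSMul.finite_disjoint_inter_image (Γ := Γ) (T := ℍ)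
    (isCompact_singleton (x := v₀)) (isCompact_closedBall z₀ r)
  refine (h.image fun γ => γ • v₀).subset ?_
  rintro v ⟨hv, hvr⟩
  obtain ⟨γ, hγ, rfl⟩ := proj_eq_iff.1 hv
  exact ⟨⟨γ, hγ⟩, ⟨γ • v₀, ⟨v₀, rfl, rfl⟩, hvr⟩, rfl⟩

/-- The lifts of a point are uniformly separated. -/
theorem exists_separation (hΓ : IsClosedSurfaceGroup Γ) (y : Surface Γ) :
    ∃ δ > 0, ∀ v w : ℍ, proj Γ v = y → proj Γ w = y → dist v w < δ → v = w := by
  obtain ⟨v₀, rfl⟩ := proj_surjective y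
  have hf : ({v | proj Γ v = proj Γ v₀ ∧ dist v v₀ ≤ 1} \ {v₀}).Finite :=
    (finite_lifts hΓ (proj Γ v₀) v₀ 1).subset sdiff_subset
  obtain ⟨δ, hδ, h⟩ : ∃ δ > 0, ∀ v ∈ {v | proj Γ v = proj Γ v₀ ∧ dist v v₀ ≤ 1} \ {v₀},
      δ ≤ dist v v₀ := by
    have hm := hf.isClosed.isOpen_compl.mem_nhds (x := v₀) (by simp)
    obtain ⟨δ, hδ, h⟩ := Metric.mem_nhds_iff.1 hm
    exact ⟨δ, hδ, fun v hv => not_lt.1 fun hlt => h hlt hv⟩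
  -- The deck group acts transitively on the fiber by isometries, so the gap around `v₀` serves
  -- every lift; the `1` keeps the translate of `v` in the ball where that gap was measured.
  refine ⟨min δ 1, lt_min hδ one_pos, fun v w hv hw hvw => ?_⟩
  obtain ⟨γ, hγ, rfl⟩ := proj_eq_iff.1 hw
  have hd : dist (γ⁻¹ • v) v₀ = dist v (γ • v₀) := by
    rw [← dist_smul γ, smul_inv_smul]
  by_contra hne
  have hlt := hvw.trans_le (min_le_left _ _)
  rw [← hd] at hlt
  refine not_le.2 hlt (h _ ⟨⟨?_, ?_⟩, ?_⟩)
  · rw [proj_smul (inv_mem hγ), hv]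
  · rw [hd]
    exact (hvw.trans_le (min_le_right _ _)).le
  · rintro h
    exact hne (by rw [← h, smul_inv_smul])

theorem sdist_le (z w : ℍ) : sdist (proj Γ z) (proj Γ w) ≤ dist z w :=
  csInf_le ⟨0, by rintro _ ⟨z, w, -, -, rfl⟩; exact dist_nonneg⟩ ⟨z, w, rfl, rfl, rfl⟩

/-- The distance of `Σ` is attained by a lift in a prescribed fiber. -/
theorem exists_sdist_eq (hΓ : IsClosedSurfaceGroup Γ) (z : ℍ) (y : Surface Γ) :
    ∃ w, proj Γ w = y ∧ sdist (proj Γ z) y = dist z w := by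
  obtain ⟨w₀, rfl⟩ := proj_surjective y
  -- Only the finitely many lifts no farther from `z` than `w₀` compete for the minimum.
  have hf := finite_lifts hΓ (proj Γ w₀) z (dist w₀ z)
  obtain ⟨w, ⟨hw, hwd⟩, hmin⟩ := hf.exists_minimalFor (fun w => dist w z) _ ⟨w₀, rfl, le_rfl⟩
  refine ⟨w, hw, le_antisymm (hw ▸ sdist_le z w) (le_csInf ⟨_, z, w, rfl, hw, rfl⟩ ?_)⟩
  rintro _ ⟨z', w', hz', hw', rfl⟩
  obtain ⟨γ, hγ, rfl⟩ := proj_eq_iff.1 hz'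
  have hd : dist (γ⁻¹ • w') z = dist (γ • z) w' := by
    rw [← dist_smul γ, smul_inv_smul, dist_comm]
  rw [← hd, dist_comm z w]
  by_contra! hlt
  exact not_le.2 hlt (hmin ⟨by rw [proj_smul (inv_mem hγ), hw'], hlt.le.trans hwd⟩ hlt.le)

theorem disk_eq_image (hΓ : IsClosedSurfaceGroup Γ) (z₀ : ℍ) (R : ℝ) :
    disk (proj Γ z₀) R = proj Γ '' Metric.closedBall z₀ R := by
  ext y
  constructor
  · intro hy
    obtain ⟨w, rfl, hw⟩ := exists_sdist_eq hΓ z₀ y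
    refine ⟨w, ?_, rfl⟩
    rw [Metric.mem_closedBall, dist_comm, ← hw]
    exact hy
  · rintro ⟨w, hw, rfl⟩
    exact (sdist_le z₀ w).trans (by rwa [dist_comm])

theorem isClosed_disk (hΓ : IsClosedSurfaceGroup Γ) (z₀ : ℍ) (R : ℝ) :
    IsClosed (disk (proj Γ z₀) R) := by
  have := t2Space hΓ
  rw [disk_eq_image hΓ]
  exact ((isCompact_closedBall z₀ R).image continuous_proj).isClosed

/-- Near a lift of `x`, the distance to `x` is the distance to the lift. -/
theorem sdist_eq_of_near {δ : ℝ} {v z : ℍ}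
    (hΓ : IsClosedSurfaceGroup Γ)
    (hδ : ∀ a b : ℍ, proj Γ a = proj Γ v → proj Γ b = proj Γ v → dist a b < δ → a = b)
    (hz : dist z v < δ / 2) : sdist (proj Γ v) (proj Γ z) = dist z v := by
  refine le_antisymm (by rw [dist_comm]; exact sdist_le v z) ?_
  obtain ⟨w, hw, hd⟩ := exists_sdist_eq hΓ v (proj Γ z)
  obtain ⟨γ, hγ, rfl⟩ := proj_eq_iff.1 hw
  rw [hd]
  by_contra! hlt
  -- A lift `γ • z` closer to `v` than `z` would bring `γ • v` within `δ` of `v`. Then `γ` fixes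
  -- `v`, and the two distances agree after all.
  have h := hδ (γ • v) v (proj_smul hγ v) rfl (by
    calc dist (γ • v) v ≤ dist (γ • v) (γ • z) + dist (γ • z) v := dist_triangle _ _ _
      _ < δ := by rw [dist_smul, dist_comm v z, dist_comm (γ • z) v]; linarith)
  have h' : dist v (γ • z) = dist z v := by
    conv_lhs => rw [← h]
    rw [dist_smul, dist_comm]
  exact hlt.ne h'

end Surface

end MagneticTorus

/-! ### The magnetic vector field and its trajectories -/

namespace MagneticTorus

namespace CotangentPlane

/-- The Hamiltonian vector field of `p` for the twisted symplectic form, in the chart. -/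
noncomputable def magneticField (B : ℝ) (q : ℂ × ℂ) : ℂ × ℂ :=
  (q.1.im ^ 2 • q.2,
    -(B • (Complex.I * q.2)) - (q.1.im * (q.2.re ^ 2 + q.2.im ^ 2)) • Complex.I)

theorem hasFDerivAt_hamiltonian (q : ℂ × ℂ) :
    ∃ L : ℂ × ℂ →L[ℝ] ℝ, HasFDerivAt hamiltonian L q ∧ ∀ Y, L Y =
      q.1.im * (q.2.re ^ 2 + q.2.im ^ 2) * Y.1.im +
        q.1.im ^ 2 * (q.2.re * Y.2.re + q.2.im * Y.2.im) := by
  have h1 : HasFDerivAt (fun q : ℂ × ℂ => q.1.im)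
      (Complex.imCLM.comp (ContinuousLinearMap.fst ℝ ℂ ℂ)) q :=
    (Complex.imCLM.comp (ContinuousLinearMap.fst ℝ ℂ ℂ)).hasFDerivAt
  have h2 : HasFDerivAt (fun q : ℂ × ℂ => q.2.re)
      (Complex.reCLM.comp (ContinuousLinearMap.snd ℝ ℂ ℂ)) q :=
    (Complex.reCLM.comp (ContinuousLinearMap.snd ℝ ℂ ℂ)).hasFDerivAt
  have h3 : HasFDerivAt (fun q : ℂ × ℂ => q.2.im)
      (Complex.imCLM.comp (ContinuousLinearMap.snd ℝ ℂ ℂ)) q :=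
    (Complex.imCLM.comp (ContinuousLinearMap.snd ℝ ℂ ℂ)).hasFDerivAt
  have h := ((h1.pow 2).mul ((h2.pow 2).add (h3.pow 2))).const_mul (1 / 2)
  refine ⟨_, h.congr_of_eventuallyEq (.of_forall fun q => ?_), fun Y => ?_⟩
  · simp only [hamiltonian, ← Complex.normSq_eq_norm_sq, Complex.normSq_apply]
    simp only [Pi.mul_apply, Pi.add_apply]
    ring
  · simp
    ring

/-- `Ω` is nondegenerate, so testing against the four coordinate vectors determines `H`. This turns
Hamilton's equation into an explicit differential equation. -/
theorem eq_magneticField_iff {B : ℝ} {q H : ℂ × ℂ} (hq : q.1.im ≠ 0) :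
    (∀ Y, twistedForm B q Y H = fderiv ℝ hamiltonian q Y) ↔ H = magneticField B q := by
  obtain ⟨L, hL, hLY⟩ := hasFDerivAt_hamiltonian q
  rw [hL.fderiv]
  simp only [hLY]
  have hsm : ∀ (r : ℝ) (z : ℂ), (r • z).re = r * z.re := fun r z => by simp
  have hsm' : ∀ (r : ℝ) (z : ℂ), (r • z).im = r * z.im := fun r z => by simp
  constructor
  · intro h
    have h1 := h (1, 0)
    have h2 := h (Complex.I, 0)
    have h3 := h (0, 1)
    have h4 := h (0, Complex.I)
    simp [twistedForm] at h1 h2 h3 h4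
    refine Prod.ext (Complex.ext ?_ ?_) (Complex.ext ?_ ?_)
    · simp [-Complex.real_smul, hsm, magneticField, h3]
    · simp [-Complex.real_smul, hsm', magneticField, h4]
    · simp [-Complex.real_smul, hsm, magneticField]
      rw [h4] at h1
      field_simp at h1
      linarith
    · simp [-Complex.real_smul, hsm', magneticField]
      rw [h3] at h2
      field_simp at h2
      linarith
  · rintro rfl Y
    simp only [twistedForm, magneticField, hsm, hsm', Complex.sub_re, Complex.sub_im, Complex.neg_re,
      Complex.neg_im, Complex.mul_re, Complex.mul_im, Complex.conj_re, Complex.conj_im, Complex.I_re,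
      Complex.I_im]
    field_simp
    ring

theorem isMagneticTrajectory_iff {B : ℝ} {c : ℝ → CotangentPlane} :
    IsMagneticTrajectory B c ↔
      ∀ t, HasDerivAt (fun s => coord (c s)) (magneticField B (coord (c t))) t := by
  refine forall_congr' fun t => ?_
  simp only [eq_magneticField_iff (q := coord (c t)) (B := B) (c t).1.im_ne_zero]
  simp

theorem contDiff_magneticField (B : ℝ) : ContDiff ℝ 1 (magneticField B) := by
  have him : ContDiff ℝ 1 Complex.im := Complex.imCLM.contDiff
  have hre : ContDiff ℝ 1 Complex.re := Complex.reCLM.contDiff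
  unfold magneticField
  fun_prop

theorem coord_injective : Function.Injective coord := fun _ _ h =>
  Prod.ext (UpperHalfPlane.ext (congrArg Prod.fst h)) (congrArg Prod.snd h :)

/-- Integral curves of the magnetic field are unique. -/
theorem IsMagneticTrajectory.eq {B : ℝ} {c c' : ℝ → CotangentPlane}
    (hc : IsMagneticTrajectory B c) (hc' : IsMagneticTrajectory B c') (h : c 0 = c' 0) :
    c = c' := by
  rw [isMagneticTrajectory_iff] at hc hc'
  ext1 t
  apply coord_injective
  set T := |t| + 1
  have ht : t ∈ Ioo (-T) T := abs_lt.1 (lt_add_one _)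
  have h0 : (0 : ℝ) ∈ Ioo (-T) T := by
    have : 0 < T := by positivity
    exact ⟨by linarith, this⟩
  have hcont : ∀ {c : ℝ → CotangentPlane}, (∀ t, HasDerivAt (fun s => coord (c s)) (magneticField B (coord (c t))) t) →
      IsCompact ((fun s => coord (c s)) '' Icc (-T) T) := fun h =>
    isCompact_Icc.image (continuous_iff_continuousAt.2 fun t => (h t).continuousAt)
  -- The field is only locally Lipschitz; a common constant exists on the compact union of the two
  -- trajectories over `[-T, T]`.
  obtain ⟨K, hK⟩ := LocallyLipschitzOn.exists_lipschitzOnWith_of_compact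
    ((hcont hc).union (hcont hc')) ((contDiff_magneticField B).locallyLipschitz.locallyLipschitzOn)
  exact ODE_solution_unique_of_mem_Ioo (v := fun _ => magneticField B)
    (s := fun _ => _) (fun _ _ => hK) h0
    (fun s hs => ⟨hc s, .inl ⟨s, Ioo_subset_Icc_self hs, rfl⟩⟩)
    (fun s hs => ⟨hc' s, .inr ⟨s, Ioo_subset_Icc_self hs, rfl⟩⟩)
    (by simp [h]) ht

/-- The upward covector of norm `s` at `i`. -/
noncomputable def upward (s : ℝ) : CotangentPlane := (UpperHalfPlane.I, s * Complex.I)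

theorem coord_smul_upward (g : SL(2, ℝ)) (s : ℝ) :
    coord (g • upward s) =
      ((g 0 0 * Complex.I + g 0 1) / (g 1 0 * Complex.I + g 1 1),
        (g 1 1 - g 1 0 * Complex.I) ^ 2 * (s * Complex.I)) := by
  refine Prod.ext ?_ ?_
  · change ((g • UpperHalfPlane.I : ℍ) : ℂ) = _
    simp [UpperHalfPlane.coe_specialLinearGroup_apply]
  · change conj (UpperHalfPlane.denom (g : GL (Fin 2) ℝ) UpperHalfPlane.I) ^ 2 *
      (s * Complex.I) = _
    simp only [UpperHalfPlane.denom, map_add, map_mul,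
      UpperHalfPlane.coe_I, Complex.conj_I, Complex.conj_ofReal]
    congr 2
    simp
    ring

/-- The field is invariant under the action, so on the orbit of `upward s` it comes from a
left-invariant field on `SL(2, ℝ)`. The hypothesis is its equation `A' = A X` with `X = ½ !![s, -B;
B, -s]`, written row by row. -/
theorem isMagneticTrajectory_smul_upward {B s : ℝ} {A : ℝ → SL(2, ℝ)}
    (h : ∀ i t, HasDerivAt (fun t => A t i 0) ((s * A t i 0 + B * A t i 1) / 2) t ∧
      HasDerivAt (fun t => A t i 1) ((-B * A t i 0 - s * A t i 1) / 2) t) :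
    IsMagneticTrajectory B (fun t => A t • upward s) := by
  rw [isMagneticTrajectory_iff]
  intro t
  have hlin : ∀ i, HasDerivAt (fun t => (A t i 0 : ℂ) * Complex.I + A t i 1)
      (((s * A t i 0 + B * A t i 1) / 2 : ℝ) * Complex.I +
        ((-B * A t i 0 - s * A t i 1) / 2 : ℝ)) t := fun i =>
    ((h i t).1.ofReal_comp.mul_const _).add (h i t).2.ofReal_comp
  have hconj : HasDerivAt (fun t => (A t 1 1 : ℂ) - A t 1 0 * Complex.I)
      (((-B * A t 1 0 - s * A t 1 1) / 2 : ℝ) -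
        ((s * A t 1 0 + B * A t 1 1) / 2 : ℝ) * Complex.I) t :=
    (h 1 t).2.ofReal_comp.sub ((h 1 t).1.ofReal_comp.mul_const _)
  have hdet := (A t).det_coe
  rw [Matrix.det_fin_two] at hdet
  simp only [coord_smul_upward]
  have him := UpperHalfPlane.coe_specialLinearGroup_apply (A t) UpperHalfPlane.I
  have hD : (A t 1 0 : ℂ) * Complex.I + A t 1 1 ≠ 0 := by
    have := UpperHalfPlane.denom_ne_zero (A t : GL (Fin 2) ℝ) UpperHalfPlane.I
    simpa [UpperHalfPlane.denom] using this
  have hd := ((hlin 0).div (hlin 1) hD).prodMk ((hconj.pow 2).mul_const ((s : ℂ) * Complex.I))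
  refine hd.congr_deriv ?_
  generalize A t 0 0 = a at *
  generalize A t 0 1 = b at *
  generalize A t 1 0 = c at *
  generalize A t 1 1 = d at *
  have hI := Complex.I_sq
  have hn : c ^ 2 + d ^ 2 ≠ 0 := by
    intro h0
    have hc : c = 0 := by nlinarith
    have hd : d = 0 := by nlinarith
    simp [hc, hd] at hD
  have hn' : d ^ 2 + c ^ 2 ≠ 0 := by rwa [add_comm]
  have hnC : (c ^ 2 + d ^ 2 : ℂ) ≠ 0 := by exact_mod_cast hn
  have hy : ((a * Complex.I + b) / (c * Complex.I + d)).im = 1 / (c ^ 2 + d ^ 2) := by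
    rw [Complex.div_im]
    simp [Complex.normSq_apply]
    rw [← sq, ← sq, ← sub_div, hdet, one_div, add_comm]
  -- Splitting the squared modulus into conjugate factors lets the factor of the covector cancel
  -- against the denominator of the footpoint.
  have hfac : (c ^ 2 + d ^ 2 : ℂ) = (c * Complex.I + d) * (d - c * Complex.I) := by
    linear_combination (c : ℂ) ^ 2 * hI
  have hdetC : (a * d - b * c : ℂ) = 1 := by exact_mod_cast hdet
  rw [hfac] at hnC
  have hD' := right_ne_zero_of_mul hnC
  refine Prod.ext ?_ ?_
  · simp only [magneticField, hy, Complex.real_smul]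
    push_cast
    rw [hfac]
    rw [show (1 / (((c : ℂ) * Complex.I + d) * (d - c * Complex.I))) ^ 2 *
      ((d - c * Complex.I) ^ 2 * (s * Complex.I)) = s * Complex.I / (c * Complex.I + d) ^ 2 by
        field_simp]
    congr 1
    linear_combination s * Complex.I * hdetC - (B / 2 * (a * d - b * c) : ℂ) * hI
  · have hsq : (((d : ℂ) - c * Complex.I) ^ 2 * (s * Complex.I)).re ^ 2 +
        (((d : ℂ) - c * Complex.I) ^ 2 * (s * Complex.I)).im ^ 2 =
        s ^ 2 * (c ^ 2 + d ^ 2) ^ 2 := by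
      simp [sq]
      ring
    simp only [magneticField, hy, hsq, Complex.real_smul]
    rw [show 1 / (c ^ 2 + d ^ 2) * (s ^ 2 * (c ^ 2 + d ^ 2) ^ 2) = s ^ 2 * (c ^ 2 + d ^ 2) by
      field_simp]
    push_cast
    linear_combination (s ^ 2 * Complex.I * c ^ 2 - B * c * (d - c * Complex.I) * s *
      Complex.I : ℂ) * hI

end CotangentPlane

end MagneticTorus

/-! ### The magnetic flow as right multiplication by a one-parameter group -/

namespace MagneticTorus

/-- The rotation about `i` that rotates the covectors at `i` by the angle `θ`. -/
noncomputable def rotMatrix (θ : ℝ) : SL(2, ℝ) :=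
  ⟨!![Real.cos (θ / 2), Real.sin (θ / 2); -Real.sin (θ / 2), Real.cos (θ / 2)], by
    rw [Matrix.det_fin_two_of]
    linear_combination Real.cos_sq_add_sin_sq (θ / 2)⟩

section

variable {B E : ℝ}

theorem frequency_pos (hEc : E < B ^ 2 / 2) : 0 < √(B ^ 2 - 2 * E) :=
  Real.sqrt_pos.2 (by linarith)

theorem frequency_sq (hEc : E < B ^ 2 / 2) : √(B ^ 2 - 2 * E) ^ 2 = B ^ 2 - 2 * E :=
  Real.sq_sqrt (by linarith)

/-- The one-parameter group of `SL(2, ℝ)` whose orbit of the upward covector at `i` is a trajectory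
of the magnetic flow with energy `E`. -/
noncomputable def flowMatrix (hE : 0 < E) (hEc : E < B ^ 2 / 2) (t : ℝ) : SL(2, ℝ) :=
  ⟨!![Real.cos (√(B ^ 2 - 2 * E) * t / 2) +
        √(2 * E) / √(B ^ 2 - 2 * E) * Real.sin (√(B ^ 2 - 2 * E) * t / 2),
      -(B / √(B ^ 2 - 2 * E) * Real.sin (√(B ^ 2 - 2 * E) * t / 2));
      B / √(B ^ 2 - 2 * E) * Real.sin (√(B ^ 2 - 2 * E) * t / 2),
      Real.cos (√(B ^ 2 - 2 * E) * t / 2) -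
        √(2 * E) / √(B ^ 2 - 2 * E) * Real.sin (√(B ^ 2 - 2 * E) * t / 2)], by
    -- The determinant is `cos² + ((B² - 2E)/ω²) sin²`, which is `1` because `ω² = B² - 2E`.
    rw [Matrix.det_fin_two_of]
    have h := frequency_sq hEc
    have h0 := (frequency_pos hEc).ne'
    have hs := Real.sq_sqrt (show 0 ≤ 2 * E by linarith)
    have hcs := Real.cos_sq_add_sin_sq (√(B ^ 2 - 2 * E) * t / 2)
    generalize √(B ^ 2 - 2 * E) = ω at *
    field_simp
    linear_combination (ω ^ 2) * hcs - Real.sin (ω * t / 2) ^ 2 * h -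
      Real.sin (ω * t / 2) ^ 2 * hs⟩

theorem flowMatrix_zero (hE : 0 < E) (hEc : E < B ^ 2 / 2) : flowMatrix hE hEc 0 = 1 := by
  ext i j
  fin_cases i <;> fin_cases j <;> simp [flowMatrix]

/-- With `s = √(2E)` and `X = ½ !![s, -B; B, -s]` one has `X² = -(ω²/4)`. The matrix is therefore
`exp (tX) = cos (ωt/2) + (2/ω) sin (ωt/2) X`. -/
theorem hasDerivAt_flowMatrix (hE : 0 < E) (hEc : E < B ^ 2 / 2) (i : Fin 2) (t : ℝ) :
    HasDerivAt (fun t => flowMatrix hE hEc t i 0)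
      ((√(2 * E) * flowMatrix hE hEc t i 0 + B * flowMatrix hE hEc t i 1) / 2) t ∧
    HasDerivAt (fun t => flowMatrix hE hEc t i 1)
      ((-B * flowMatrix hE hEc t i 0 - √(2 * E) * flowMatrix hE hEc t i 1) / 2) t := by
  have h := frequency_sq hEc
  have h0 := (frequency_pos hEc).ne'
  have hs := Real.sq_sqrt (show 0 ≤ 2 * E by linarith)
  simp only [flowMatrix]
  generalize √(2 * E) = s at *
  generalize √(B ^ 2 - 2 * E) = ω at *
  have hl : HasDerivAt (fun t : ℝ => ω * t / 2) (ω / 2) t := by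
    simpa using ((hasDerivAt_id t).const_mul ω).div_const 2
  have hc := hl.cos
  have hsn := hl.sin
  fin_cases i
  · refine ⟨(hc.add (hsn.const_mul (s / ω))).congr_deriv ?_,
      (hsn.const_mul (B / ω)).neg.congr_deriv ?_⟩
    · simp
      field_simp
      linear_combination (-Real.sin (ω * t / 2)) * h - Real.sin (ω * t / 2) * hs
    · simp
      field_simp
      ring
  · refine ⟨(hsn.const_mul (B / ω)).congr_deriv ?_,
      (hc.sub (hsn.const_mul (s / ω))).congr_deriv ?_⟩
    · simp
      field_simp
      ring
    · simp
      field_simp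
      linear_combination (-Real.sin (ω * t / 2)) * h - Real.sin (ω * t / 2) * hs

open CotangentPlane

theorem isMagneticTrajectory_flowMatrix (hE : 0 < E) (hEc : E < B ^ 2 / 2) (g : SL(2, ℝ)) :
    IsMagneticTrajectory B (fun t => (g * flowMatrix hE hEc t) • upward √(2 * E)) := by
  refine isMagneticTrajectory_smul_upward fun i t => ?_
  have h0 := hasDerivAt_flowMatrix hE hEc 0 t
  have h1 := hasDerivAt_flowMatrix hE hEc 1 t
  simp only [Matrix.SpecialLinearGroup.coe_mul, Matrix.mul_apply, Fin.sum_univ_two]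
  exact ⟨((h0.1.const_mul _).add (h1.1.const_mul _)).congr_deriv (by ring),
    ((h0.2.const_mul _).add (h1.2.const_mul _)).congr_deriv (by ring)⟩

/-- The denominator of the half-angle matrix at `i` is `exp (-iθ/2)`; its conjugate squared is `exp
(iθ)`. -/
theorem rotMatrix_smul_upward (θ s : ℝ) : rotMatrix θ • upward s = rotate θ (upward s) := by
  apply coord_injective
  rw [coord_smul_upward]
  have hc := Complex.cos_sq_add_sin_sq (θ / 2 : ℂ)
  refine Prod.ext ?_ ?_
  · simp only [rotMatrix, coord, rotate, upward]
    simp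
    have : (-(Complex.sin (θ / 2) * Complex.I) + Complex.cos (θ / 2)) ≠ 0 := by
      intro h
      have := Complex.exp_ne_zero (-(θ / 2) * Complex.I)
      rw [Complex.exp_mul_I, Complex.cos_neg, Complex.sin_neg] at this
      exact this (by linear_combination h)
    rw [div_eq_iff this]
    linear_combination Complex.sin (θ / 2) * Complex.I_sq
  · simp only [rotMatrix, coord, rotate, upward]
    rw [show (θ : ℂ) * Complex.I = (θ / 2) * Complex.I + (θ / 2) * Complex.I by ring,
      Complex.exp_add, Complex.exp_mul_I]
    simp
    left
    ring

theorem rotMatrix_smul_I (θ : ℝ) : rotMatrix θ • UpperHalfPlane.I = UpperHalfPlane.I :=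
  congrArg Prod.fst (rotMatrix_smul_upward θ 0)

/-- Transitivity on the energy surface: rotate at `i`, then move `i` to the footpoint. -/
theorem exists_smul_upward (hE : 0 < E) (q : CotangentPlane) (hq : hamiltonian (coord q) = E) :
    ∃ g : SL(2, ℝ), g • upward √(2 * E) = q := by
  have hs : 0 < √(2 * E) := Real.sqrt_pos.2 (by linarith)
  have hy := q.1.im_pos
  have hn : q.1.im * ‖q.2‖ = √(2 * E) := by
    have hq' : 1 / 2 * (q.1.im ^ 2 * ‖q.2‖ ^ 2) = E := hq
    have h0 : 0 ≤ q.1.im * ‖q.2‖ := by positivity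
    rw [show 2 * E = (q.1.im * ‖q.2‖) ^ 2 by rw [← hq']; ring, Real.sqrt_sq h0]
  -- `toSL2R` divides covectors at `i` by the height of the footpoint, so `w` is the factor by which
  -- `upward` must be turned beforehand. It has modulus one because the energy is `E`.
  set w : ℂ := q.2 * q.1.im / (√(2 * E) * Complex.I) with hw
  have hnw : ‖w‖ = 1 := by
    simp only [hw, norm_div, norm_mul, Complex.norm_real, Complex.norm_I, Real.norm_eq_abs,
      abs_of_pos hy, abs_of_pos hs]
    rw [mul_comm, hn, mul_one, div_self hs.ne']
  have hexp : Complex.exp (w.arg * Complex.I) = w := by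
    have := Complex.norm_mul_exp_arg_mul_I w
    rwa [hnw, Complex.ofReal_one, one_mul] at this
  refine ⟨q.1.toSL2R * rotMatrix w.arg, ?_⟩
  rw [mul_smul, rotMatrix_smul_upward]
  refine Prod.ext ?_ ?_
  · exact UpperHalfPlane.toSL2R_smul_I q.1
  · change conj (UpperHalfPlane.denom (q.1.toSL2R : GL (Fin 2) ℝ) UpperHalfPlane.I) ^ 2 *
      (Complex.exp (w.arg * Complex.I) * (√(2 * E) * Complex.I)) = q.2
    have hsq : ((√q.1.im : ℝ) : ℂ) ^ 2 = q.1.im := by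
      rw [← Complex.ofReal_pow, Real.sq_sqrt hy.le]
    have hd : conj (UpperHalfPlane.denom (q.1.toSL2R : GL (Fin 2) ℝ) UpperHalfPlane.I) ^ 2 =
        1 / (q.1.im : ℂ) := by
      simp [UpperHalfPlane.denom, hsq]
    have hsC : (√(2 * E) : ℂ) ≠ 0 := by exact_mod_cast hs.ne'
    have hyC : (q.1.im : ℂ) ≠ 0 := by exact_mod_cast hy.ne'
    rw [hd, hexp, hw, div_mul_cancel₀ _ (mul_ne_zero hsC Complex.I_ne_zero)]
    field_simp

/-- The footpoint of the trajectory with angle `θ` at time `t`, for the upward covector at `i`. -/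
noncomputable def orbitPoint (hE : 0 < E) (hEc : E < B ^ 2 / 2) (q : ℝ × ℝ) : ℍ :=
  (rotMatrix q.1 * flowMatrix hE hEc q.2) • UpperHalfPlane.I

variable {Γ : Subgroup SL(2, ℝ)}

/-- The trajectory chosen in `magneticFlow` may start at another lift `γ g • upward`. By uniqueness
it is the orbit of `γ g`, and `γ` disappears in the quotient. -/
theorem CotangentSurface.magneticFlow_proj (hE : 0 < E) (hEc : E < B ^ 2 / 2) (g : SL(2, ℝ))
    (t : ℝ) :
    magneticFlow B t (proj Γ (g • upward √(2 * E))) =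
      proj Γ ((g * flowMatrix hE hEc t) • upward √(2 * E)) := by
  have hex : ∃ c : ℝ → CotangentPlane, CotangentPlane.IsMagneticTrajectory B c ∧
      proj Γ (c 0) = proj Γ (g • upward √(2 * E)) :=
    ⟨_, isMagneticTrajectory_flowMatrix hE hEc g, by simp [flowMatrix_zero]⟩
  rw [magneticFlow, dif_pos hex]
  obtain ⟨hc, hc0⟩ := hex.choose_spec
  obtain ⟨⟨γ, hγ⟩, h⟩ := Quotient.exact hc0
  have h : (γ * g) • upward √(2 * E) = hex.choose 0 := by
    rw [mul_smul]
    exact h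
  rw [hc.eq (isMagneticTrajectory_flowMatrix hE hEc (γ * g)) (by rw [flowMatrix_zero, mul_one, h])]
  exact Quotient.sound ⟨⟨γ, hγ⟩, by simp only [mul_smul]; rfl⟩

/-- A covector at `x₀` with energy `E` lifts to a translate of the upward covector. -/
theorem exists_lift (hE : 0 < E) {z₀ : ℍ} {ξ₀ : CotangentSurface Γ}
    (hξ₀ : ξ₀.footpoint = Surface.proj Γ z₀) (hξ₀E : ξ₀.energy = E) :
    ∃ g : SL(2, ℝ), g • UpperHalfPlane.I = z₀ ∧
      CotangentSurface.proj Γ (g • upward √(2 * E)) = ξ₀ := by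
  obtain ⟨q, rfl⟩ := Quotient.exists_rep ξ₀
  obtain ⟨γ, hγ, h⟩ := Surface.proj_eq_iff.1 hξ₀.symm
  obtain ⟨g, hg⟩ := exists_smul_upward hE q hξ₀E
  refine ⟨γ * g, ?_, Quotient.sound ⟨⟨γ, hγ⟩, ?_⟩⟩
  · rw [← h, ← hg, mul_smul]
    rfl
  · rw [mul_smul, hg]
    rfl

theorem torusMap_eq (hE : 0 < E) (hEc : E < B ^ 2 / 2) (g : SL(2, ℝ)) (q : ℝ × ℝ) :
    torusMap B (CotangentSurface.proj Γ (g • upward √(2 * E))) q =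
      CotangentSurface.proj Γ ((g * (rotMatrix q.1 * flowMatrix hE hEc q.2)) • upward √(2 * E)) := by
  rw [← mul_assoc, ← CotangentSurface.magneticFlow_proj, mul_smul, rotMatrix_smul_upward, torusMap,
    ← rotate_smul]
  rfl

theorem footpoint_torusMap (hE : 0 < E) (hEc : E < B ^ 2 / 2) (g : SL(2, ℝ)) (q : ℝ × ℝ) :
    (torusMap B (CotangentSurface.proj Γ (g • upward √(2 * E))) q).footpoint =
      Surface.proj Γ (g • orbitPoint hE hEc q) := by
  rw [torusMap_eq hE hEc, orbitPoint, ← mul_smul]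
  rfl

theorem continuous_rotMatrix_mul_flowMatrix (hE : 0 < E) (hEc : E < B ^ 2 / 2) :
    Continuous fun q : ℝ × ℝ => rotMatrix q.1 * flowMatrix hE hEc q.2 := by
  have h1 : Continuous fun q : ℝ × ℝ => rotMatrix q.1 := by
    refine Continuous.subtype_mk (continuous_matrix fun i j => ?_) _
    fin_cases i <;> fin_cases j <;> simp <;> fun_prop
  have h2 : Continuous fun q : ℝ × ℝ => flowMatrix hE hEc q.2 := by
    refine Continuous.subtype_mk (continuous_matrix fun i j => ?_) _
    fin_cases i <;> fin_cases j <;> simp <;> fun_prop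
  exact h1.mul h2

theorem continuous_orbitPoint (hE : 0 < E) (hEc : E < B ^ 2 / 2) :
    Continuous (orbitPoint hE hEc) :=
  (continuous_rotMatrix_mul_flowMatrix hE hEc).smul continuous_const

theorem continuous_torusMap (hE : 0 < E) (hEc : E < B ^ 2 / 2) (g : SL(2, ℝ)) :
    Continuous (torusMap B (CotangentSurface.proj Γ (g • upward √(2 * E)))) := by
  rw [funext (torusMap_eq hE hEc g)]
  refine continuous_quotient_mk'.comp ?_
  have h := (continuous_const (y := g)).mul (continuous_rotMatrix_mul_flowMatrix hE hEc)
  have hent : ∀ i j, Continuous fun q : ℝ × ℝ =>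
      (g * (rotMatrix q.1 * flowMatrix hE hEc q.2)) i j := fun i j =>
    (continuous_subtype_val.comp h).matrix_elem i j
  refine Continuous.prodMk (h.smul continuous_const) ?_
  have h0 := hent 1 0
  have h1 := hent 1 1
  refine Continuous.mul (((Complex.continuous_conj.comp ?_)).pow 2) continuous_const
  exact ((Complex.continuous_ofReal.comp h0).mul continuous_const).add
    (Complex.continuous_ofReal.comp h1)

theorem continuous_footpoint : Continuous (CotangentSurface.footpoint (Γ := Γ)) :=
  Continuous.quotient_lift (Surface.continuous_proj.comp continuous_fst) _

end

end MagneticTorus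

/-! ### The hyperboloid coordinate and rotations about `i` -/

namespace MagneticTorus

/-- The hyperboloid coordinate of `ℍ` about `i`: a diffeomorphism onto `ℂ` under which the rotations
about `i` become linear. -/
noncomputable def hyperboloidCoord (z : ℍ) : ℂ :=
  ⟨(z.re ^ 2 + z.im ^ 2 - 1) / (2 * z.im), -(z.re / z.im)⟩

theorem cosh_dist_I (z : ℍ) :
    Real.cosh (dist z UpperHalfPlane.I) = (z.re ^ 2 + z.im ^ 2 + 1) / (2 * z.im) := by
  rw [UpperHalfPlane.cosh_dist']
  simp [UpperHalfPlane.I]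

theorem norm_hyperboloidCoord_sq (z : ℍ) :
    ‖hyperboloidCoord z‖ ^ 2 = Real.cosh (dist z UpperHalfPlane.I) ^ 2 - 1 := by
  have := z.im_ne_zero
  rw [cosh_dist_I, Complex.sq_norm, Complex.normSq_apply]
  simp only [hyperboloidCoord]
  field_simp
  ring

theorem norm_hyperboloidCoord (z : ℍ) :
    ‖hyperboloidCoord z‖ = Real.sinh (dist z UpperHalfPlane.I) := by
  rw [← sq_eq_sq₀ (norm_nonneg _) (Real.sinh_nonneg_iff.2 dist_nonneg), norm_hyperboloidCoord_sq,
    Real.sinh_sq]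

/-- The norm gives `cosh d`, the remaining coordinate on the hyperboloid. Subtracting the real part
from it leaves `1 / z.im`, and the imaginary part then gives `z.re`. -/
theorem hyperboloidCoord_injective : Function.Injective hyperboloidCoord := by
  intro z w h
  have hn := congrArg (fun u : ℂ => ‖u‖) h
  simp only [norm_hyperboloidCoord] at hn
  have hd := Real.sinh_injective hn
  have hc := congrArg Real.cosh hd
  rw [cosh_dist_I, cosh_dist_I] at hc
  have hre := congrArg Complex.re h
  have him := congrArg Complex.im h
  simp only [hyperboloidCoord] at hre him
  have hz := z.im_ne_zero
  have hw := w.im_ne_zero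
  have hi : 1 / z.im = 1 / w.im := by
    have h1 : ∀ u : ℍ, 1 / u.im = (u.re ^ 2 + u.im ^ 2 + 1) / (2 * u.im) -
        (u.re ^ 2 + u.im ^ 2 - 1) / (2 * u.im) := fun u => by
      have := u.im_ne_zero
      field_simp
      ring
    rw [h1, h1, hre, hc]
  have him' : z.im = w.im := by
    rwa [one_div, one_div, inv_inj] at hi
  rw [him'] at him
  refine UpperHalfPlane.ext (Complex.ext ?_ him')
  field_simp at him
  exact neg_injective him

theorem re_im_rotMatrix_smul (θ : ℝ) (z : ℍ) :
    ∃ D > 0, D = (Real.cos (θ / 2) - Real.sin (θ / 2) * z.re) ^ 2 +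
        (Real.sin (θ / 2) * z.im) ^ 2 ∧
      (rotMatrix θ • z).re = ((Real.cos (θ / 2) * z.re + Real.sin (θ / 2)) *
        (Real.cos (θ / 2) - Real.sin (θ / 2) * z.re) -
        Real.cos (θ / 2) * Real.sin (θ / 2) * z.im ^ 2) / D ∧
      (rotMatrix θ • z).im = z.im / D := by
  have hcs := Real.cos_sq_add_sin_sq (θ / 2)
  have hcoe := UpperHalfPlane.coe_specialLinearGroup_apply (rotMatrix θ) z
  simp only [rotMatrix, Algebra.algebraMap_self, RingHom.id_apply, Matrix.of_apply,
    Matrix.cons_val', Matrix.cons_val_zero, Matrix.cons_val_one, Matrix.cons_val_fin_one] at hcoe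
  rw [← rotMatrix] at hcoe
  have hre := congrArg Complex.re hcoe
  have him := congrArg Complex.im hcoe
  rw [Complex.div_re] at hre
  rw [Complex.div_im] at him
  simp only [Complex.normSq_apply, Complex.add_re, Complex.add_im, Complex.re_ofReal_mul,
    Complex.im_ofReal_mul, Complex.ofReal_re, Complex.ofReal_im, UpperHalfPlane.coe_re,
    UpperHalfPlane.coe_im] at hre him
  have hz := z.im_pos
  generalize Real.cos (θ / 2) = C at *
  generalize Real.sin (θ / 2) = S at *
  have hD : 0 < (C - S * z.re) ^ 2 + (S * z.im) ^ 2 := by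
    by_cases hS : S = 0
    · subst hS
      nlinarith
    · positivity
  refine ⟨_, hD, rfl, hre.trans ?_, him.trans ?_⟩
  · rw [← add_div]
    congr 1 <;> ring
  · rw [← sub_div]
    congr 1
    · linear_combination z.im * hcs
    · ring

theorem hyperboloidCoord_rotMatrix_smul (θ : ℝ) (z : ℍ) :
    hyperboloidCoord (rotMatrix θ • z) = Complex.exp (θ * Complex.I) * hyperboloidCoord z := by
  obtain ⟨D, hD, hDe, hre, him⟩ := re_im_rotMatrix_smul θ z
  have hz := z.im_ne_zero
  have hcs := Real.cos_sq_add_sin_sq (θ / 2)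
  have h1 : Real.cos θ = Real.cos (θ / 2) ^ 2 - Real.sin (θ / 2) ^ 2 := by
    rw [← Real.cos_two_mul', mul_div_cancel₀ _ two_ne_zero]
  have h2 : Real.sin θ = 2 * Real.sin (θ / 2) * Real.cos (θ / 2) := by
    rw [← Real.sin_two_mul, mul_div_cancel₀ _ two_ne_zero]
  have hexp : Complex.exp (θ * Complex.I) = ⟨Real.cos θ, Real.sin θ⟩ := by
    rw [Complex.exp_mul_I, ← Complex.ofReal_cos, ← Complex.ofReal_sin, Complex.mk_eq_add_mul_I]
  rw [hexp, h1, h2]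
  simp only [hyperboloidCoord, hre, him]
  generalize Real.cos (θ / 2) = C at *
  generalize Real.sin (θ / 2) = S at *
  -- Multiplicativity of the squared modulus for `(C z + S) * conj (C - S z)`, whose imaginary part
  -- is `z.im`.
  have hnum : ((C * z.re + S) * (C - S * z.re) - C * S * z.im ^ 2) ^ 2 + z.im ^ 2 =
      D * ((C * z.re + S) ^ 2 + (C * z.im) ^ 2) := by
    rw [hDe]
    linear_combination (-z.im ^ 2 * (C ^ 2 + S ^ 2 + 1)) * hcs
  refine Complex.ext ?_ ?_
  · simp only [Complex.mul_re]
    have : (((C * z.re + S) * (C - S * z.re) - C * S * z.im ^ 2) / D) ^ 2 + (z.im / D) ^ 2 - 1 =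
      (((C * z.re + S) ^ 2 + (C * z.im) ^ 2) - D) / D := by
      rw [div_pow, div_pow, ← add_div, hnum]
      field_simp
    rw [this]
    field_simp
    rw [hDe]
    ring
  · simp only [Complex.mul_im]
    field_simp
    ring

theorem cosh_dist_smul_I (g : SL(2, ℝ)) :
    Real.cosh (dist (g • UpperHalfPlane.I) UpperHalfPlane.I) =
      (g 0 0 ^ 2 + g 0 1 ^ 2 + g 1 0 ^ 2 + g 1 1 ^ 2) / 2 := by
  have hcoe := UpperHalfPlane.coe_specialLinearGroup_apply g UpperHalfPlane.I
  simp only [Algebra.algebraMap_self, RingHom.id_apply, UpperHalfPlane.coe_I] at hcoe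
  have hre := congrArg Complex.re hcoe
  have him := congrArg Complex.im hcoe
  rw [Complex.div_re] at hre
  rw [Complex.div_im] at him
  simp only [Complex.normSq_apply, Complex.add_re, Complex.add_im, Complex.re_ofReal_mul,
    Complex.im_ofReal_mul, Complex.ofReal_re, Complex.ofReal_im, UpperHalfPlane.coe_re,
    UpperHalfPlane.coe_im, Complex.I_re, Complex.I_im, mul_zero, mul_one, zero_add, add_zero]
    at hre him
  have hdet := g.det_coe
  rw [Matrix.det_fin_two] at hdet
  rw [cosh_dist_I, hre, him]
  generalize g 0 0 = a at *
  generalize g 0 1 = b at *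
  generalize g 1 0 = c at *
  generalize g 1 1 = d at *
  have hn : 0 < d * d + c * c := by
    by_contra! h
    have hc : c = 0 := by nlinarith
    have hd : d = 0 := by nlinarith
    simp [hc, hd] at hdet
  rw [← add_div, ← sub_div, div_pow, div_pow, hdet]
  obtain ⟨n, hnn⟩ : ∃ n, n = d * d + c * c := ⟨_, rfl⟩
  rw [← hnn] at hn ⊢
  field_simp
  subst hnn
  linear_combination (-(a * d - b * c + 1)) * hdet

/-! ### Orbits as polar coordinates on the punctured disk -/

section

variable {B E : ℝ}

/-- The rotation fixes `i`, so only `flowMatrix` matters, and the sum of the squares of its entries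
is elementary trigonometry. This formula underlies both the density and the radial Jacobian. -/
theorem cosh_dist_orbitPoint (hE : 0 < E) (hEc : E < B ^ 2 / 2) (q : ℝ × ℝ) :
    Real.cosh (dist (orbitPoint hE hEc q) UpperHalfPlane.I) =
      1 + 2 * E / (B ^ 2 - 2 * E) * (1 - Real.cos (√(B ^ 2 - 2 * E) * q.2)) := by
  have hrot : dist (orbitPoint hE hEc q) UpperHalfPlane.I =
      dist (flowMatrix hE hEc q.2 • UpperHalfPlane.I) UpperHalfPlane.I := by
    conv_lhs => rw [orbitPoint, mul_smul, ← rotMatrix_smul_I q.1, dist_smul, rotMatrix_smul_I]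
  rw [hrot, cosh_dist_smul_I]
  have hcos : Real.cos (√(B ^ 2 - 2 * E) * q.2) =
      Real.cos (√(B ^ 2 - 2 * E) * q.2 / 2) ^ 2 - Real.sin (√(B ^ 2 - 2 * E) * q.2 / 2) ^ 2 := by
    rw [← Real.cos_two_mul', mul_div_cancel₀ _ two_ne_zero]
  rw [hcos]
  simp only [flowMatrix, Matrix.of_apply, Matrix.cons_val', Matrix.cons_val_zero,
    Matrix.cons_val_one, Matrix.cons_val_fin_one]
  have h := frequency_sq hEc
  have h0 := (frequency_pos hEc).ne'
  have hs := Real.sq_sqrt (show 0 ≤ 2 * E by linarith)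
  have hcs := Real.cos_sq_add_sin_sq (√(B ^ 2 - 2 * E) * q.2 / 2)
  generalize √(2 * E) = s at *
  generalize √(B ^ 2 - 2 * E) = ω at *
  generalize Real.cos (ω * q.2 / 2) = C at *
  generalize Real.sin (ω * q.2 / 2) = S at *
  rw [← h]
  field_simp
  first
  | linear_combination S ^ 2 * hs - S ^ 2 * h + (ω ^ 2 + 2 * E) * hcs
  | linear_combination 2 * (S ^ 2 * hs - S ^ 2 * h + (ω ^ 2 + 2 * E) * hcs)

theorem hyperboloidCoord_orbitPoint (hE : 0 < E) (hEc : E < B ^ 2 / 2) (θ t : ℝ) :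
    hyperboloidCoord (orbitPoint hE hEc (θ, t)) =
      Complex.exp (θ * Complex.I) *
        hyperboloidCoord (flowMatrix hE hEc t • UpperHalfPlane.I) := by
  rw [orbitPoint, mul_smul, hyperboloidCoord_rotMatrix_smul]

theorem cosh_radius (hE : 0 < E) (hEc : E < B ^ 2 / 2) :
    Real.cosh (radius B E) = 1 + 2 * E / (B ^ 2 - 2 * E) * 2 := by
  have h : 0 < B ^ 2 - 2 * E := by linarith
  rw [radius, Real.cosh_arcosh]
  · field_simp
    ring
  · rw [one_le_div h]
    linarith

theorem radius_pos (hE : 0 < E) (hEc : E < B ^ 2 / 2) : 0 < radius B E := by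
  have h : 0 < B ^ 2 - 2 * E := by linarith
  rw [radius]
  refine Real.arcosh_pos ?_
  rw [one_lt_div h]
  linarith

theorem period_pos (hEc : E < B ^ 2 / 2) : 0 < period B E :=
  div_pos Real.two_pi_pos (frequency_pos hEc)

/-- The cosine of the phase at which a trajectory is at distance `d` from its starting point. -/
noncomputable def cosPhase (B E d : ℝ) : ℝ := 1 - (Real.cosh d - 1) * (B ^ 2 - 2 * E) / (2 * E)

theorem cosPhase_dist_orbitPoint (hE : 0 < E) (hEc : E < B ^ 2 / 2) (q : ℝ × ℝ) :
    cosPhase B E (dist (orbitPoint hE hEc q) UpperHalfPlane.I) =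
      Real.cos (√(B ^ 2 - 2 * E) * q.2) := by
  have h : B ^ 2 - 2 * E ≠ 0 := by linarith
  rw [cosPhase, cosh_dist_orbitPoint]
  field_simp
  ring

/-- `cosPhase` is affine and decreasing in `cosh d`, with value `1` at `d = 0` and `-1` at `d =
R_E`. -/
theorem cosPhase_mem_Ioo_iff (hE : 0 < E) (hEc : E < B ^ 2 / 2) {d : ℝ} (hd : 0 ≤ d) :
    cosPhase B E d ∈ Ioo (-1) 1 ↔ 0 < d ∧ d < radius B E := by
  have h : 0 < B ^ 2 - 2 * E := by linarith
  have hR := (radius_pos hE hEc).le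
  have h1 : 0 < d ↔ 1 < Real.cosh d := by rw [Real.one_lt_cosh, lt_iff_le_and_ne, ne_comm]; simp [hd]
  have h2 : d < radius B E ↔ Real.cosh d < Real.cosh (radius B E) := by
    rw [Real.cosh_lt_cosh, abs_of_nonneg hd, abs_of_nonneg hR]
  rw [h1, h2, cosh_radius hE hEc, cosPhase, mem_Ioo, and_comm]
  refine and_congr ?_ ?_
  · rw [sub_lt_self_iff]
    rw [div_pos_iff_of_pos_right (by positivity), mul_pos_iff_of_pos_right h, sub_pos]
  · rw [neg_lt_sub_iff_lt_add, div_lt_iff₀ (by positivity), ← sub_pos (b := Real.cosh d),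
      show 1 + 2 * E / (B ^ 2 - 2 * E) * 2 - Real.cosh d =
        ((1 + 1) * (2 * E) - (Real.cosh d - 1) * (B ^ 2 - 2 * E)) / (B ^ 2 - 2 * E) by
          field_simp; ring,
      div_pos_iff_of_pos_right h, sub_pos]

theorem cosPhase_injOn (hE : 0 < E) (hEc : E < B ^ 2 / 2) : InjOn (cosPhase B E) (Ici 0) := by
  have h : 0 < B ^ 2 - 2 * E := by linarith
  intro d hd d' hd' hdd
  simp only [cosPhase, sub_right_inj] at hdd
  rw [div_left_inj' (by positivity), mul_left_inj' h.ne', sub_left_inj] at hdd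
  exact Real.cosh_injOn hd hd' hdd

theorem bijOn_cos_first (hEc : E < B ^ 2 / 2) :
    BijOn (fun t => Real.cos (√(B ^ 2 - 2 * E) * t)) (Ioo 0 (period B E / 2)) (Ioo (-1) 1) := by
  have hω := frequency_pos hEc
  have hT : √(B ^ 2 - 2 * E) * (period B E / 2) = Real.pi := by
    rw [period]
    field_simp
  refine ⟨fun t ht => ?_, fun t ht t' ht' h => ?_, fun c hc => ?_⟩
  · have h0 := mul_pos hω ht.1
    have h1 := hT ▸ mul_lt_mul_of_pos_left ht.2 hω
    constructor
    · rw [← Real.cos_pi]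
      exact Real.strictAntiOn_cos ⟨h0.le, h1.le⟩ ⟨Real.pi_pos.le, le_rfl⟩ h1
    · rw [← Real.cos_zero]
      exact Real.strictAntiOn_cos ⟨le_rfl, Real.pi_pos.le⟩ ⟨h0.le, h1.le⟩ h0
  · refine mul_left_cancel₀ hω.ne' (Real.injOn_cos ⟨?_, ?_⟩ ⟨?_, ?_⟩ h)
    · exact (mul_pos hω ht.1).le
    · exact (hT ▸ mul_lt_mul_of_pos_left ht.2 hω).le
    · exact (mul_pos hω ht'.1).le
    · exact (hT ▸ mul_lt_mul_of_pos_left ht'.2 hω).le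
  · refine ⟨Real.arccos c / √(B ^ 2 - 2 * E), ⟨div_pos (Real.arccos_pos.2 hc.2) hω, ?_⟩, ?_⟩
    · rw [div_lt_iff₀ hω, mul_comm, hT]
      exact lt_of_le_of_ne (Real.arccos_le_pi c) fun h => hc.1.not_ge (Real.arccos_eq_pi.1 h)
    · simp only [mul_div_cancel₀ _ hω.ne']
      exact Real.cos_arccos hc.1.le hc.2.le

/-- The reflection `t ↦ T_E - t` preserves the cosine of the phase and swaps the two half periods.
-/
theorem bijOn_cos_second (hEc : E < B ^ 2 / 2) :
    BijOn (fun t => Real.cos (√(B ^ 2 - 2 * E) * t)) (Ioo (period B E / 2) (period B E))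
      (Ioo (-1) 1) := by
  have hT : √(B ^ 2 - 2 * E) * period B E = 2 * Real.pi := by
    rw [period, mul_div_cancel₀ _ (frequency_pos hEc).ne']
  have hrefl : BijOn (fun t => period B E - t) (Ioo (period B E / 2) (period B E))
      (Ioo 0 (period B E / 2)) := by
    refine ⟨fun t ht => ⟨by linarith [ht.2], by linarith [ht.1]⟩, fun t _ t' _ h => ?_,
      fun t ht => ⟨period B E - t, ⟨by linarith [ht.2], by linarith [ht.1]⟩, by simp⟩⟩
    simpa using h
  refine ((bijOn_cos_first hEc).comp hrefl).congr fun t _ => ?_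
  simp only [Function.comp, mul_sub, hT, Real.cos_two_pi_sub]

theorem exists_exp_eq {w : ℂ} (hw : ‖w‖ = 1) :
    ∃ θ ∈ Ico 0 (2 * Real.pi), Complex.exp (θ * Complex.I) = w := by
  have h := Complex.norm_mul_exp_arg_mul_I w
  rw [hw, Complex.ofReal_one, one_mul] at h
  have h1 := Complex.neg_pi_lt_arg w
  have h2 := Complex.arg_le_pi w
  have hpi := Real.pi_pos
  rcases le_or_gt 0 w.arg with h0 | h0
  · exact ⟨w.arg, ⟨h0, by linarith⟩, h⟩
  · refine ⟨w.arg + 2 * Real.pi, ⟨by linarith, by linarith⟩, ?_⟩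
    push_cast
    rw [add_mul, Complex.exp_add, h, Complex.exp_two_pi_mul_I, mul_one]

theorem exp_injOn : InjOn (fun θ : ℝ => Complex.exp (θ * Complex.I)) (Ico 0 (2 * Real.pi)) := by
  intro θ hθ θ' hθ' h
  obtain ⟨n, hn⟩ := Complex.exp_eq_exp_iff_exists_int.1 h
  have hn' : θ = θ' + n * (2 * Real.pi) := by
    have := congrArg Complex.im hn
    simpa using this
  have hpi := Real.pi_pos
  have h1 : (n : ℝ) < 1 := by
    by_contra! hge
    nlinarith [hθ.2, hθ'.1]
  have h2 : (-1 : ℝ) < n := by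
    by_contra! hge
    nlinarith [hθ.1, hθ'.2]
  have : n = 0 := by
    have h1' : n < 1 := by exact_mod_cast h1
    have h2' : -1 < n := by exact_mod_cast h2
    omega
  simpa [this] using hn'

/-- The phase determines the distance and the rotation supplies the angle. `J` stands for either
half period. -/
theorem bijOn_orbitPoint (hE : 0 < E) (hEc : E < B ^ 2 / 2) {J : Set ℝ}
    (hJ : BijOn (fun t => Real.cos (√(B ^ 2 - 2 * E) * t)) J (Ioo (-1) 1)) :
    BijOn (orbitPoint hE hEc) (Ico 0 (2 * Real.pi) ×ˢ J)
      {v | 0 < dist v UpperHalfPlane.I ∧ dist v UpperHalfPlane.I < radius B E} := by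
  have hmem : ∀ v : ℍ, v ∈ {v | 0 < dist v UpperHalfPlane.I ∧ dist v UpperHalfPlane.I < radius B E} ↔
      cosPhase B E (dist v UpperHalfPlane.I) ∈ Ioo (-1) 1 := fun v =>
    (cosPhase_mem_Ioo_iff hE hEc dist_nonneg).symm
  have hmaps : MapsTo (orbitPoint hE hEc) (Ico 0 (2 * Real.pi) ×ˢ J)
      {v | 0 < dist v UpperHalfPlane.I ∧ dist v UpperHalfPlane.I < radius B E} := by
    rintro q ⟨-, hq⟩
    rw [hmem, cosPhase_dist_orbitPoint]
    exact hJ.mapsTo hq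
  refine ⟨hmaps, ?_, ?_⟩
  · rintro ⟨θ, t⟩ ⟨hθ, ht⟩ ⟨θ', t'⟩ ⟨hθ', ht'⟩ h
    have hc := congrArg (fun v => cosPhase B E (dist v UpperHalfPlane.I)) h
    simp only [cosPhase_dist_orbitPoint] at hc
    obtain rfl : t = t' := hJ.injOn ht ht' hc
    have hW := congrArg hyperboloidCoord h
    rw [hyperboloidCoord_orbitPoint, hyperboloidCoord_orbitPoint] at hW
    have hne : hyperboloidCoord (flowMatrix hE hEc t • UpperHalfPlane.I) ≠ 0 := by
      have h0 := (hmaps (show ((0 : ℝ), t) ∈ _ from ⟨⟨le_rfl, Real.two_pi_pos⟩, ht⟩)).1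
      have h1 := hyperboloidCoord_orbitPoint hE hEc 0 t
      intro h2
      rw [h2, mul_zero, ← norm_eq_zero, norm_hyperboloidCoord, Real.sinh_eq_zero] at h1
      exact h0.ne' h1
    rw [Prod.mk.injEq]
    exact ⟨exp_injOn hθ hθ' (mul_right_cancel₀ hne hW), rfl⟩
  · intro v hv
    obtain ⟨t, ht, htv⟩ := hJ.surjOn ((hmem v).1 hv)
    have h1 := cosPhase_dist_orbitPoint hE hEc (0, t)
    simp only at htv h1
    rw [htv] at h1
    have hd := cosPhase_injOn hE hEc dist_nonneg dist_nonneg h1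
    have h2 := hyperboloidCoord_orbitPoint hE hEc 0 t
    have hv0 : ‖hyperboloidCoord v‖ ≠ 0 := by
      rw [norm_hyperboloidCoord]
      exact (Real.sinh_pos_iff.2 hv.1).ne'
    have hn : ‖hyperboloidCoord v‖ =
        ‖hyperboloidCoord (flowMatrix hE hEc t • UpperHalfPlane.I)‖ := by
      rw [norm_hyperboloidCoord, ← hd, ← norm_hyperboloidCoord, h2]
      simp
    obtain ⟨θ, hθ, hexp⟩ := exists_exp_eq (w := hyperboloidCoord v /
      hyperboloidCoord (flowMatrix hE hEc t • UpperHalfPlane.I)) (by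
        rw [norm_div, ← hn, div_self hv0])
    refine ⟨(θ, t), ⟨hθ, ht⟩, hyperboloidCoord_injective ?_⟩
    rw [hyperboloidCoord_orbitPoint, hexp, div_mul_cancel₀]
    rw [← norm_ne_zero_iff, ← hn]
    exact hv0

/-! ### The density as a sum over lifts -/

/-- The contribution to the density of a lift at distance `d ∈ (0, R)` from the center. -/
noncomputable def profile (B E d : ℝ) : ℝ :=
  √(B ^ 2 - 2 * E) / (E * √(1 - cosPhase B E d ^ 2))

variable {Γ : Subgroup SL(2, ℝ)}

/-- The lifts of `y` in the punctured open disk of radius `R_E` about `z₀`. -/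
def interiorLifts (B E : ℝ) (z₀ : ℍ) (y : Surface Γ) : Set ℍ :=
  {v | Surface.proj Γ v = y ∧ 0 < dist v z₀ ∧ dist v z₀ < radius B E}

theorem finite_interiorLifts (hΓ : IsClosedSurfaceGroup Γ) (z₀ : ℍ) (y : Surface Γ) :
    (interiorLifts B E z₀ y).Finite :=
  (Surface.finite_lifts hΓ y z₀ (radius B E)).subset fun _ h => ⟨h.1, h.2.2.le⟩

theorem bijOn_smul_orbitPoint (hE : 0 < E) (hEc : E < B ^ 2 / 2) {J : Set ℝ}
    (hJ : BijOn (fun t => Real.cos (√(B ^ 2 - 2 * E) * t)) J (Ioo (-1) 1)) (g : SL(2, ℝ))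
    (y : Surface Γ) :
    BijOn (fun q => g • orbitPoint hE hEc q)
      {q | q ∈ Ico 0 (2 * Real.pi) ×ˢ J ∧ Surface.proj Γ (g • orbitPoint hE hEc q) = y}
      (interiorLifts B E (g • UpperHalfPlane.I) y) := by
  have h := bijOn_orbitPoint hE hEc hJ
  refine ⟨fun q hq => ⟨hq.2, ?_⟩, fun q hq q' hq' hqq => h.injOn hq.1 hq'.1 ?_, fun v hv => ?_⟩
  · simp only [dist_smul]
    exact h.mapsTo hq.1
  · exact MulAction.injective g hqq
  · have hd : dist (g⁻¹ • v) UpperHalfPlane.I = dist v (g • UpperHalfPlane.I) := by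
      rw [← dist_smul g, smul_inv_smul]
    obtain ⟨q, hq, hqv⟩ := h.surjOn (show g⁻¹ • v ∈ _ by
      rw [mem_ofPred_eq, hd]
      exact hv.2)
    have hqv' : g • orbitPoint hE hEc q = v := by rw [hqv, smul_inv_smul]
    exact ⟨q, ⟨hq, hqv' ▸ hv.1⟩, hqv'⟩

open CotangentPlane

theorem preimages_eq (hE : 0 < E) (hEc : E < B ^ 2 / 2) (g : SL(2, ℝ)) (y : Surface Γ) :
    preimages B E (CotangentSurface.proj Γ (g • upward √(2 * E))) y =
      {q | q ∈ Ico 0 (2 * Real.pi) ×ˢ Ioo 0 (period B E / 2) ∧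
        Surface.proj Γ (g • orbitPoint hE hEc q) = y} ∪
      {q | q ∈ Ico 0 (2 * Real.pi) ×ˢ Ioo (period B E / 2) (period B E) ∧
        Surface.proj Γ (g • orbitPoint hE hEc q) = y} := by
  have hT := period_pos hEc
  ext q
  simp only [preimages, footpoint_torusMap hE hEc, mem_ofPred_eq, mem_union, mem_prod, mem_Ioo]
  constructor
  · rintro ⟨h1, ⟨h2, h3⟩, h4, h5⟩
    rcases lt_or_gt_of_ne h4 with h | h
    · exact .inl ⟨⟨h1, h2, h⟩, h5⟩
    · exact .inr ⟨⟨h1, h, h3⟩, h5⟩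
  · rintro (⟨⟨h1, h2, h3⟩, h5⟩ | ⟨⟨h1, h2, h3⟩, h5⟩)
    · exact ⟨h1, ⟨h2, by linarith⟩, h3.ne, h5⟩
    · exact ⟨h1, ⟨by linarith, h3⟩, h2.ne', h5⟩

theorem finite_preimages (hΓ : IsClosedSurfaceGroup Γ) (hE : 0 < E) (hEc : E < B ^ 2 / 2)
    (g : SL(2, ℝ)) (y : Surface Γ) :
    (preimages B E (CotangentSurface.proj Γ (g • upward √(2 * E))) y).Finite := by
  have hf := finite_interiorLifts (B := B) (E := E) hΓ (g • UpperHalfPlane.I) y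
  rw [preimages_eq hE hEc]
  exact ((bijOn_smul_orbitPoint hE hEc (bijOn_cos_first hEc) g y).finite_iff_finite.2 hf).union
    ((bijOn_smul_orbitPoint hE hEc (bijOn_cos_second hEc) g y).finite_iff_finite.2 hf)

/-- The density is a sum over the lifts of `y` in the disk of radius `R_E`. -/
theorem density_eq (hΓ : IsClosedSurfaceGroup Γ) (hE : 0 < E) (hEc : E < B ^ 2 / 2)
    (g : SL(2, ℝ)) (y : Surface Γ) :
    density B E (CotangentSurface.proj Γ (g • upward √(2 * E))) y =
      ∑ᶠ v ∈ interiorLifts B E (g • UpperHalfPlane.I) y,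
        profile B E (dist v (g • UpperHalfPlane.I)) := by
  have hf := finite_interiorLifts (B := B) (E := E) hΓ (g • UpperHalfPlane.I) y
  have h1 := bijOn_smul_orbitPoint hE hEc (bijOn_cos_first hEc) g y
  have h2 := bijOn_smul_orbitPoint hE hEc (bijOn_cos_second hEc) g y
  -- Each lift has one preimage per half period, so the total factor `2 E` cancels the prefactor of
  -- the density. Where the sine vanishes, both sides are `0` by the convention for division.
  have hval : ∀ q : ℝ × ℝ, √(B ^ 2 - 2 * E) / |Real.sin (√(B ^ 2 - 2 * E) * q.2)| =
      E * profile B E (dist (g • orbitPoint hE hEc q) (g • UpperHalfPlane.I)) := by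
    intro q
    rw [dist_smul, profile, cosPhase_dist_orbitPoint, ← Real.abs_sin_eq_sqrt_one_sub_cos_sq]
    rcases eq_or_ne |Real.sin (√(B ^ 2 - 2 * E) * q.2)| 0 with h | h
    · simp [h]
    · field_simp
  rw [density, preimages_eq hE hEc, finsum_mem_union ?_ (h1.finite_iff_finite.2 hf)
    (h2.finite_iff_finite.2 hf)]
  · rw [finsum_mem_eq_of_bijOn (g := fun v =>
      E * profile B E (dist v (g • UpperHalfPlane.I))) _ h1 fun q _ => hval q, finsum_mem_eq_of_bijOn (g := fun v =>
      E * profile B E (dist v (g • UpperHalfPlane.I))) _ h2 fun q _ => hval q,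
      ← mul_finsum_mem]
    field_simp
    ring
  · rw [Set.disjoint_left]
    rintro q ⟨⟨-, hq⟩, -⟩ ⟨⟨-, hq'⟩, -⟩
    exact lt_asymm hq.2 hq'.1

end

end MagneticTorus

/-! ### Integration in the hyperboloid coordinate -/

namespace MagneticTorus

/-- The difference of the two sides is `1 / im` of the point with coordinate `w`, and must be
positive for the inverse chart to land in `ℍ`. -/
theorem sq_lt_one_add_norm_sq (w : ℂ) : w.re < √(1 + ‖w‖ ^ 2) := by
  refine Real.lt_sqrt_of_sq_lt ?_
  rw [Complex.sq_norm, Complex.normSq_apply]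
  nlinarith [sq_nonneg w.im]

/-- The inverse of the hyperboloid coordinate. -/
noncomputable def ofHyperboloidCoord (w : ℂ) : ℍ :=
  UpperHalfPlane.mk (((-w.im / (√(1 + ‖w‖ ^ 2) - w.re) : ℝ) : ℂ) +
    ((1 / (√(1 + ‖w‖ ^ 2) - w.re) : ℝ) : ℂ) * Complex.I) (by
      have := sq_lt_one_add_norm_sq w
      have : 0 < √(1 + ‖w‖ ^ 2) - w.re := by linarith
      rw [← Complex.mk_eq_add_mul_I]
      positivity)

theorem re_ofHyperboloidCoord (w : ℂ) :
    (ofHyperboloidCoord w).re = -w.im / (√(1 + ‖w‖ ^ 2) - w.re) := by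
  change (((-w.im / (√(1 + ‖w‖ ^ 2) - w.re) : ℝ) : ℂ) +
    ((1 / (√(1 + ‖w‖ ^ 2) - w.re) : ℝ) : ℂ) * Complex.I).re = _
  rw [← Complex.mk_eq_add_mul_I]

theorem im_ofHyperboloidCoord (w : ℂ) :
    (ofHyperboloidCoord w).im = 1 / (√(1 + ‖w‖ ^ 2) - w.re) := by
  change (((-w.im / (√(1 + ‖w‖ ^ 2) - w.re) : ℝ) : ℂ) +
    ((1 / (√(1 + ‖w‖ ^ 2) - w.re) : ℝ) : ℂ) * Complex.I).im = _
  rw [← Complex.mk_eq_add_mul_I]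

theorem continuous_ofHyperboloidCoord : Continuous ofHyperboloidCoord := by
  have hne : ∀ w : ℂ, √(1 + ‖w‖ ^ 2) - w.re ≠ 0 := fun w =>
    (sub_pos.2 (sq_lt_one_add_norm_sq w)).ne'
  refine Continuous.upperHalfPlaneMk ?_ _
  refine (Complex.continuous_ofReal.comp ?_).add ((Complex.continuous_ofReal.comp ?_).mul
    continuous_const)
  · exact Complex.continuous_im.neg.div (by fun_prop) hne
  · exact continuous_const.div (by fun_prop) hne

theorem hyperboloidCoord_ofHyperboloidCoord (w : ℂ) :
    hyperboloidCoord (ofHyperboloidCoord w) = w := by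
  have hne : √(1 + ‖w‖ ^ 2) - w.re ≠ 0 := (sub_pos.2 (sq_lt_one_add_norm_sq w)).ne'
  have hsq : √(1 + ‖w‖ ^ 2) ^ 2 = 1 + (w.re * w.re + w.im * w.im) := by
    rw [Real.sq_sqrt (by positivity), Complex.sq_norm, Complex.normSq_apply]
  refine Complex.ext ?_ ?_
  · simp only [hyperboloidCoord, re_ofHyperboloidCoord, im_ofHyperboloidCoord]
    field_simp
    linear_combination -hsq
  · simp only [hyperboloidCoord, re_ofHyperboloidCoord, im_ofHyperboloidCoord]
    field_simp

theorem ofHyperboloidCoord_hyperboloidCoord (z : ℍ) :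
    ofHyperboloidCoord (hyperboloidCoord z) = z :=
  hyperboloidCoord_injective (hyperboloidCoord_ofHyperboloidCoord _)

/-- The hyperboloid coordinate as a map of the complex plane. -/
noncomputable def hyperboloidChart (w : ℂ) : ℂ :=
  ((w.re ^ 2 + w.im ^ 2 - 1) / (2 * w.im)) • (1 : ℂ) + (-(w.re / w.im)) • Complex.I

theorem hyperboloidChart_coe (z : ℍ) : hyperboloidChart z = hyperboloidCoord z := by
  refine Complex.ext ?_ ?_ <;>
    simp [-Complex.real_smul, Complex.smul_re, Complex.smul_im, hyperboloidChart, hyperboloidCoord]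

/-- On `ℍ` the Jacobian is `cosh d(·, i)` times the density `1 / im²` of the hyperbolic area. -/
theorem hasFDerivAt_hyperboloidChart {w : ℂ} (hw : w.im ≠ 0) :
    ∃ L : ℂ →L[ℝ] ℂ, HasFDerivAt hyperboloidChart L w ∧
      L.det = (w.re ^ 2 + w.im ^ 2 + 1) / (2 * w.im) / w.im ^ 2 := by
  have hre : HasFDerivAt Complex.re Complex.reCLM w := Complex.reCLM.hasFDerivAt
  have him : HasFDerivAt Complex.im Complex.imCLM w := Complex.imCLM.hasFDerivAt
  have h1 := (((hre.pow 2).add (him.pow 2)).sub_const 1).mul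
    ((hasDerivAt_inv (mul_ne_zero two_ne_zero hw)).comp_hasFDerivAt w (him.const_mul 2))
  have h2 := (hre.mul ((hasDerivAt_inv hw).comp_hasFDerivAt w him)).neg
  refine ⟨_, (h1.smul_const (1 : ℂ)).add (h2.smul_const Complex.I), ?_⟩
  rw [ContinuousLinearMap.det, ← LinearMap.det_toMatrix Complex.basisOneI, Matrix.det_fin_two]
  simp [-Complex.real_smul, LinearMap.toMatrix_apply]
  field_simp
  ring

theorem lintegral_volume_eq (f : ℍ → ENNReal) :
    ∫⁻ z : ℍ, f z = ∫⁻ w in {w : ℂ | 0 < w.im},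
      ENNReal.ofReal (1 / w.im ^ 2) * f (UpperHalfPlane.ofComplex w) := by
  have hrange : range UpperHalfPlane.coe = {w : ℂ | 0 < w.im} := by
    ext w
    exact ⟨by rintro ⟨z, rfl⟩; exact z.im_pos, fun h => ⟨⟨w, h⟩, rfl⟩⟩
  have hmp : MeasurePreserving UpperHalfPlane.coe (volume.comap UpperHalfPlane.coe)
      (volume.restrict {w : ℂ | 0 < w.im}) :=
    ⟨UpperHalfPlane.measurable_coe, by
      rw [UpperHalfPlane.measurableEmbedding_coe.map_comap, hrange]⟩
  have hmeas : Measurable fun z : ℍ => (1 / NNReal.mk z.im z.im_pos.le : NNReal) ^ 2 := by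
    refine Continuous.measurable (.pow (.div₀ continuous_const ?_ ?_) _)
    · exact UpperHalfPlane.continuous_im.subtype_mk _
    · exact fun x ↦ NNReal.ne_iff.mp x.im_ne_zero
  rw [UpperHalfPlane.volume_def, lintegral_withDensity_eq_lintegral_mul_non_measurable _
      hmeas.coe_nnreal_ennreal (.of_forall fun _ => ENNReal.coe_lt_top),
    ← hmp.lintegral_comp_emb UpperHalfPlane.measurableEmbedding_coe]
  refine lintegral_congr fun z => ?_
  rw [UpperHalfPlane.ofComplex_apply, Pi.mul_apply]
  congr 1
  rw [ENNReal.ofReal, ENNReal.coe_inj]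
  ext
  have hz := z.im_pos
  rw [Real.coe_toNNReal _ (by simp only [UpperHalfPlane.coe_im]; positivity)]
  simp

/-- The Lebesgue measure in the hyperboloid coordinate is `cosh d(·, i)` times the area. -/
theorem lintegral_hyperboloidCoord (h : ℂ → ENNReal) :
    ∫⁻ w : ℂ, h w = ∫⁻ z : ℍ, ENNReal.ofReal (Real.cosh (dist z UpperHalfPlane.I)) *
      h (hyperboloidCoord z) := by
  have hS : MeasurableSet {w : ℂ | 0 < w.im} :=
    (isOpen_lt continuous_const Complex.continuous_im).measurableSet
  choose! L hL hdet using fun (w : ℂ) (hw : w.im ≠ 0) => hasFDerivAt_hyperboloidChart hw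
  have hcoe : ∀ w ∈ {w : ℂ | 0 < w.im}, ∃ z : ℍ, (z : ℂ) = w := fun w hw => ⟨⟨w, hw⟩, rfl⟩
  have himage : hyperboloidChart '' {w : ℂ | 0 < w.im} = univ := by
    refine eq_univ_of_forall fun w => ⟨ofHyperboloidCoord w, (ofHyperboloidCoord w).im_pos, ?_⟩
    rw [hyperboloidChart_coe, hyperboloidCoord_ofHyperboloidCoord]
  have hinj : InjOn hyperboloidChart {w : ℂ | 0 < w.im} := by
    intro w hw w' hw' h
    obtain ⟨z, rfl⟩ := hcoe w hw
    obtain ⟨z', rfl⟩ := hcoe w' hw'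
    rw [hyperboloidChart_coe, hyperboloidChart_coe] at h
    rw [hyperboloidCoord_injective h]
  rw [← setLIntegral_univ, ← himage, lintegral_image_eq_lintegral_abs_det_fderiv_mul volume hS
    (fun w hw => (hL w (ne_of_gt hw)).hasFDerivWithinAt) hinj, lintegral_volume_eq]
  refine setLIntegral_congr_fun hS fun w hw => ?_
  have hdw := hdet w (ne_of_gt hw)
  obtain ⟨z, rfl⟩ := hcoe w hw
  have hz := z.im_pos
  simp only [hdw, hyperboloidChart_coe, UpperHalfPlane.ofComplex_apply, cosh_dist_I,
    UpperHalfPlane.coe_im, UpperHalfPlane.coe_re]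
  rw [← mul_assoc, ← ENNReal.ofReal_mul (by positivity), abs_of_nonneg (by positivity)]
  congr 2
  field_simp

theorem lintegral_polar {h : ℂ → ENNReal} (hh : Measurable h) :
    ∫⁻ w, h w = ∫⁻ ρ in Ioi (0 : ℝ), ENNReal.ofReal ρ *
      ∫⁻ θ in Ioo (-Real.pi) Real.pi, h (ρ * Complex.exp (θ * Complex.I)) := by
  have hpol : ∀ p, Complex.polarCoord.symm p = p.1 * Complex.exp (p.2 * Complex.I) := fun p => by
    rw [Complex.polarCoord_symm_apply, Complex.exp_mul_I]
    push_cast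
    rfl
  rw [← Complex.lintegral_comp_polarCoord_symm, polarCoord_target, Measure.volume_eq_prod,
    ← Measure.prod_restrict]
  simp only [hpol, smul_eq_mul]
  rw [lintegral_prod _ (by fun_prop)]
  refine lintegral_congr fun ρ => ?_
  have hm : Measurable fun θ : ℝ => h (ρ * Complex.exp (θ * Complex.I)) := hh.comp (by fun_prop)
  simp only
  rw [lintegral_const_mul _ hm]

/-- The argument of `w` only shifts the angle, and a periodic function has the same integral over
every full period. A circle integral thus depends on `‖w‖` alone. -/
theorem lintegral_rotate {h : ℂ → ENNReal} (w : ℂ) :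
    ∫⁻ θ in Icc (0 : ℝ) (2 * Real.pi), h (Complex.exp (θ * Complex.I) * w) =
      ∫⁻ θ in Ioo (-Real.pi) Real.pi, h (‖w‖ * Complex.exp (θ * Complex.I)) := by
  set k : ℝ → ENNReal := fun θ => h (‖w‖ * Complex.exp (θ * Complex.I)) with hk
  have hper : Function.Periodic k (2 * Real.pi) := fun θ => by
    simp only [hk]
    push_cast
    rw [add_mul, Complex.exp_add, Complex.exp_two_pi_mul_I, mul_one]
  have h1 : ∀ θ : ℝ, h (Complex.exp (θ * Complex.I) * w) = k (θ + w.arg) := fun θ => by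
    simp only [hk]
    congr 1
    conv_lhs => rw [← Complex.norm_mul_exp_arg_mul_I w]
    push_cast
    rw [add_mul, Complex.exp_add]
    ring
  have h2 : ∫⁻ θ in Icc (0 : ℝ) (2 * Real.pi), k (θ + w.arg) =
      ∫⁻ θ in Icc w.arg (w.arg + 2 * Real.pi), k θ := by
    have := (measurePreserving_add_right volume w.arg).setLIntegral_comp_preimage_emb
      (MeasurableEquiv.addRight w.arg).measurableEmbedding k (Icc w.arg (w.arg + 2 * Real.pi))
    rw [← this]
    congr 2
    ext θ
    simp
  have h3 := (isAddFundamentalDomain_Ioc Real.two_pi_pos w.arg volume).setLIntegral_eq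
    (isAddFundamentalDomain_Ioc Real.two_pi_pos (-Real.pi) volume) k (by
      rintro ⟨_, n, rfl⟩ θ
      have := hper.int_mul n θ
      simpa [AddSubgroup.vadd_def, add_comm] using this)
  rw [setLIntegral_congr_fun measurableSet_Icc fun θ _ => h1 θ, h2,
    setLIntegral_congr Ioc_ae_eq_Icc.symm, h3, setLIntegral_congr Ioo_ae_eq_Ioc]
  congr 3
  ring

end MagneticTorus

/-! ### The image of `dθ dt` on the hyperbolic plane -/

namespace MagneticTorus

section

variable {B E : ℝ}

open Classical in
/-- The contribution to the density of a lift at distance `d` from the center. -/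
noncomputable def weight (B E d : ℝ) : ℝ := if 0 < d ∧ d < radius B E then profile B E d else 0

theorem profile_nonneg (hE : 0 < E) (d : ℝ) : 0 ≤ profile B E d := by
  unfold profile
  positivity

theorem weight_nonneg (hE : 0 < E) (d : ℝ) : 0 ≤ weight B E d := by
  unfold weight
  split_ifs
  exacts [profile_nonneg hE d, le_rfl]

theorem weight_eq_profile {d : ℝ} (h : 0 < d) (h' : d < radius B E) :
    weight B E d = profile B E d := if_pos ⟨h, h'⟩

theorem weight_eq_zero {d : ℝ} (h : ¬(0 < d ∧ d < radius B E)) : weight B E d = 0 := if_neg h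

@[fun_prop]
theorem continuous_cosPhase : Continuous (cosPhase B E) := by
  unfold cosPhase
  exact continuous_const.sub (((Real.continuous_cosh.sub continuous_const).mul
    continuous_const).div_const _)

theorem measurable_weight : Measurable (weight B E) := by
  refine Measurable.ite ((measurableSet_lt measurable_const measurable_id).inter
    (measurableSet_lt measurable_id measurable_const)) ?_ measurable_const
  exact measurable_const.div (measurable_const.mul
    (by fun_prop : Continuous fun d => √(1 - cosPhase B E d ^ 2)).measurable)

/-- The distance from the starting point at time `t`. -/
noncomputable def orbitDist (hE : 0 < E) (hEc : E < B ^ 2 / 2) (t : ℝ) : ℝ :=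
  dist (orbitPoint hE hEc (0, t)) UpperHalfPlane.I

theorem orbitDist_nonneg (hE : 0 < E) (hEc : E < B ^ 2 / 2) (t : ℝ) : 0 ≤ orbitDist hE hEc t :=
  dist_nonneg

theorem cosPhase_orbitDist (hE : 0 < E) (hEc : E < B ^ 2 / 2) (t : ℝ) :
    cosPhase B E (orbitDist hE hEc t) = Real.cos (√(B ^ 2 - 2 * E) * t) :=
  cosPhase_dist_orbitPoint hE hEc (0, t)

/-- `sinh d` is the radius in the hyperboloid coordinate. It is `√(cosh² d - 1)` with `cosh d`
explicit in `t`; positivity of `d` keeps the root differentiable. -/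
theorem hasDerivAt_sinh_orbitDist (hE : 0 < E) (hEc : E < B ^ 2 / 2) {t : ℝ}
    (ht : 0 < orbitDist hE hEc t) :
    HasDerivAt (fun t => Real.sinh (orbitDist hE hEc t))
      (Real.cosh (orbitDist hE hEc t) *
        (2 * E / √(B ^ 2 - 2 * E) * Real.sin (√(B ^ 2 - 2 * E) * t)) /
        Real.sinh (orbitDist hE hEc t)) t := by
  have hs := Real.sinh_pos_iff.2 ht
  have hω := frequency_pos hEc
  have hω2 := frequency_sq hEc
  have hc : ∀ t, Real.cosh (orbitDist hE hEc t) = 1 + 2 * E / (B ^ 2 - 2 * E) *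
      (1 - Real.cos (√(B ^ 2 - 2 * E) * t)) := fun t => cosh_dist_orbitPoint hE hEc (0, t)
  have heq : (fun t => Real.sinh (orbitDist hE hEc t)) = fun t =>
      √((1 + 2 * E / (B ^ 2 - 2 * E) * (1 - Real.cos (√(B ^ 2 - 2 * E) * t))) ^ 2 - 1) := by
    ext t
    rw [← hc, ← Real.sinh_sq, Real.sqrt_sq (Real.sinh_nonneg_iff.2 (orbitDist_nonneg hE hEc t))]
  have hl : HasDerivAt (fun t : ℝ => √(B ^ 2 - 2 * E) * t) √(B ^ 2 - 2 * E) t := by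
    simpa using (hasDerivAt_id t).const_mul √(B ^ 2 - 2 * E)
  have h1 := (((hl.cos.const_sub 1).const_mul (2 * E / (B ^ 2 - 2 * E))).const_add 1).pow 2
  have h2 := (h1.sub_const 1).sqrt (by
    have : Real.sinh (orbitDist hE hEc t) ^ 2 ≠ 0 := (pow_pos hs 2).ne'
    rw [Real.sinh_sq, hc] at this
    exact this)
  rw [heq]
  refine h2.congr_deriv ?_
  have hsqrt := congrFun heq t
  simp only [Pi.pow_apply] at hsqrt ⊢
  rw [← hsqrt, ← hc t, ← hω2]
  simp only [Nat.cast_ofNat, Nat.add_one_sub_one, pow_one]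
  rw [hω2]
  generalize √(B ^ 2 - 2 * E) = ω at *
  rw [← hω2]
  field_simp

theorem injOn_sinh_orbitDist (hE : 0 < E) (hEc : E < B ^ 2 / 2) {J : Set ℝ}
    (hJ : BijOn (fun t => Real.cos (√(B ^ 2 - 2 * E) * t)) J (Ioo (-1) 1)) :
    InjOn (fun t => Real.sinh (orbitDist hE hEc t)) J := by
  intro t ht t' ht' h
  refine hJ.injOn ht ht' ?_
  simp only [← cosPhase_orbitDist hE hEc, Real.sinh_injective h]

theorem image_sinh_orbitDist (hE : 0 < E) (hEc : E < B ^ 2 / 2) {J : Set ℝ}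
    (hJ : BijOn (fun t => Real.cos (√(B ^ 2 - 2 * E) * t)) J (Ioo (-1) 1)) :
    (fun t => Real.sinh (orbitDist hE hEc t)) '' J = Ioo 0 (Real.sinh (radius B E)) := by
  ext ρ
  constructor
  · rintro ⟨t, ht, rfl⟩
    have h := hJ.mapsTo ht
    simp only [← cosPhase_orbitDist hE hEc] at h
    rw [cosPhase_mem_Ioo_iff hE hEc (orbitDist_nonneg hE hEc t)] at h
    exact ⟨Real.sinh_pos_iff.2 h.1, Real.sinh_lt_sinh.2 h.2⟩
  · intro hρ
    obtain ⟨d, rfl⟩ := Real.sinh_surjective ρ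
    have hd : 0 < d := Real.sinh_pos_iff.1 hρ.1
    obtain ⟨t, ht, htd⟩ := hJ.surjOn ((cosPhase_mem_Ioo_iff hE hEc hd.le).2
      ⟨hd, Real.sinh_lt_sinh.1 hρ.2⟩)
    simp only [← cosPhase_orbitDist hE hEc] at htd
    exact ⟨t, ht, congrArg Real.sinh (cosPhase_injOn hE hEc dist_nonneg hd.le htd)⟩

/-- In the radius `ρ = sinh d`, the weighted area has radial density `ρ * weight / √(1 + ρ²)`.
Against `dρ/dt` it gives `2`, not `1`, because `weight` accounts for both half periods. -/
theorem jacobian_mul_weight (hE : 0 < E) (hEc : E < B ^ 2 / 2) {t : ℝ}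
    (ht : Real.cos (√(B ^ 2 - 2 * E) * t) ∈ Ioo (-1) 1) :
    |Real.cosh (orbitDist hE hEc t) *
        (2 * E / √(B ^ 2 - 2 * E) * Real.sin (√(B ^ 2 - 2 * E) * t)) /
        Real.sinh (orbitDist hE hEc t)| *
      (Real.sinh (orbitDist hE hEc t) * (weight B E (orbitDist hE hEc t) /
        Real.cosh (orbitDist hE hEc t))) = 2 := by
  have hω := frequency_pos hEc
  have h := ht
  rw [← cosPhase_orbitDist hE hEc, cosPhase_mem_Ioo_iff hE hEc (orbitDist_nonneg hE hEc t)] at h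
  have hs := Real.sinh_pos_iff.2 h.1
  have hc := Real.cosh_pos (orbitDist hE hEc t)
  have hsin : |Real.sin (√(B ^ 2 - 2 * E) * t)| ≠ 0 := by
    rw [Real.abs_sin_eq_sqrt_one_sub_cos_sq]
    refine (Real.sqrt_pos.2 ?_).ne'
    nlinarith [ht.1, ht.2]
  rw [weight_eq_profile h.1 h.2, profile, cosPhase_orbitDist, ← Real.abs_sin_eq_sqrt_one_sub_cos_sq,
    abs_div, abs_mul, abs_mul, abs_of_pos hs, abs_of_pos hc,
    abs_of_pos (show 0 < 2 * E / √(B ^ 2 - 2 * E) by positivity)]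
  field_simp

theorem lintegral_radial (hE : 0 < E) (hEc : E < B ^ 2 / 2) {J : Set ℝ} (hJm : MeasurableSet J)
    (hJ : BijOn (fun t => Real.cos (√(B ^ 2 - 2 * E) * t)) J (Ioo (-1) 1)) (H : ℝ → ENNReal) :
    ∫⁻ ρ in Ioi 0, ENNReal.ofReal (ρ * (weight B E (Real.arsinh ρ) / √(1 + ρ ^ 2))) * H ρ =
      2 * ∫⁻ t in J, H (Real.sinh (orbitDist hE hEc t)) := by
  -- `weight` vanishes from `R_E` on, so only the radii swept by the orbit matter.
  have hrestrict : ∫⁻ ρ in Ioi 0,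
      ENNReal.ofReal (ρ * (weight B E (Real.arsinh ρ) / √(1 + ρ ^ 2))) * H ρ =
      ∫⁻ ρ in Ioo 0 (Real.sinh (radius B E)),
        ENNReal.ofReal (ρ * (weight B E (Real.arsinh ρ) / √(1 + ρ ^ 2))) * H ρ := by
    rw [← lintegral_indicator measurableSet_Ioi, ← lintegral_indicator measurableSet_Ioo]
    refine lintegral_congr fun ρ => ?_
    by_cases h0 : 0 < ρ
    · by_cases h1 : ρ < Real.sinh (radius B E)
      · rw [indicator_of_mem (show ρ ∈ Ioi 0 from h0),
          indicator_of_mem (show ρ ∈ Ioo 0 (Real.sinh (radius B E)) from ⟨h0, h1⟩)]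
      · rw [indicator_of_mem (show ρ ∈ Ioi 0 from h0), indicator_of_notMem fun h => h1 h.2,
          weight_eq_zero]
        · simp
        · rintro ⟨-, h⟩
          rw [← Real.sinh_lt_sinh, Real.sinh_arsinh] at h
          exact h1 h
    · rw [indicator_of_notMem (show ρ ∉ Ioi 0 from h0), indicator_of_notMem fun h => h0 h.1]
  have hmem : ∀ t ∈ J, 0 < orbitDist hE hEc t := fun t ht => by
    have h := hJ.mapsTo ht
    simp only [← cosPhase_orbitDist hE hEc] at h
    exact ((cosPhase_mem_Ioo_iff hE hEc (orbitDist_nonneg hE hEc t)).1 h).1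
  rw [hrestrict, ← image_sinh_orbitDist hE hEc hJ, lintegral_image_eq_lintegral_abs_deriv_mul hJm
    (fun t ht => (hasDerivAt_sinh_orbitDist hE hEc (hmem t ht)).hasDerivWithinAt)
    (injOn_sinh_orbitDist hE hEc hJ), ← lintegral_const_mul' _ _ ENNReal.ofNat_ne_top]
  refine setLIntegral_congr_fun hJm fun t ht => ?_
  have hc := Real.cosh_pos (orbitDist hE hEc t)
  rw [← mul_assoc, ← ENNReal.ofReal_mul (abs_nonneg _), Real.arsinh_sinh, add_comm 1,
    ← Real.cosh_sq, Real.sqrt_sq hc.le, jacobian_mul_weight hE hEc (hJ.mapsTo ht)]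
  simp

/-- Integrating first over the angle reduces both sides to the circle integrals `H` of `f`; the
substitution `ρ = sinh d(t)` then matches them. -/
theorem lintegral_orbitPoint (hE : 0 < E) (hEc : E < B ^ 2 / 2) {f : ℍ → ENNReal}
    (hf : Measurable f) :
    ∫⁻ q in Icc 0 (2 * Real.pi) ×ˢ Icc 0 (period B E), f (orbitPoint hE hEc q) =
      ∫⁻ z : ℍ, ENNReal.ofReal (weight B E (dist z UpperHalfPlane.I)) * f z := by
  set H : ℝ → ENNReal := fun ρ => ∫⁻ θ in Ioo (-Real.pi) Real.pi,
    f (ofHyperboloidCoord (ρ * Complex.exp (θ * Complex.I))) with hH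
  have hfm : Measurable fun w => f (ofHyperboloidCoord w) :=
    hf.comp continuous_ofHyperboloidCoord.measurable
  have hL : ∫⁻ q in Icc 0 (2 * Real.pi) ×ˢ Icc 0 (period B E), f (orbitPoint hE hEc q) =
      ∫⁻ t in Icc 0 (period B E), H (Real.sinh (orbitDist hE hEc t)) := by
    rw [Measure.volume_eq_prod, ← Measure.prod_restrict, lintegral_prod_symm
      (fun q => f (orbitPoint hE hEc q))
      (hf.comp (continuous_orbitPoint hE hEc).measurable).aemeasurable]
    refine lintegral_congr fun t => ?_
    have := lintegral_rotate (h := fun w => f (ofHyperboloidCoord w))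
      (hyperboloidCoord (flowMatrix hE hEc t • UpperHalfPlane.I))
    have h0 := hyperboloidCoord_orbitPoint hE hEc 0 t
    rw [Complex.ofReal_zero, zero_mul, Complex.exp_zero, one_mul] at h0
    simp only [← hyperboloidCoord_orbitPoint hE hEc, ofHyperboloidCoord_hyperboloidCoord] at this
    rw [this, ← h0, norm_hyperboloidCoord]
    rfl
  have hR : ∫⁻ z : ℍ, ENNReal.ofReal (weight B E (dist z UpperHalfPlane.I)) * f z =
      ∫⁻ ρ in Ioi 0, ENNReal.ofReal (ρ * (weight B E (Real.arsinh ρ) / √(1 + ρ ^ 2))) * H ρ := by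
    have h1 := lintegral_hyperboloidCoord (fun w =>
      ENNReal.ofReal (weight B E (Real.arsinh ‖w‖) / √(1 + ‖w‖ ^ 2)) * f (ofHyperboloidCoord w))
    have hm : Measurable fun w : ℂ =>
        ENNReal.ofReal (weight B E (Real.arsinh ‖w‖) / √(1 + ‖w‖ ^ 2)) :=
      ((measurable_weight.comp (Real.continuous_arsinh.measurable.comp measurable_norm)).div
        (by fun_prop)).ennreal_ofReal
    have hmf : Measurable fun w : ℂ =>
        ENNReal.ofReal (weight B E (Real.arsinh ‖w‖) / √(1 + ‖w‖ ^ 2)) *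
          f (ofHyperboloidCoord w) := hm.mul hfm
    rw [lintegral_polar hmf] at h1
    refine Eq.trans ?_ (h1.symm.trans ?_)
    · refine lintegral_congr fun z => ?_
      have hc := Real.cosh_pos (dist z UpperHalfPlane.I)
      rw [ofHyperboloidCoord_hyperboloidCoord, norm_hyperboloidCoord, Real.arsinh_sinh,
        ← mul_assoc, ← ENNReal.ofReal_mul hc.le, add_comm 1, ← Real.cosh_sq,
        Real.sqrt_sq hc.le, mul_div_cancel₀ _ hc.ne']
    · refine setLIntegral_congr_fun measurableSet_Ioi fun ρ hρ => ?_
      have hn : ∀ θ : ℝ, ‖(ρ : ℂ) * Complex.exp (θ * Complex.I)‖ = ρ := fun θ => by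
        rw [norm_mul, Complex.norm_exp_ofReal_mul_I, mul_one, Complex.norm_real]
        exact abs_of_pos hρ
      simp only [hn]
      have hm' : Measurable fun θ : ℝ => f (ofHyperboloidCoord (ρ * Complex.exp (θ * Complex.I))) :=
        hfm.comp (by fun_prop)
      rw [lintegral_const_mul _ hm', ← mul_assoc,
        ← ENNReal.ofReal_mul (le_of_lt hρ)]
  have hT := period_pos hEc
  have hA := lintegral_radial hE hEc measurableSet_Ioo (bijOn_cos_first hEc) H
  have hB := lintegral_radial hE hEc measurableSet_Ioo (bijOn_cos_second hEc) H
  rw [← hR] at hA hB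
  -- Twice each half-period integral is the weighted area integral, so the halves agree and their
  -- sum is that integral.
  have hAB := (ENNReal.mul_right_inj two_ne_zero ENNReal.ofNat_ne_top).1 (hA.symm.trans hB)
  have hsplit : ∀ k : ℝ → ENNReal, ∫⁻ t in Icc 0 (period B E), k t =
      (∫⁻ t in Ioo 0 (period B E / 2), k t) + ∫⁻ t in Ioo (period B E / 2) (period B E), k t := by
    intro k
    rw [setLIntegral_congr (Ioc_ae_eq_Icc (μ := volume)).symm,
      ← Ioc_union_Ioc_eq_Ioc (show 0 ≤ period B E / 2 by linarith) (by linarith),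
      lintegral_union measurableSet_Ioc (Ioc_disjoint_Ioc_of_le le_rfl),
      setLIntegral_congr (Ioo_ae_eq_Ioc (μ := volume)).symm,
      setLIntegral_congr (Ioo_ae_eq_Ioc (μ := volume) (a := period B E / 2)).symm]
  rw [hL, hsplit, ← hAB, ← two_mul, hA]

end

end MagneticTorus

/-! ### The area of the surface and unfolding over the deck group -/

namespace MagneticTorus

namespace Surface

variable {Γ : Subgroup SL(2, ℝ)}

/-- The usable form of freeness: `-1` may belong to `Γ`, but it acts trivially. -/
theorem smul_eq_of_fixed (hΓ : IsClosedSurfaceGroup Γ) {γ : SL(2, ℝ)} (hγ : γ ∈ Γ) {z : ℍ}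
    (h : γ • z = z) (w : ℍ) : γ • w = w := by
  rcases hΓ.free γ hγ z h with rfl | rfl
  · exact one_smul _ w
  · refine UpperHalfPlane.ext ?_
    rw [UpperHalfPlane.coe_specialLinearGroup_apply]
    simp

theorem exists_injOn_nhds (hΓ : IsClosedSurfaceGroup Γ) (z : ℍ) :
    ∃ U : Set ℍ, IsOpen U ∧ z ∈ U ∧ InjOn (proj Γ) U := by
  obtain ⟨δ, hδ, h⟩ := exists_separation hΓ (proj Γ z)
  refine ⟨Metric.ball z (δ / 2), Metric.isOpen_ball, Metric.mem_ball_self (by linarith), ?_⟩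
  intro a ha b hb hab
  obtain ⟨γ, hγ, rfl⟩ := proj_eq_iff.1 hab
  have hz : γ • z = z := h _ _ (proj_smul hγ z) rfl (by
    rw [Metric.mem_ball] at ha hb
    calc dist (γ • z) z ≤ dist (γ • z) (γ • b) + dist (γ • b) z := dist_triangle _ _ _
      _ < δ := by rw [dist_smul, dist_comm z b]; linarith)
  exact smul_eq_of_fixed hΓ hγ hz b

/-- Countably many open sets on which `proj` is injective cover `ℍ`. Make their images disjoint and
keep, in each set, the points over its own piece. -/
theorem exists_fundamentalDomain (hΓ : IsClosedSurfaceGroup Γ) :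
    ∃ D : Set ℍ, MeasurableSet D ∧ InjOn (proj Γ) D ∧ proj Γ '' D = univ := by
  choose V hVo hzV hVi using exists_injOn_nhds hΓ
  obtain ⟨s, hs, hsU⟩ := TopologicalSpace.countable_cover_nhds fun z => (hVo z).mem_nhds (hzV z)
  have hne : s.Nonempty := by
    by_contra hne
    rw [not_nonempty_iff_eq_empty] at hne
    simp only [hne, biUnion_empty] at hsU
    exact (hsU ▸ mem_univ UpperHalfPlane.I : UpperHalfPlane.I ∈ (∅ : Set ℍ))
  obtain ⟨e, rfl⟩ := hs.exists_eq_range hne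
  set A : ℕ → Set (Surface Γ) := fun n => proj Γ '' V (e n) with hA
  have hAm : ∀ n, MeasurableSet (A n) := fun n =>
    (isOpenMap_proj _ (hVo (e n))).measurableSet
  have hAU : ⋃ n, disjointed A n = univ := by
    rw [iUnion_disjointed]
    refine eq_univ_of_forall fun y => ?_
    obtain ⟨z, rfl⟩ := proj_surjective y
    have hz : z ∈ ⋃ x ∈ range e, V x := hsU ▸ mem_univ z
    simp only [mem_range, iUnion_exists, iUnion_iUnion_eq', mem_iUnion] at hz
    obtain ⟨n, hn⟩ := hz
    exact mem_iUnion.2 ⟨n, z, hn, rfl⟩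
  refine ⟨⋃ n, V (e n) ∩ proj Γ ⁻¹' disjointed A n, ?_, ?_, ?_⟩
  · exact MeasurableSet.iUnion fun n => (hVo (e n)).measurableSet.inter
      (continuous_proj.measurable (MeasurableSet.disjointed hAm n))
  · intro a ha b hb hab
    obtain ⟨n, han, han'⟩ := mem_iUnion.1 ha
    obtain ⟨m, hbm, hbm'⟩ := mem_iUnion.1 hb
    have hnm : n = m := by
      by_contra hne
      rw [mem_preimage, hab] at han'
      exact Set.disjoint_left.1 (disjoint_disjointed A hne) han' hbm'
    subst hnm
    exact hVi _ han hbm hab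
  · refine eq_univ_of_forall fun y => ?_
    obtain ⟨n, hn⟩ := mem_iUnion.1 (hAU ▸ mem_univ y : y ∈ ⋃ n, disjointed A n)
    obtain ⟨z, hz, rfl⟩ := disjointed_subset A n hn
    exact ⟨z, mem_iUnion.2 ⟨n, hz, hn⟩, rfl⟩

variable (Γ) in
/-- The deck group of the covering `ℍ → Σ`. -/
noncomputable def deckGroup : Subgroup (Equiv.Perm ℍ) := (MulAction.toPermHom Γ ℍ).range

theorem exists_of_deckGroup (σ : deckGroup Γ) : ∃ γ ∈ Γ, ∀ z : ℍ, σ • z = γ • z := by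
  obtain ⟨_, γ, rfl⟩ := σ
  exact ⟨γ, γ.2, fun _ => rfl⟩

/-- The element of the deck group induced by an element of `Γ`. -/
noncomputable def toDeckGroup (γ : Γ) : deckGroup Γ := ⟨MulAction.toPermHom Γ ℍ γ, γ, rfl⟩

theorem countable_deckGroup (hΓ : IsClosedSurfaceGroup Γ) : Countable (deckGroup Γ) := by
  have := countable hΓ
  refine Function.Surjective.countable (f := toDeckGroup (Γ := Γ)) ?_
  rintro ⟨_, γ, rfl⟩
  exact ⟨γ, rfl⟩

theorem proj_deckGroup_smul (σ : deckGroup Γ) (z : ℍ) : proj Γ (σ • z) = proj Γ z := by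
  obtain ⟨γ, hγ, h⟩ := exists_of_deckGroup σ
  rw [h, proj_smul hγ]

/-- This can fail for `Γ` itself, because of `-1`. Passing to permutations of `ℍ` removes the
kernel, as a fundamental domain requires. -/
theorem deckGroup_smul_injective (hΓ : IsClosedSurfaceGroup Γ) (z : ℍ) :
    Function.Injective fun σ : deckGroup Γ => σ • z := by
  intro σ τ h
  obtain ⟨γ, hγ, hγ'⟩ := exists_of_deckGroup (τ⁻¹ * σ)
  have hz : γ • z = z := by
    rw [← hγ', mul_smul, inv_smul_eq_iff]
    exact h
  have h1 : τ⁻¹ * σ = 1 := by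
    refine Subtype.ext (Equiv.ext fun w => ?_)
    exact (hγ' w).trans (smul_eq_of_fixed hΓ hγ hz w)
  exact (inv_mul_eq_one.1 h1).symm

theorem exists_deckGroup_smul {z w : ℍ} (h : proj Γ w = proj Γ z) :
    ∃ σ : deckGroup Γ, σ • z = w := by
  obtain ⟨γ, hγ, h⟩ := proj_eq_iff.1 h
  exact ⟨toDeckGroup ⟨γ, hγ⟩, h⟩

instance : ContinuousConstSMul (deckGroup Γ) ℍ where
  continuous_const_smul σ := by
    obtain ⟨γ, -, h⟩ := exists_of_deckGroup σ
    simp only [h]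
    exact continuous_const_smul γ

theorem measurePreserving_smul_SL (g : SL(2, ℝ)) : MeasurePreserving (g • · : ℍ → ℍ) :=
  MeasureTheory.measurePreserving_smul (Matrix.SpecialLinearGroup.toGL g) volume

instance : SMulInvariantMeasure (deckGroup Γ) ℍ volume where
  measure_preimage_smul σ s hs := by
    obtain ⟨γ, -, h⟩ := exists_of_deckGroup σ
    simp only [h]
    exact (measurePreserving_smul_SL γ).measure_preimage hs.nullMeasurableSet

theorem isFundamentalDomain (hΓ : IsClosedSurfaceGroup Γ) {D : Set ℍ} (hD : MeasurableSet D)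
    (hinj : InjOn (proj Γ) D) (hsurj : proj Γ '' D = univ) :
    IsFundamentalDomain (deckGroup Γ) D := by
  refine IsFundamentalDomain.mk' hD.nullMeasurableSet fun z => ?_
  obtain ⟨w, hw, hwz⟩ := (hsurj ▸ mem_univ (proj Γ z) : proj Γ z ∈ proj Γ '' D)
  obtain ⟨σ, rfl⟩ := exists_deckGroup_smul hwz
  refine ⟨σ, hw, fun τ hτ => deckGroup_smul_injective hΓ z (hinj hτ hw ?_)⟩
  rw [proj_deckGroup_smul, proj_deckGroup_smul]

open scoped Pointwise in
/-- The area of the surface is the image of the area of a fundamental domain. -/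
theorem vol_eq (hΓ : IsClosedSurfaceGroup Γ) {D : Set ℍ} (hD : MeasurableSet D)
    (hinj : InjOn (proj Γ) D) (hsurj : proj Γ '' D = univ) :
    vol Γ = ((volume : Measure ℍ).restrict D).map (proj Γ) := by
  have := countable_deckGroup hΓ
  have hfd := isFundamentalDomain hΓ hD hinj hsurj
  refine le_antisymm (iSup_le fun U => iSup_le fun hU => iSup_le fun hUi => ?_)
    (le_iSup_of_le D (le_iSup_of_le hD (le_iSup_of_le hinj le_rfl)))
  refine Measure.le_iff.2 fun A hA => ?_
  have hP := continuous_proj.measurable hA (f := proj Γ)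
  rw [Measure.map_apply continuous_proj.measurable hA, Measure.map_apply continuous_proj.measurable
    hA, Measure.restrict_apply hP, Measure.restrict_apply hP, hfd.measure_eq_tsum]
  have hm : ∀ σ : deckGroup Γ, MeasurableSet (σ • (proj Γ ⁻¹' A ∩ U) ∩ D) := fun σ =>
    ((hP.inter hU).const_smul σ).inter hD
  -- The pieces of `U` translated into `D` are disjoint because `proj` is injective on `U`; so `U`
  -- contributes no more than `D`.
  rw [← measure_iUnion ?_ hm]
  · refine measure_mono (iUnion_subset ?_)
    rintro σ _ ⟨⟨z, hz, rfl⟩, hzD⟩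
    refine ⟨?_, hzD⟩
    have : proj Γ (σ • z) ∈ A := by
      rw [proj_deckGroup_smul]
      exact hz.1
    exact this
  · intro σ τ hστ
    refine Set.disjoint_left.2 ?_
    rintro _ ⟨⟨z, hz, rfl⟩, -⟩ ⟨⟨w, hw, hwz⟩, -⟩
    have hwz : τ • w = σ • z := hwz
    have hp : proj Γ w = proj Γ z := by
      rw [← proj_deckGroup_smul τ, hwz, proj_deckGroup_smul]
    obtain rfl := hUi hw.2 hz.2 hp
    exact hστ (deckGroup_smul_injective hΓ w hwz).symm

/-- `ℍ` is standard Borel and `Σ` is Hausdorff and second countable, so a set whose preimage under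
the surjection `proj` is Borel is itself Borel. -/
theorem measurable_of_comp_proj (hΓ : IsClosedSurfaceGroup Γ) {β : Type*} [MeasurableSpace β]
    {S : Surface Γ → β} (hS : Measurable fun z => S (proj Γ z)) : Measurable S := by
  have := t2Space hΓ
  have := secondCountableTopology (Γ := Γ)
  have hm : Measurable (proj Γ) := continuous_proj.measurable
  exact (hm.measurable_comp_iff_of_surjective proj_surjective).1 hS

/-- The image on `Σ` of a measure with density on `ℍ` has the sum of the density over the lifts as
its density. -/
theorem map_proj_withDensity (hΓ : IsClosedSurfaceGroup Γ) {f : ℍ → ENNReal} (hf : Measurable f)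
    {S : Surface Γ → ENNReal} (hS : ∀ z, S (proj Γ z) = ∑' σ : deckGroup Γ, f (σ • z)) :
    ((volume : Measure ℍ).withDensity f).map (proj Γ) = (vol Γ).withDensity S := by
  have := countable_deckGroup hΓ
  obtain ⟨D, hD, hinj, hsurj⟩ := exists_fundamentalDomain hΓ
  have hfd := isFundamentalDomain hΓ hD hinj hsurj
  have hfσ : ∀ σ : deckGroup Γ, Measurable fun z : ℍ => f (σ • z) := fun σ =>
    hf.comp (measurable_const_smul σ)
  have hSm : Measurable S := measurable_of_comp_proj hΓ (by
    simp only [hS]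
    exact Measurable.tsum hfσ)
  ext A hA
  have hP := continuous_proj.measurable hA (f := proj Γ)
  rw [Measure.map_apply continuous_proj.measurable hA, withDensity_apply _ hP,
    withDensity_apply _ hA, vol_eq hΓ hD hinj hsurj, ← lintegral_indicator hP,
    hfd.lintegral_eq_tsum'', setLIntegral_map hA hSm continuous_proj.measurable,
    Measure.restrict_restrict hP]
  simp only [hS]
  rw [lintegral_tsum fun σ => (hfσ σ).aemeasurable]
  refine tsum_congr fun σ => ?_
  rw [← Measure.restrict_restrict hP, ← lintegral_indicator hP]
  refine lintegral_congr fun z => ?_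
  -- The preimage of `A` is invariant under the deck group, so its indicator does not see `σ`.
  have hz : σ • z ∈ proj Γ ⁻¹' A ↔ z ∈ proj Γ ⁻¹' A := by
    rw [mem_preimage, proj_deckGroup_smul, mem_preimage]
  by_cases h : z ∈ proj Γ ⁻¹' A
  · rw [indicator_of_mem h, indicator_of_mem (hz.2 h)]
  · rw [indicator_of_notMem h, indicator_of_notMem (mt hz.1 h)]

/-- By freeness `σ ↦ σ • z` enumerates the fiber of `z` without repetition. -/
theorem tsum_deckGroup (hΓ : IsClosedSurfaceGroup Γ) (f : ℍ → ENNReal) (z : ℍ) {L : Finset ℍ}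
    (hL : ∀ v ∈ L, proj Γ v = proj Γ z) (hf : ∀ v, proj Γ v = proj Γ z → v ∉ L → f v = 0) :
    ∑' σ : deckGroup Γ, f (σ • z) = ∑ v ∈ L, f v := by
  classical
  have hinj := deckGroup_smul_injective hΓ z
  have h : Function.support ((↑L : Set ℍ).indicator f) ⊆ range fun σ : deckGroup Γ => σ • z := by
    intro v hv
    have hvL : v ∈ L := by
      by_contra h
      exact hv (indicator_of_notMem h f)
    obtain ⟨σ, hσ⟩ := exists_deckGroup_smul (hL v hvL)
    exact ⟨σ, hσ⟩
  have hcongr : ∀ σ : deckGroup Γ, f (σ • z) = (↑L : Set ℍ).indicator f (σ • z) := fun σ => by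
    by_cases hσ : σ • z ∈ L
    · rw [indicator_of_mem (Finset.mem_coe.2 hσ)]
    · rw [indicator_of_notMem (by simpa using hσ), hf _ (proj_deckGroup_smul σ z) hσ]
  rw [tsum_congr hcongr, hinj.tsum_eq h, tsum_eq_sum (s := L) fun v hv =>
    indicator_of_notMem (by simpa using hv) f]
  exact Finset.sum_congr rfl fun v hv => indicator_of_mem (Finset.mem_coe.2 hv) f

end Surface

section

variable {B E : ℝ} {Γ : Subgroup SL(2, ℝ)}

open CotangentPlane

/-- The density as a finite sum over any finite set of lifts that contains those in the disk. -/
theorem density_eq_sum (hΓ : IsClosedSurfaceGroup Γ) (hE : 0 < E) (hEc : E < B ^ 2 / 2)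
    (g : SL(2, ℝ)) (y : Surface Γ) {L : Finset ℍ} (hL : ∀ v ∈ L, Surface.proj Γ v = y)
    (hL' : ∀ v, Surface.proj Γ v = y → dist v (g • UpperHalfPlane.I) < radius B E → v ∈ L) :
    density B E (CotangentSurface.proj Γ (g • upward √(2 * E))) y =
      ∑ v ∈ L, weight B E (dist v (g • UpperHalfPlane.I)) := by
  classical
  have hf := finite_interiorLifts (B := B) (E := E) hΓ (g • UpperHalfPlane.I) y
  rw [density_eq hΓ hE hEc, finsum_mem_eq_finite_toFinset_sum _ hf]
  have hsub : hf.toFinset ⊆ L := fun v hv => by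
    rw [Finite.mem_toFinset] at hv
    exact hL' v hv.1 hv.2.2
  rw [← Finset.sum_subset hsub]
  · refine Finset.sum_congr rfl fun v hv => ?_
    rw [Finite.mem_toFinset] at hv
    exact (weight_eq_profile hv.2.1 hv.2.2).symm
  · intro v hv hv'
    refine weight_eq_zero fun h => hv' ?_
    rw [Finite.mem_toFinset]
    exact ⟨hL v hv, h⟩

theorem ofReal_density (hΓ : IsClosedSurfaceGroup Γ) (hE : 0 < E) (hEc : E < B ^ 2 / 2)
    (g : SL(2, ℝ)) (z : ℍ) :
    ENNReal.ofReal (density B E (CotangentSurface.proj Γ (g • upward √(2 * E)))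
      (Surface.proj Γ z)) = ∑' σ : Surface.deckGroup Γ,
        ENNReal.ofReal (weight B E (dist (σ • z) (g • UpperHalfPlane.I))) := by
  have hf := Surface.finite_lifts hΓ (Surface.proj Γ z) (g • UpperHalfPlane.I) (radius B E)
  have hmem : ∀ v, v ∈ hf.toFinset ↔ Surface.proj Γ v = Surface.proj Γ z ∧
      dist v (g • UpperHalfPlane.I) ≤ radius B E := fun v => Finite.mem_toFinset hf
  rw [density_eq_sum hΓ hE hEc g _ (fun v hv => ((hmem v).1 hv).1)
    (fun v hv hv' => (hmem v).2 ⟨hv, hv'.le⟩),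
    ENNReal.ofReal_sum_of_nonneg fun v _ => weight_nonneg hE _]
  refine (Surface.tsum_deckGroup hΓ (fun v => ENNReal.ofReal (weight B E (dist v
    (g • UpperHalfPlane.I)))) z (fun v hv => ((hmem v).1 hv).1) fun v hv hvL => ?_).symm
  rw [weight_eq_zero, ENNReal.ofReal_zero]
  exact fun h => hvL ((hmem v).2 ⟨hv, h.2.le⟩)

theorem map_orbitPoint (hE : 0 < E) (hEc : E < B ^ 2 / 2) (g : SL(2, ℝ)) :
    ((volume : Measure (ℝ × ℝ)).restrict (Icc 0 (2 * Real.pi) ×ˢ Icc 0 (period B E))).map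
      (fun q => g • orbitPoint hE hEc q) = (volume : Measure ℍ).withDensity fun z =>
        ENNReal.ofReal (weight B E (dist z (g • UpperHalfPlane.I))) := by
  have hm : Measurable fun q => g • orbitPoint hE hEc q :=
    ((continuous_const_smul g).comp (continuous_orbitPoint hE hEc)).measurable
  refine Measure.ext_of_lintegral _ fun f hf => ?_
  have hw : Measurable fun z : ℍ =>
      ENNReal.ofReal (weight B E (dist z (g • UpperHalfPlane.I))) :=
    (measurable_weight.comp (by fun_prop)).ennreal_ofReal
  rw [lintegral_map hf hm, lintegral_withDensity_eq_lintegral_mul _ hw hf,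
    lintegral_orbitPoint hE hEc (f := fun z => f (g • z))
      (hf.comp (continuous_const_smul g).measurable),
    ← (Surface.measurePreserving_smul_SL g).lintegral_comp (hw.mul hf)]
  simp only [Pi.mul_apply, dist_smul]

/-- The footpoint of the torus map factors through `ℍ`: push `dθ dt` to the plane along the orbits,
then unfold along `proj`. -/
theorem map_footpoint_torusMeasure (hΓ : IsClosedSurfaceGroup Γ) (hE : 0 < E)
    (hEc : E < B ^ 2 / 2) (g : SL(2, ℝ)) :
    (torusMeasure B E (CotangentSurface.proj Γ (g • upward √(2 * E)))).map
        CotangentSurface.footpoint =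
      (Surface.vol Γ).withDensity fun y => ENNReal.ofReal
        (density B E (CotangentSurface.proj Γ (g • upward √(2 * E))) y) := by
  have hm : Measurable fun q => g • orbitPoint hE hEc q :=
    ((continuous_const_smul g).comp (continuous_orbitPoint hE hEc)).measurable
  have hw : Measurable fun z : ℍ =>
      ENNReal.ofReal (weight B E (dist z (g • UpperHalfPlane.I))) :=
    (measurable_weight.comp (by fun_prop)).ennreal_ofReal
  rw [torusMeasure, Measure.map_map continuous_footpoint.measurable
    (continuous_torusMap hE hEc g).measurable,
    ← Surface.map_proj_withDensity hΓ hw (ofReal_density hΓ hE hEc g), ← map_orbitPoint hE hEc g,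
    Measure.map_map Surface.continuous_proj.measurable hm]
  congr 1
  exact funext fun q => footpoint_torusMap hE hEc g q

theorem measurable_density (hΓ : IsClosedSurfaceGroup Γ) (hE : 0 < E) (hEc : E < B ^ 2 / 2)
    (g : SL(2, ℝ)) :
    Measurable (density B E (CotangentSurface.proj Γ (g • upward √(2 * E)))) := by
  have := Surface.countable_deckGroup hΓ
  refine Surface.measurable_of_comp_proj hΓ ?_
  have h : (fun z => density B E (CotangentSurface.proj Γ (g • upward √(2 * E)))
      (Surface.proj Γ z)) = fun z => (∑' σ : Surface.deckGroup Γ,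
        ENNReal.ofReal (weight B E (dist (σ • z) (g • UpperHalfPlane.I)))).toReal := by
    ext z
    rw [← ofReal_density hΓ hE hEc g z, ENNReal.toReal_ofReal]
    rw [density_eq hΓ hE hEc]
    exact finsum_nonneg fun v => finsum_nonneg fun _ => profile_nonneg hE _
  rw [h]
  refine (Measurable.tsum fun σ => ?_).ennreal_toReal
  exact (measurable_weight.comp ((measurable_const_smul σ).dist measurable_const)).ennreal_ofReal

theorem density_nonneg (hE : 0 < E) (ξ₀ : CotangentSurface Γ) (y : Surface Γ) :
    0 ≤ density B E ξ₀ y := by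
  unfold density
  refine mul_nonneg (by positivity) 
    (finsum_nonneg fun q => finsum_nonneg fun _ => by positivity)

/-- The integral of the density is the total mass of the torus, that is, the area of a compact
rectangle. -/
theorem integrable_density (hΓ : IsClosedSurfaceGroup Γ) (hE : 0 < E) (hEc : E < B ^ 2 / 2)
    (g : SL(2, ℝ)) :
    Integrable (density B E (CotangentSurface.proj Γ (g • upward √(2 * E)))) (Surface.vol Γ) := by
  refine ⟨(measurable_density hΓ hE hEc g).aestronglyMeasurable, ?_⟩
  rw [hasFiniteIntegral_iff_ofReal (.of_forall fun y => density_nonneg hE _ y)]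
  have h := congrArg (fun μ => μ univ) (map_footpoint_torusMeasure hΓ hE hEc g)
  simp only [withDensity_apply _ MeasurableSet.univ, Measure.restrict_univ] at h
  rw [← h, torusMeasure, Measure.map_apply continuous_footpoint.measurable MeasurableSet.univ,
    preimage_univ, Measure.map_apply (continuous_torusMap hE hEc g).measurable MeasurableSet.univ,
    preimage_univ, Measure.restrict_apply_univ]
  exact (isCompact_Icc.prod isCompact_Icc).measure_lt_top

end

end MagneticTorus

/-! ### The two singularities of the weight -/

namespace MagneticTorus

section

variable {B E : ℝ}

theorem one_sub_cosPhase_sq_pos (hE : 0 < E) (hEc : E < B ^ 2 / 2) {d : ℝ} (h : 0 < d)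
    (h' : d < radius B E) : 0 < 1 - cosPhase B E d ^ 2 := by
  have := (cosPhase_mem_Ioo_iff hE hEc h.le).2 ⟨h, h'⟩
  nlinarith [this.1, this.2]

theorem weight_pos (hE : 0 < E) (hEc : E < B ^ 2 / 2) {d : ℝ} (h : 0 < d)
    (h' : d < radius B E) : 0 < weight B E d := by
  rw [weight_eq_profile h h', profile]
  exact div_pos (frequency_pos hEc)
    (mul_pos hE (Real.sqrt_pos.2 (one_sub_cosPhase_sq_pos hE hEc h h')))

theorem continuousAt_weight (hE : 0 < E) (hEc : E < B ^ 2 / 2) {d : ℝ} (h : 0 < d)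
    (h' : d ≠ radius B E) : ContinuousAt (weight B E) d := by
  rcases lt_or_gt_of_ne h' with h' | h'
  · have heq : weight B E =ᶠ[𝓝 d] profile B E := by
      filter_upwards [lt_mem_nhds h, gt_mem_nhds h'] with x hx hx'
      exact weight_eq_profile hx hx'
    refine ContinuousAt.congr ?_ heq.symm
    refine continuousAt_const.div (by fun_prop) ?_
    exact (mul_pos hE (Real.sqrt_pos.2 (one_sub_cosPhase_sq_pos hE hEc h h'))).ne'
  · have heq : weight B E =ᶠ[𝓝 d] fun _ => 0 := by
      filter_upwards [lt_mem_nhds h'] with x hx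
      exact weight_eq_zero fun h => lt_asymm hx h.2
    exact continuousAt_const.congr heq.symm

theorem sinh_radius (hB : 0 < B) (hE : 0 < E) (hEc : E < B ^ 2 / 2) :
    Real.sinh (radius B E) = 2 * B * √(2 * E) / (B ^ 2 - 2 * E) := by
  have h : 0 < B ^ 2 - 2 * E := by linarith
  have hs := Real.sq_sqrt (show 0 ≤ 2 * E by linarith)
  rw [← sq_eq_sq₀ (Real.sinh_nonneg_iff.2 (radius_pos hE hEc).le) (by positivity), Real.sinh_sq,
    cosh_radius hE hEc, div_pow, mul_pow, hs]
  field_simp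
  ring

/-- With `κ = cosPhase` and `cosh d - 1 = 2 sinh² (d/2)`, the product `(1 - κ)(1 + κ)` is asymptotic
to `d² (B² - 2E)/(2E)`. -/
theorem tendsto_mul_weight_zero (hE : 0 < E) (hEc : E < B ^ 2 / 2) :
    Tendsto (fun d => d * weight B E d) (𝓝[>] 0) (𝓝 √(2 / E)) := by
  have hω := frequency_pos hEc
  have hω2 := frequency_sq hEc
  have hs : Tendsto (fun d : ℝ => Real.sinh d / d) (𝓝[≠] 0) (𝓝 1) := by
    have := (Real.hasDerivAt_sinh 0).tendsto_slope
    simpa [slope_fun_def_field] using this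
  have hs2 : Tendsto (fun d : ℝ => Real.sinh (d / 2) / (d / 2)) (𝓝[>] 0) (𝓝 1) := by
    refine hs.comp (tendsto_nhdsWithin_iff.2 ⟨?_, ?_⟩)
    · exact tendsto_nhdsWithin_of_tendsto_nhds (Continuous.tendsto' (by fun_prop) _ _ (by simp))
    · filter_upwards [self_mem_nhdsWithin] with d hd
      exact (half_pos hd).ne'
  have hκ : Tendsto (cosPhase B E) (𝓝[>] 0) (𝓝 1) :=
    tendsto_nhdsWithin_of_tendsto_nhds (continuous_cosPhase.tendsto' _ _ (by simp [cosPhase]))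
  have hlim : Tendsto (fun d : ℝ => √(B ^ 2 - 2 * E) / (E * √((Real.sinh (d / 2) / (d / 2)) ^ 2 *
      ((B ^ 2 - 2 * E) / (4 * E)) * (1 + cosPhase B E d)))) (𝓝[>] 0)
      (𝓝 (√(B ^ 2 - 2 * E) / (E * √(1 ^ 2 * ((B ^ 2 - 2 * E) / (4 * E)) * (1 + 1))))) := by
    refine tendsto_const_nhds.div (tendsto_const_nhds.mul ?_) ?_
    · exact (((hs2.pow 2).mul_const _).mul (hκ.const_add 1)).sqrt
    · rw [← hω2]
      positivity
  have hval : √(B ^ 2 - 2 * E) / (E * √(1 ^ 2 * ((B ^ 2 - 2 * E) / (4 * E)) * (1 + 1))) =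
      √(2 / E) := by
    rw [show 1 ^ 2 * ((B ^ 2 - 2 * E) / (4 * E)) * (1 + 1) = (B ^ 2 - 2 * E) / (2 * E) by
      field_simp; ring, Real.sqrt_div' _ (by positivity), Real.sqrt_div' _ hE.le]
    have h2 : √(2 * E) = √2 * √E := Real.sqrt_mul zero_le_two _
    have hE2 := Real.mul_self_sqrt hE.le
    have hEp := Real.sqrt_pos.2 hE
    rw [h2]
    field_simp
    rw [sq, hE2]
  rw [hval] at hlim
  refine hlim.congr' ?_
  filter_upwards [self_mem_nhdsWithin, mem_nhdsWithin_of_mem_nhds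
    (gt_mem_nhds (radius_pos hE hEc))] with d hd hdR
  have hd : 0 < d := hd
  have hc : Real.cosh d - 1 = 2 * Real.sinh (d / 2) ^ 2 := by
    rw [Real.sinh_sq]
    have := Real.cosh_two_mul (d / 2)
    rw [mul_div_cancel₀ _ two_ne_zero, Real.sinh_sq] at this
    linarith
  have hd2 : (Real.sinh (d / 2) / (d / 2)) ^ 2 * ((B ^ 2 - 2 * E) / (4 * E)) *
      (1 + cosPhase B E d) = (1 - cosPhase B E d ^ 2) / d ^ 2 := by
    have : 1 - cosPhase B E d = 2 * Real.sinh (d / 2) ^ 2 * (B ^ 2 - 2 * E) / (2 * E) := by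
      rw [cosPhase, hc]
      ring
    rw [show 1 - cosPhase B E d ^ 2 = (1 - cosPhase B E d) * (1 + cosPhase B E d) by ring, this]
    field_simp
    ring
  rw [hd2, Real.sqrt_div' _ (by positivity), Real.sqrt_sq hd.le, weight_eq_profile hd hdR, profile]
  have := Real.sqrt_pos.2 (one_sub_cosPhase_sq_pos hE hEc hd hdR)
  field_simp

/-- At `R_E` the factor `1 + κ` vanishes to first order, with slope of size `sinh R_E (B² -
2E)/(2E)`, while `1 - κ` tends to `2`. The value of `sinh R_E` produces the constant. -/
theorem tendsto_mul_weight_radius (hB : 0 < B) (hE : 0 < E) (hEc : E < B ^ 2 / 2) :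
    Tendsto (fun d => √(radius B E - d) * weight B E d) (𝓝[<] radius B E)
      (𝓝 (boundaryConstant B E)) := by
  have hω := frequency_pos hEc
  have hω2 := frequency_sq hEc
  have hD : 0 < B ^ 2 - 2 * E := by linarith
  have hκR : cosPhase B E (radius B E) = -1 := by
    rw [cosPhase, cosh_radius hE hEc]
    field_simp
    ring
  have hder : HasDerivAt (cosPhase B E)
      (-(Real.sinh (radius B E) * (B ^ 2 - 2 * E) / (2 * E))) (radius B E) :=
    ((((Real.hasDerivAt_cosh _).sub_const 1).mul_const _).div_const _).const_sub 1
  have hsl : Tendsto (fun d => (1 + cosPhase B E d) / (radius B E - d)) (𝓝[<] radius B E)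
      (𝓝 (Real.sinh (radius B E) * (B ^ 2 - 2 * E) / (2 * E))) := by
    have h := (hder.tendsto_slope.mono_left (nhdsWithin_mono _ fun x hx => ne_of_lt hx)).neg
    rw [neg_neg] at h
    refine h.congr fun d => ?_
    rw [slope_def_field, hκR, ← div_neg]
    congr 1 <;> ring
  have hκ : Tendsto (cosPhase B E) (𝓝[<] radius B E) (𝓝 (-1)) :=
    tendsto_nhdsWithin_of_tendsto_nhds (continuous_cosPhase.tendsto' _ _ hκR)
  have hm : 0 < Real.sinh (radius B E) * (B ^ 2 - 2 * E) / (2 * E) * (1 - -1) := by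
    have := Real.sinh_pos_iff.2 (radius_pos hE hEc)
    positivity
  have hlim : Tendsto (fun d : ℝ => √(B ^ 2 - 2 * E) / (E * √((1 + cosPhase B E d) /
      (radius B E - d) * (1 - cosPhase B E d)))) (𝓝[<] radius B E)
      (𝓝 (√(B ^ 2 - 2 * E) / (E * √(Real.sinh (radius B E) * (B ^ 2 - 2 * E) / (2 * E) *
        (1 - -1))))) :=
    tendsto_const_nhds.div (tendsto_const_nhds.mul (hsl.mul (hκ.const_sub 1)).sqrt)
      (mul_pos hE (Real.sqrt_pos.2 hm)).ne'
  have hval : √(B ^ 2 - 2 * E) / (E * √(Real.sinh (radius B E) * (B ^ 2 - 2 * E) / (2 * E) *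
      (1 - -1))) = boundaryConstant B E := by
    have hs := Real.sqrt_pos.2 (show 0 < 2 * E by linarith)
    have hs2 := Real.sq_sqrt (show 0 ≤ 2 * E by linarith)
    rw [boundaryConstant, sinh_radius hB hE hEc,
      show √(2 * E) * (B ^ 2 - 2 * E) / (4 * B) = (B ^ 2 - 2 * E) / (4 * B / √(2 * E)) by
        field_simp, Real.sqrt_div' _ (by positivity),
      show 2 * B * √(2 * E) / (B ^ 2 - 2 * E) * (B ^ 2 - 2 * E) / (2 * E) * (1 - -1) =
        4 * B / √(2 * E) by
        generalize √(2 * E) = s at *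
        field_simp
        linear_combination 2 * hs2]
    rw [div_mul_div_comm, one_mul]
  rw [hval] at hlim
  refine hlim.congr' ?_
  filter_upwards [self_mem_nhdsWithin, mem_nhdsWithin_of_mem_nhds
    (lt_mem_nhds (radius_pos hE hEc))] with d hdR hd
  have hdR' : 0 < radius B E - d := sub_pos.2 hdR
  rw [show (1 + cosPhase B E d) / (radius B E - d) * (1 - cosPhase B E d) =
    (1 - cosPhase B E d ^ 2) / (radius B E - d) by ring, Real.sqrt_div' _ hdR'.le,
    weight_eq_profile hd hdR, profile]
  have := Real.sqrt_pos.2 (one_sub_cosPhase_sq_pos hE hEc hd hdR)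
  have := Real.sqrt_pos.2 hdR'
  field_simp

theorem boundaryConstant_pos (hB : 0 < B) (hE : 0 < E) (hEc : E < B ^ 2 / 2) :
    0 < boundaryConstant B E := by
  have hD : 0 < B ^ 2 - 2 * E := by linarith
  unfold boundaryConstant
  positivity

theorem isEquivalent_weight_zero (hE : 0 < E) (hEc : E < B ^ 2 / 2) :
    weight B E ~[𝓝[>] 0] fun d => √(2 / E) / d := by
  have hA : 0 < √(2 / E) := by positivity
  refine (Asymptotics.isEquivalent_iff_tendsto_one ?_).2 ?_
  · filter_upwards [self_mem_nhdsWithin] with d hd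
    exact (div_pos hA hd).ne'
  · have h := (tendsto_mul_weight_zero hE hEc).div_const √(2 / E)
    rw [div_self hA.ne'] at h
    refine h.congr' ?_
    filter_upwards [self_mem_nhdsWithin] with d hd
    have : d ≠ 0 := ne_of_gt hd
    simp only [Pi.div_apply]
    field_simp

open Classical in
/-- The leading term of the density at a branch of the boundary curve, as a function of the distance
from the center. -/
noncomputable def boundaryModel (R d : ℝ) : ℝ := if d < R then 1 / √(R - d) else 0

theorem boundaryModel_nonneg (R d : ℝ) : 0 ≤ boundaryModel R d := by
  unfold boundaryModel
  split_ifs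
  · positivity
  · exact le_rfl

/-- A two-sided statement is possible because both functions vanish from `R_E` on. It is needed
because a point may approach a branch from either side. -/
theorem isEquivalent_weight_radius (hB : 0 < B) (hE : 0 < E) (hEc : E < B ^ 2 / 2) :
    weight B E ~[𝓝 (radius B E)] fun d =>
      boundaryConstant B E * boundaryModel (radius B E) d := by
  have hC := boundaryConstant_pos hB hE hEc
  have h1 : weight B E ~[𝓝[<] radius B E] fun d =>
      boundaryConstant B E * boundaryModel (radius B E) d := by
    have hmod : ∀ d < radius B E, boundaryModel (radius B E) d = 1 / √(radius B E - d) :=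
      fun d hd => if_pos hd
    refine (Asymptotics.isEquivalent_iff_tendsto_one ?_).2 ?_
    · filter_upwards [self_mem_nhdsWithin] with d hd
      rw [hmod d hd]
      exact (mul_pos hC (one_div_pos.2 (Real.sqrt_pos.2 (sub_pos.2 hd)))).ne'
    · have h := (tendsto_mul_weight_radius hB hE hEc).div_const (boundaryConstant B E)
      rw [div_self hC.ne'] at h
      refine h.congr' ?_
      filter_upwards [self_mem_nhdsWithin] with d hd
      have := Real.sqrt_pos.2 (sub_pos.2 hd)
      rw [Pi.div_apply, hmod d hd]
      field_simp
  have h2 : weight B E ~[𝓝[≥] radius B E] fun d =>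
      boundaryConstant B E * boundaryModel (radius B E) d := by
    refine Asymptotics.IsEquivalent.congr_left Asymptotics.IsEquivalent.refl ?_
    filter_upwards [self_mem_nhdsWithin] with d hd
    rw [weight_eq_zero fun h => not_lt.2 hd h.2, boundaryModel, if_neg (not_lt.2 hd), mul_zero]
  rw [← nhdsLT_sup_nhdsGE]
  exact Asymptotics.IsLittleO.sup h1 h2

end

end MagneticTorus

/-! ### Geodesics, boundary branches and local lifts -/

namespace MagneticTorus

/-- Every point lies on a geodesic line through a given point, parametrized by arc length. -/
theorem exists_isometry_through (z₀ u : ℍ) :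
    ∃ c : ℝ → ℍ, Isometry c ∧ c 0 = z₀ ∧ c (dist u z₀) = u := by
  obtain ⟨g, hg⟩ := MulAction.exists_smul_eq SL(2, ℝ) UpperHalfPlane.I z₀
  let q : ℝ → ℍ := fun s => UpperHalfPlane.mk ⟨0, Real.exp s⟩ (Real.exp_pos s)
  have hq : Isometry q := UpperHalfPlane.isometry_vertical_line 0
  have hq0 : q 0 = UpperHalfPlane.I := UpperHalfPlane.ext (by
    simp [q, Complex.ext_iff])
  set u' : ℍ := g⁻¹ • u with hu'
  have hd : dist u z₀ = dist u' UpperHalfPlane.I := by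
    rw [← dist_smul g u', hu', smul_inv_smul, hg]
  have hnn : ‖hyperboloidCoord u'‖ = ‖hyperboloidCoord (q (dist u z₀))‖ := by
    rw [norm_hyperboloidCoord, norm_hyperboloidCoord, ← hd, ← hq0, hq.dist_eq, Real.dist_eq,
      sub_zero, abs_of_nonneg dist_nonneg]
  -- Points at equal distance from `i` differ by a rotation about `i`; at distance zero any angle
  -- will do.
  obtain ⟨θ, hθ⟩ : ∃ θ : ℝ, Complex.exp (θ * Complex.I) * hyperboloidCoord (q (dist u z₀)) =
      hyperboloidCoord u' := by
    by_cases h0 : hyperboloidCoord (q (dist u z₀)) = 0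
    · refine ⟨0, ?_⟩
      rw [h0, norm_zero, norm_eq_zero] at hnn
      rw [h0, hnn, mul_zero]
    · obtain ⟨θ, -, h⟩ := exists_exp_eq
        (w := hyperboloidCoord u' / hyperboloidCoord (q (dist u z₀))) (by
          rw [norm_div, hnn, div_self (norm_ne_zero_iff.2 h0)])
      exact ⟨θ, by rw [h, div_mul_cancel₀ _ h0]⟩
  refine ⟨fun s => g • rotMatrix θ • q s, ?_, ?_, ?_⟩
  · exact (isometry_smul ℍ g).comp ((isometry_smul ℍ (rotMatrix θ)).comp hq)
  · simp only [hq0, rotMatrix_smul_I, hg]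
  · simp only
    rw [hyperboloidCoord_injective ((hyperboloidCoord_rotMatrix_smul θ _).trans hθ), hu',
      smul_inv_smul]

/-- The point of the circle of radius `R` on the ray through `u`. -/
theorem exists_radial_point {z₀ u : ℍ} {R : ℝ} (hu : dist u z₀ ≤ R) :
    ∃ p, dist p z₀ = R ∧ dist u p = R - dist u z₀ := by
  obtain ⟨c, hc, h0, h1⟩ := exists_isometry_through z₀ u
  refine ⟨c R, ?_, ?_⟩
  · rw [← h0, hc.dist_eq, Real.dist_eq, sub_zero, abs_of_nonneg (dist_nonneg.trans hu)]
  · conv_lhs => rw [← h1]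
    rw [hc.dist_eq, dist_comm, Real.dist_eq, abs_of_nonneg (sub_nonneg.2 hu)]

/-- Nonnegative models cannot cancel, so each is at most their sum, which also absorbs bounded
errors since it tends to infinity. -/
theorem isEquivalent_sum {ι X : Type*} {s : Finset ι} {F : Filter X} {f m : ι → X → ℝ}
    (hm : ∀ i ∈ s, ∀ x, 0 ≤ m i x)
    (h : ∀ i ∈ s, (f i - m i) =o[F] m i ∨ (f i - m i) =O[F] fun _ => (1 : ℝ))
    (hM : Tendsto (fun x => ∑ i ∈ s, m i x) F atTop) :
    (fun x => ∑ i ∈ s, f i x) ~[F] fun x => ∑ i ∈ s, m i x := by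
  have h1 : (fun _ : X => (1 : ℝ)) =o[F] fun x => ∑ i ∈ s, m i x :=
    Asymptotics.isLittleO_const_left.2 (Or.inr (tendsto_norm_atTop_atTop.comp hM))
  have hsum : (fun x => ∑ i ∈ s, (f i - m i) x) =o[F] fun x => ∑ i ∈ s, m i x := by
    refine Asymptotics.IsLittleO.fun_sum fun i hi => ?_
    rcases h i hi with h | h
    · refine h.trans_isBigO (Asymptotics.IsBigO.of_bound 1 (Eventually.of_forall fun x => ?_))
      rw [one_mul, Real.norm_of_nonneg (hm i hi x),
        Real.norm_of_nonneg (Finset.sum_nonneg fun j hj => hm j hj x)]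
      exact Finset.single_le_sum (fun j hj => hm j hj x) hi
    · exact h.trans_isLittleO h1
  refine hsum.congr_left fun x => ?_
  simp only [Pi.sub_apply, Finset.sum_sub_distrib]

variable {B E : ℝ} {Γ : Subgroup SL(2, ℝ)}

namespace Surface

theorem smul_eq_smul_of_eq (hΓ : IsClosedSurfaceGroup Γ) {γ γ' : SL(2, ℝ)} (hγ : γ ∈ Γ)
    (hγ' : γ' ∈ Γ) {z : ℍ} (h : γ • z = γ' • z) (w : ℍ) : γ • w = γ' • w := by
  have := smul_eq_of_fixed hΓ (Γ.mul_mem (Γ.inv_mem hγ') hγ) (z := z)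
    (by rw [mul_smul, h, inv_smul_smul]) w
  rw [mul_smul, inv_smul_eq_iff] at this
  exact this

/-- The boundary branch through `w`, seen from a point `u` close to `w`. -/
theorem mem_innerBranch_iff (hΓ : IsClosedSurfaceGroup Γ) {δ r ε R : ℝ} {z₀ w u : ℍ}
    (hδ : ∀ a b : ℍ, proj Γ a = proj Γ w → proj Γ b = proj Γ w → dist a b < δ → a = b)
    (hrδ : r ≤ δ / 4) (hw : dist w z₀ = R) (hu : dist u w < r / 2)
    (hε : dist u w < ε) :
    proj Γ u ∈ innerBranch Γ z₀ R ε r w ↔ dist u z₀ < R := by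
  have hr : 0 < r := by linarith [dist_nonneg (x := u) (y := w)]
  constructor
  · rintro ⟨u', ⟨⟨-, hu'R⟩, hu'w⟩, hu'⟩
    obtain ⟨γ, hγ, rfl⟩ := proj_eq_iff.1 hu'
    rw [Metric.mem_ball] at hu'w
    -- Both `u` and its translate lie near `w`, so by separation `γ` fixes `w` and acts trivially:
    -- no other sheet interferes.
    have hfix : γ • w = w := hδ _ _ (proj_smul hγ w) rfl (by
      calc dist (γ • w) w ≤ dist (γ • w) (γ • u) + dist (γ • u) w := dist_triangle _ _ _
        _ < δ := by rw [dist_smul, dist_comm w u]; linarith)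
    rwa [smul_eq_of_fixed hΓ hγ hfix] at hu'R
  · intro h
    refine ⟨u, ⟨⟨?_, h⟩, ?_⟩, rfl⟩
    · have := dist_triangle w u z₀
      rw [dist_comm w u] at this
      linarith
    · rw [Metric.mem_ball]
      linarith

/-- The triangle inequality through `z₀` bounds the distance to the arc from below, and the radial
point attains it. That point is within `r` of `w` because `R - dist u z₀ ≤ dist u w < r / 2`. -/
theorem sdistSet_branch (hΓ : IsClosedSurfaceGroup Γ) {δ r R : ℝ} {z₀ w u : ℍ}
    (hδ : ∀ a b : ℍ, proj Γ a = proj Γ w → proj Γ b = proj Γ w → dist a b < δ → a = b)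
    (hrδ : r ≤ δ / 4) (hw : dist w z₀ = R) (hu : dist u w < r / 2)
    (hR : dist u z₀ < R) :
    sdistSet (proj Γ u) (branch Γ z₀ R r w) = R - dist u z₀ := by
  have hr : 0 < r := by linarith [dist_nonneg (x := u) (y := w)]
  have hRu : R - dist u z₀ ≤ dist u w := by
    have := dist_triangle w u z₀
    rw [dist_comm w u] at this
    linarith
  have hlow : ∀ y ∈ branch Γ z₀ R r w, R - dist u z₀ ≤ sdist (proj Γ u) y := by
    rintro y ⟨p, ⟨hp, hpw⟩, rfl⟩
    rw [Metric.mem_ball] at hpw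
    obtain ⟨q, hq, hd⟩ := exists_sdist_eq hΓ u (proj Γ p)
    obtain ⟨γ, hγ, rfl⟩ := proj_eq_iff.1 hq
    rw [hd]
    by_cases hfix : γ • w = w
    · rw [smul_eq_of_fixed hΓ hγ hfix]
      have := dist_triangle p u z₀
      rw [dist_comm p u, show dist p z₀ = R from hp] at this
      linarith
    -- A translate that moves `w` carries `p` farther than `4r - 3r/2` from `u`, too far to compete.
    · have h1 : δ ≤ dist (γ • w) w := by
        by_contra! h
        exact hfix (hδ _ _ (proj_smul hγ w) rfl h)
      have h2 := dist_triangle4 (γ • w) (γ • p) u w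
      rw [dist_smul, dist_comm w p, dist_comm (γ • p) u] at h2
      linarith
  obtain ⟨p, hp, hup⟩ := exists_radial_point hR.le
  have hpm : proj Γ p ∈ branch Γ z₀ R r w := ⟨p, ⟨hp, by
    rw [Metric.mem_ball]
    have := dist_triangle p u w
    rw [dist_comm p u] at this
    linarith⟩, rfl⟩
  refine IsLeast.csInf_eq ⟨⟨proj Γ p, hpm, ?_⟩, ?_⟩
  · exact le_antisymm (hlow _ hpm) ((sdist_le u p).trans hup.le)
  · rintro d ⟨y, hy, rfl⟩
    exact hlow y hy

end Surface

open CotangentPlane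

/-- Near `v₀` the density is a sum over the translates of the point by finitely many deck
transformations, indexed by lifts of `proj v₀`. -/
theorem exists_local_lifts (hΓ : IsClosedSurfaceGroup Γ) (hE : 0 < E) (hEc : E < B ^ 2 / 2)
    (g : SL(2, ℝ)) (v₀ : ℍ) :
    ∃ (P : Finset ℍ) (τ : ℍ → SL(2, ℝ)), (∀ v ∈ P, τ v ∈ Γ ∧ τ v • v₀ = v) ∧
      (∀ γ ∈ Γ, dist (γ • v₀) (g • UpperHalfPlane.I) ≤ radius B E + 1 → γ • v₀ ∈ P) ∧
      ∀ z, dist z v₀ < 1 →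
        density B E (CotangentSurface.proj Γ (g • upward √(2 * E))) (Surface.proj Γ z) =
          ∑ v ∈ P, weight B E (dist (τ v • z) (g • UpperHalfPlane.I)) := by
  classical
  -- If `z` is within `1` of `v₀` and `γ • z` lies in the disk, then `γ • v₀` is within `R_E + 1` of
  -- the center. One finite set therefore serves all such `z`.
  have hf := Surface.finite_lifts hΓ (Surface.proj Γ v₀) (g • UpperHalfPlane.I) (radius B E + 1)
  have hmem : ∀ v, v ∈ hf.toFinset ↔ Surface.proj Γ v = Surface.proj Γ v₀ ∧
      dist v (g • UpperHalfPlane.I) ≤ radius B E + 1 := fun v => Finite.mem_toFinset hf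
  have hτ : ∀ v, ∃ γ : SL(2, ℝ), v ∈ hf.toFinset → γ ∈ Γ ∧ γ • v₀ = v := by
    intro v
    by_cases hv : v ∈ hf.toFinset
    · obtain ⟨γ, hγ, h⟩ := Surface.proj_eq_iff.1 ((hmem v).1 hv).1
      exact ⟨γ, fun _ => ⟨hγ, h⟩⟩
    · exact ⟨1, fun h => absurd h hv⟩
  choose τ hτ using hτ
  have hP : ∀ γ ∈ Γ, dist (γ • v₀) (g • UpperHalfPlane.I) ≤ radius B E + 1 →
      γ • v₀ ∈ hf.toFinset := fun γ hγ h => (hmem _).2 ⟨Surface.proj_smul hγ v₀, h⟩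
  refine ⟨hf.toFinset, τ, hτ, hP, fun z hz => ?_⟩
  rw [density_eq_sum hΓ hE hEc g (Surface.proj Γ z) (L := hf.toFinset.image fun v => τ v • z),
    Finset.sum_image]
  · intro v hv v' hv' h
    have := Surface.smul_eq_smul_of_eq hΓ (hτ v hv).1 (hτ v' hv').1 h v₀
    rwa [(hτ v hv).2, (hτ v' hv').2] at this
  · intro u hu
    obtain ⟨v, hv, rfl⟩ := Finset.mem_image.1 hu
    exact Surface.proj_smul (hτ v hv).1 z
  · intro u hu hur
    obtain ⟨γ, hγ, rfl⟩ := Surface.proj_eq_iff.1 hu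
    have hv := hP γ hγ (by
      have := dist_triangle (γ • v₀) (γ • z) (g • UpperHalfPlane.I)
      rw [dist_smul, dist_comm v₀ z] at this
      linarith)
    exact Finset.mem_image.2 ⟨_, hv, Surface.smul_eq_smul_of_eq hΓ (hτ _ hv).1 hγ (hτ _ hv).2 z⟩

theorem tendsto_dist_smul (γ : SL(2, ℝ)) (z₀ v₀ : ℍ) :
    Tendsto (fun z => dist (γ • z) z₀) (𝓝 v₀) (𝓝 (dist (γ • v₀) z₀)) :=
  (((isometry_smul ℍ γ).continuous.dist continuous_const).tendsto v₀)

/-- The branch sum near `proj v₀` in terms of the distances of the lifts. -/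
theorem eventually_branchSum_eq (hΓ : IsClosedSurfaceGroup Γ) {z₀ v₀ : ℍ} {R : ℝ}
    {P : Finset ℍ} {τ : ℍ → SL(2, ℝ)} (hτ : ∀ v ∈ P, τ v ∈ Γ ∧ τ v • v₀ = v)
    (hP : ∀ γ ∈ Γ, dist (γ • v₀) z₀ ≤ R + 1 → γ • v₀ ∈ P) {ε : ℝ} (hε : 0 < ε) :
    ∀ᶠ r in 𝓝[>] (0 : ℝ), ∀ᶠ z in 𝓝 v₀,
      branchSum z₀ R ε r (Surface.proj Γ v₀) (Surface.proj Γ z) =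
        ∑ v ∈ P, if dist v z₀ = R then boundaryModel R (dist (τ v • z) z₀) else 0 := by
  classical
  obtain ⟨δ, hδ, hsep⟩ := Surface.exists_separation hΓ (Surface.proj Γ v₀)
  filter_upwards [Ioc_mem_nhdsGT (show 0 < δ / 4 by linarith)] with r hr
  have hset : boundaryLifts z₀ R (Surface.proj Γ v₀) = ↑(P.filter fun v => dist v z₀ = R) := by
    ext v
    rw [Finset.coe_filter]
    constructor
    · rintro ⟨hv, hd⟩
      obtain ⟨γ, hγ, rfl⟩ := Surface.proj_eq_iff.1 hv
      exact ⟨hP γ hγ (by linarith), hd⟩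
    · rintro ⟨hv, hd⟩
      refine ⟨?_, hd⟩
      rw [← (hτ v hv).2]
      exact Surface.proj_smul (hτ v hv).1 v₀
  -- The closeness under which the two lemmas on a single branch apply to every lift in `P`.
  have hnear : ∀ᶠ z in 𝓝 v₀, ∀ v ∈ P, dist (τ v • z) v < min (r / 2) ε := by
    refine (Filter.eventually_all_finset P).2 fun v hv => ?_
    have h := tendsto_dist_smul (τ v) v v₀
    rw [(hτ v hv).2, dist_self] at h
    exact h.eventually (gt_mem_nhds (lt_min (by linarith [hr.1]) hε))
  filter_upwards [hnear] with z hz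
  rw [branchSum, hset, finsum_mem_coe_finset, Finset.sum_filter]
  refine Finset.sum_congr rfl fun v hv => ?_
  split_ifs with hd
  · have hv' : Surface.proj Γ v = Surface.proj Γ v₀ := by
      conv_lhs => rw [← (hτ v hv).2]
      exact Surface.proj_smul (hτ v hv).1 v₀
    have h1 := (hz v hv).trans_le (min_le_left _ _)
    have h2 := (hz v hv).trans_le (min_le_right _ _)
    have hsep' := hsep
    rw [← hv'] at hsep'
    rw [← Surface.proj_smul (hτ v hv).1 z, boundaryModel]
    have hiff := Surface.mem_innerBranch_iff hΓ hsep' hr.2 hd h1 h2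
    split_ifs with h
    · rw [indicator_of_mem (hiff.2 h), Surface.sdistSet_branch hΓ hsep' hr.2 hd h1 h]
    · exact indicator_of_notMem (fun h' => h (hiff.1 h')) _
  · rfl

end MagneticTorus

/-! ### Leading terms of the local sum -/

namespace MagneticTorus

variable {B E : ℝ} {Γ : Subgroup SL(2, ℝ)}

open CotangentPlane

/-- The leading term of the contribution of the lift `v` at distance `d` from `z₀`. -/
noncomputable def singularPart (B E : ℝ) (z₀ v : ℍ) (d : ℝ) : ℝ :=
  (if dist v z₀ = 0 then √(2 / E) / d else 0) +
    boundaryConstant B E * if dist v z₀ = radius B E then boundaryModel (radius B E) d else 0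

theorem singularPart_nonneg (hB : 0 < B) (hE : 0 < E) (hEc : E < B ^ 2 / 2) (z₀ v : ℍ) {d : ℝ}
    (hd : 0 ≤ d) : 0 ≤ singularPart B E z₀ v d := by
  have h1 := (boundaryConstant_pos hB hE hEc).le
  have h2 := boundaryModel_nonneg (radius B E) d
  unfold singularPart
  split_ifs <;> positivity

theorem tendsto_dist_smul_ne {γ : SL(2, ℝ)} {v₀ z₀ : ℍ} (h : γ • v₀ = z₀) :
    Tendsto (fun z => dist (γ • z) z₀) (𝓝[≠] v₀) (𝓝[>] 0) := by
  have h0 := tendsto_dist_smul γ z₀ v₀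
  rw [h, dist_self] at h0
  refine tendsto_nhdsWithin_iff.2 ⟨h0.mono_left nhdsWithin_le_nhds, ?_⟩
  filter_upwards [self_mem_nhdsWithin] with z hz
  rw [mem_Ioi, dist_pos, ← h]
  exact fun h' => hz (MulAction.injective γ h')

/-- A lift at the center or on the circle is equivalent to its model. Any other lift sits where
`weight` is continuous, and contributes a bounded term with model zero. -/
theorem weight_sub_singularPart (hB : 0 < B) (hE : 0 < E) (hEc : E < B ^ 2 / 2)
    {γ : SL(2, ℝ)} {v₀ v : ℍ} (z₀ : ℍ) (h : γ • v₀ = v) :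
    ((fun z => weight B E (dist (γ • z) z₀)) - fun z => singularPart B E z₀ v (dist (γ • z) z₀))
        =o[𝓝[≠] v₀] (fun z => singularPart B E z₀ v (dist (γ • z) z₀)) ∨
      ((fun z => weight B E (dist (γ • z) z₀)) - fun z => singularPart B E z₀ v (dist (γ • z) z₀))
        =O[𝓝[≠] v₀] fun _ => (1 : ℝ) := by
  have hR := radius_pos hE hEc
  have ht := tendsto_dist_smul γ z₀ v₀
  rw [h] at ht
  have htn : Tendsto (fun z => dist (γ • z) z₀) (𝓝[≠] v₀) (𝓝 (dist v z₀)) :=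
    ht.mono_left nhdsWithin_le_nhds
  by_cases h0 : dist v z₀ = 0
  · left
    have hs : singularPart B E z₀ v = fun d => √(2 / E) / d := by
      ext d
      rw [singularPart, if_pos h0, if_neg (by rw [h0]; exact hR.ne), mul_zero, add_zero]
    rw [hs]
    exact (isEquivalent_weight_zero hE hEc).comp_tendsto
      (tendsto_dist_smul_ne (h.trans (dist_eq_zero.1 h0)))
  by_cases h1 : dist v z₀ = radius B E
  · left
    have hs : singularPart B E z₀ v = fun d => boundaryConstant B E *
        boundaryModel (radius B E) d := by
      ext d
      rw [singularPart, if_neg h0, if_pos h1, zero_add]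
    rw [hs]
    rw [h1] at htn
    exact (isEquivalent_weight_radius hB hE hEc).comp_tendsto htn
  · right
    have hs : singularPart B E z₀ v = fun _ => 0 := by
      ext d
      rw [singularPart, if_neg h0, if_neg h1, mul_zero, add_zero]
    rw [hs]
    have hc := (continuousAt_weight hE hEc (lt_of_le_of_ne dist_nonneg (Ne.symm h0)) h1)
    have := (hc.tendsto.comp htn).isBigO_one ℝ
    refine this.congr_left fun z => ?_
    simp

/-- The density is asymptotic to the sum of the singular parts as soon as that sum is
unbounded. -/
theorem isEquivalent_density (hB : 0 < B) (hE : 0 < E)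
    (hEc : E < B ^ 2 / 2) (g : SL(2, ℝ)) {v₀ : ℍ} {P : Finset ℍ} {τ : ℍ → SL(2, ℝ)}
    (hτ : ∀ v ∈ P, τ v ∈ Γ ∧ τ v • v₀ = v)
    (hα : ∀ z, dist z v₀ < 1 →
      density B E (CotangentSurface.proj Γ (g • upward √(2 * E))) (Surface.proj Γ z) =
        ∑ v ∈ P, weight B E (dist (τ v • z) (g • UpperHalfPlane.I)))
    {A : Set (Surface Γ)} (hA : 𝓝[Surface.proj Γ ⁻¹' A] v₀ ≤ 𝓝[≠] v₀)
    (hM : Tendsto (fun z => ∑ v ∈ P, singularPart B E (g • UpperHalfPlane.I) v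
      (dist (τ v • z) (g • UpperHalfPlane.I))) (𝓝[Surface.proj Γ ⁻¹' A] v₀) atTop)
    {S : Surface Γ → ℝ}
    (hS : ∀ᶠ z in 𝓝 v₀, z ≠ v₀ → ∑ v ∈ P, singularPart B E (g • UpperHalfPlane.I) v
      (dist (τ v • z) (g • UpperHalfPlane.I)) = S (Surface.proj Γ z)) :
    density B E (CotangentSurface.proj Γ (g • upward √(2 * E)))
      ~[𝓝[A] (Surface.proj Γ v₀)] S := by
  have h := isEquivalent_sum (s := P) (F := 𝓝[Surface.proj Γ ⁻¹' A] v₀)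
    (f := fun v z => weight B E (dist (τ v • z) (g • UpperHalfPlane.I)))
    (m := fun v z => singularPart B E (g • UpperHalfPlane.I) v
      (dist (τ v • z) (g • UpperHalfPlane.I)))
    (fun v _ z => singularPart_nonneg hB hE hEc _ _ dist_nonneg)
    (fun v hv => (weight_sub_singularPart hB hE hEc _ (hτ v hv).2).imp
      (fun h => h.mono hA) fun h => h.mono hA) hM
  have h1 : ∀ᶠ z in 𝓝[Surface.proj Γ ⁻¹' A] v₀, dist z v₀ < 1 :=
    nhdsWithin_le_nhds (Metric.ball_mem_nhds v₀ one_pos)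
  have h2 : ∀ᶠ z in 𝓝[Surface.proj Γ ⁻¹' A] v₀, z ≠ v₀ := hA self_mem_nhdsWithin
  -- `proj` is open and continuous, so asymptotics on `Σ` can be checked on `ℍ`.
  rw [← Surface.map_nhdsWithin_preimage_proj, Asymptotics.IsEquivalent,
    Asymptotics.isLittleO_map]
  refine ((h.congr_left ?_).congr_right ?_).isLittleO
  · filter_upwards [h1] with z hz
    exact (hα z hz).symm
  · filter_upwards [h2, nhdsWithin_le_nhds hS] with z hz hz'
    exact hz' hz

end MagneticTorus

/-! ### Asymptotics of the density at the center and at the boundary curve -/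

namespace MagneticTorus

variable {B E : ℝ} {Γ : Subgroup SL(2, ℝ)}

open CotangentPlane

theorem finite_boundaryLifts (hΓ : IsClosedSurfaceGroup Γ) (z₀ : ℍ) (R : ℝ) (y : Surface Γ) :
    (boundaryLifts z₀ R y).Finite :=
  (Surface.finite_lifts hΓ y z₀ R).subset fun _ hv => ⟨hv.1, hv.2.le⟩

/-- No lift is at the center or on the circle, so every term of the local sum is continuous. This is
more than the upper semicontinuity required. -/
theorem continuousAt_density (hΓ : IsClosedSurfaceGroup Γ) (hE : 0 < E) (hEc : E < B ^ 2 / 2)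
    (g : SL(2, ℝ)) {y : Surface Γ} (hy : y ≠ Surface.proj Γ (g • UpperHalfPlane.I))
    (hy' : y ∉ boundaryCurve Γ (g • UpperHalfPlane.I) (radius B E)) :
    ContinuousAt (density B E (CotangentSurface.proj Γ (g • upward √(2 * E)))) y := by
  obtain ⟨v₀, rfl⟩ := Surface.proj_surjective y
  obtain ⟨P, τ, hτ, -, hα⟩ := exists_local_lifts hΓ hE hEc g v₀
  rw [ContinuousAt, ← Surface.isOpenMap_proj.map_nhds_eq Surface.continuous_proj.continuousAt,
    tendsto_map'_iff]
  have hproj : ∀ v ∈ P, Surface.proj Γ v = Surface.proj Γ v₀ := fun v hv => by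
    conv_lhs => rw [← (hτ v hv).2]
    exact Surface.proj_smul (hτ v hv).1 v₀
  have hlim : Tendsto (fun z => ∑ v ∈ P, weight B E (dist (τ v • z) (g • UpperHalfPlane.I)))
      (𝓝 v₀) (𝓝 (∑ v ∈ P, weight B E (dist (τ v • v₀) (g • UpperHalfPlane.I)))) := by
    refine tendsto_finsetSum _ fun v hv => ?_
    refine (ContinuousAt.tendsto ?_).comp (tendsto_dist_smul (τ v) _ v₀)
    rw [(hτ v hv).2]
    refine continuousAt_weight hE hEc (dist_pos.2 ?_) ?_
    · rintro rfl
      exact hy (hproj _ hv).symm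
    · exact fun h => hy' ⟨v, h, hproj v hv⟩
  rw [hα v₀ (by rw [dist_self]; exact one_pos)]
  refine hlim.congr' ?_
  filter_upwards [Metric.ball_mem_nhds v₀ one_pos] with z hz
  exact (hα z hz).symm

theorem sum_singularPart (z₀ : ℍ) (P : Finset ℍ) (d : ℍ → ℝ) :
    ∑ v ∈ P, singularPart B E z₀ v (d v) = (∑ v ∈ P, if dist v z₀ = 0 then √(2 / E) / d v else 0) +
      boundaryConstant B E * ∑ v ∈ P, if dist v z₀ = radius B E then
        boundaryModel (radius B E) (d v) else 0 := by
  simp only [singularPart, Finset.sum_add_distrib, Finset.mul_sum]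

/-- The asymptotics of the density at the center of the disk. -/
theorem isEquivalent_density_center (hΓ : IsClosedSurfaceGroup Γ) (hB : 0 < B) (hE : 0 < E)
    (hEc : E < B ^ 2 / 2) (g : SL(2, ℝ)) {P : Finset ℍ} {τ : ℍ → SL(2, ℝ)}
    (hτ : ∀ v ∈ P, τ v ∈ Γ ∧ τ v • g • UpperHalfPlane.I = v)
    (hP : ∀ γ ∈ Γ, dist (γ • g • UpperHalfPlane.I) (g • UpperHalfPlane.I) ≤ radius B E + 1 →
      γ • g • UpperHalfPlane.I ∈ P)
    (hα : ∀ z, dist z (g • UpperHalfPlane.I) < 1 →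
      density B E (CotangentSurface.proj Γ (g • upward √(2 * E))) (Surface.proj Γ z) =
        ∑ v ∈ P, weight B E (dist (τ v • z) (g • UpperHalfPlane.I)))
    {S : Surface Γ → ℝ}
    (hS : ∀ᶠ z in 𝓝 (g • UpperHalfPlane.I), S (Surface.proj Γ z) =
      ∑ v ∈ P, if dist v (g • UpperHalfPlane.I) = radius B E then
        boundaryModel (radius B E) (dist (τ v • z) (g • UpperHalfPlane.I)) else 0) :
    density B E (CotangentSurface.proj Γ (g • upward √(2 * E)))
      ~[𝓝[≠] (Surface.proj Γ (g • UpperHalfPlane.I))] fun x =>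
        √(2 / E) / Surface.sdist (Surface.proj Γ (g • UpperHalfPlane.I)) x +
          boundaryConstant B E * S x := by
  set z₀ := g • UpperHalfPlane.I with hz₀
  obtain ⟨δ, hδ, hsep⟩ := Surface.exists_separation hΓ (Surface.proj Γ z₀)
  have hA : 0 < √(2 / E) := by positivity
  have hmem : z₀ ∈ P := by
    have := hP 1 Γ.one_mem (by
      rw [one_smul, dist_self]
      linarith [radius_pos hE hEc])
    rwa [one_smul] at this
  -- The translate indexed by `z₀` is the identity on `ℍ`. It alone gives the `1/d` term, which
  -- already tends to infinity.
  have hfix : ∀ z, τ z₀ • z = z := Surface.smul_eq_of_fixed hΓ (hτ z₀ hmem).1 (hτ z₀ hmem).2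
  have hle : 𝓝[Surface.proj Γ ⁻¹' {Surface.proj Γ z₀}ᶜ] z₀ ≤ 𝓝[≠] z₀ :=
    nhdsWithin_mono _ fun z hz h => hz (congrArg _ h)
  have hsum : ∀ z, ∑ v ∈ P, (if dist v z₀ = 0 then √(2 / E) / dist (τ v • z) z₀ else 0) =
      √(2 / E) / dist z z₀ := by
    intro z
    rw [Finset.sum_eq_single z₀ (fun v _ hv => if_neg (dist_ne_zero.2 hv))
      (fun h => absurd hmem h), if_pos (dist_self z₀), hfix]
  refine isEquivalent_density hB hE hEc g hτ hα hle ?_ ?_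
  · have hd : Tendsto (fun z => √(2 / E) / dist z z₀) (𝓝[≠] z₀) atTop := by
      have h := tendsto_dist_smul_ne (γ := 1) (one_smul _ z₀)
      simp only [one_smul] at h
      exact (tendsto_inv_nhdsGT_zero.comp h).const_mul_atTop hA
    refine tendsto_atTop_mono (fun z => ?_) (hd.mono_left hle)
    rw [← hz₀, sum_singularPart, hsum]
    refine le_add_of_nonneg_right (mul_nonneg (boundaryConstant_pos hB hE hEc).le
      (Finset.sum_nonneg fun v _ => ?_))
    split_ifs
    · exact boundaryModel_nonneg _ _
    · exact le_rfl
  · filter_upwards [hS, Metric.ball_mem_nhds z₀ (half_pos hδ)] with z hz hzδ _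
    rw [← hz₀, sum_singularPart, hsum, hz, Surface.sdist_eq_of_near hΓ hsep hzδ]

/-- Off the inner collar the density is bounded near a boundary point. -/
theorem isBigO_density_outer (hE : 0 < E) (hEc : E < B ^ 2 / 2) (g : SL(2, ℝ)) {v₀ : ℍ}
    (hne : Surface.proj Γ v₀ ≠ Surface.proj Γ (g • UpperHalfPlane.I)) {P : Finset ℍ}
    {τ : ℍ → SL(2, ℝ)} (hτ : ∀ v ∈ P, τ v ∈ Γ ∧ τ v • v₀ = v)
    (hα : ∀ z, dist z v₀ < 1 →
      density B E (CotangentSurface.proj Γ (g • upward √(2 * E))) (Surface.proj Γ z) =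
        ∑ v ∈ P, weight B E (dist (τ v • z) (g • UpperHalfPlane.I)))
    {ε : ℝ} (hε : 0 < ε) {A : Set (Surface Γ)}
    (hA : Disjoint A (innerCollar Γ (g • UpperHalfPlane.I) (radius B E) ε)) :
    density B E (CotangentSurface.proj Γ (g • upward √(2 * E))) =O[𝓝[A] (Surface.proj Γ v₀)]
      fun _ => (1 : ℝ) := by
  rw [← Surface.map_nhdsWithin_preimage_proj, Asymptotics.isBigO_map]
  have hsum : (fun z => ∑ v ∈ P, weight B E (dist (τ v • z) (g • UpperHalfPlane.I)))
      =O[𝓝[Surface.proj Γ ⁻¹' A] v₀] fun _ => (1 : ℝ) := by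
    refine Asymptotics.IsBigO.fun_sum fun v hv => ?_
    have ht := tendsto_dist_smul (τ v) (g • UpperHalfPlane.I) v₀
    rw [(hτ v hv).2] at ht
    have htn : Tendsto (fun z => dist (τ v • z) (g • UpperHalfPlane.I))
      (𝓝[Surface.proj Γ ⁻¹' A] v₀) _ := ht.mono_left nhdsWithin_le_nhds
    by_cases h : dist v (g • UpperHalfPlane.I) = radius B E
    -- Near `v₀` the distance exceeds `R_E - ε`. Off the inner collar it is then at least `R_E`,
    -- where the weight is zero.
    · refine Asymptotics.IsBigO.of_bound 0 ?_
      filter_upwards [self_mem_nhdsWithin,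
        htn.eventually (lt_mem_nhds (show _ < _ from (sub_lt_self _ hε).trans_eq h.symm))]
        with z hz hzd
      rw [weight_eq_zero, norm_zero, zero_mul]
      rintro ⟨-, h'⟩
      exact hA.notMem_of_mem_left hz ⟨τ v • z, ⟨hzd, h'⟩, Surface.proj_smul (hτ v hv).1 z⟩
    · refine ((continuousAt_weight hE hEc (dist_pos.2 ?_) h).tendsto.comp htn).isBigO_one ℝ
      rintro h0
      apply hne
      rw [← h0, ← (hτ v hv).2]
      exact (Surface.proj_smul (hτ v hv).1 v₀).symm
  refine hsum.congr' ?_ EventuallyEq.rfl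
  filter_upwards [nhdsWithin_le_nhds (Metric.ball_mem_nhds v₀ one_pos)] with z hz
  exact (hα z hz).symm

theorem tendsto_boundaryModel (R : ℝ) : Tendsto (boundaryModel R) (𝓝[<] R) atTop := by
  have h : Tendsto (fun d => √(R - d)) (𝓝[<] R) (𝓝[>] 0) := by
    refine tendsto_nhdsWithin_iff.2 ⟨?_, ?_⟩
    · have : Continuous fun d => √(R - d) := by fun_prop
      exact tendsto_nhdsWithin_of_tendsto_nhds (this.tendsto' _ _ (by simp))
    · filter_upwards [self_mem_nhdsWithin] with d hd
      exact Real.sqrt_pos.2 (sub_pos.2 hd)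
  refine (tendsto_inv_nhdsGT_zero.comp h).congr' ?_
  filter_upwards [self_mem_nhdsWithin] with d hd
  rw [boundaryModel, if_pos (show d < R from hd), one_div]
  rfl

/-- Along the inner collar, one of the lifts on the circle moves into the disk. -/
theorem eventually_exists_inner_lift (hΓ : IsClosedSurfaceGroup Γ) {z₀ v₀ : ℍ} {R : ℝ}
    {P : Finset ℍ} {τ : ℍ → SL(2, ℝ)} (hτ : ∀ v ∈ P, τ v ∈ Γ ∧ τ v • v₀ = v)
    (hP : ∀ γ ∈ Γ, dist (γ • v₀) z₀ ≤ R + 1 → γ • v₀ ∈ P) {ε : ℝ}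
    (hε : ∀ v ∈ P, dist v z₀ < R → dist v z₀ < R - ε) :
    ∀ᶠ z in 𝓝[Surface.proj Γ ⁻¹' innerCollar Γ z₀ R ε] v₀,
      ∃ v ∈ P, dist v z₀ = R ∧ dist (τ v • z) z₀ < R := by
  -- Lifts inside the circle are already below `R - ε`, and those outside are above `R`; both
  -- inequalities persist nearby. A lift found in the annulus must therefore come from the circle.
  have hout : ∀ᶠ z in 𝓝 v₀, ∀ v ∈ P, dist v z₀ ≠ R →
      ¬(R - ε < dist (τ v • z) z₀ ∧ dist (τ v • z) z₀ < R) := by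
    refine (Filter.eventually_all_finset P).2 fun v hv => ?_
    have ht := tendsto_dist_smul (τ v) z₀ v₀
    rw [(hτ v hv).2] at ht
    by_cases hlt : dist v z₀ < R
    · filter_upwards [ht.eventually (gt_mem_nhds (hε v hv hlt))] with z hz _ h
      exact lt_asymm hz h.1
    · by_cases heq : dist v z₀ = R
      · exact Eventually.of_forall fun z h => absurd heq h
      · filter_upwards [ht.eventually (lt_mem_nhds (lt_of_le_of_ne (not_lt.1 hlt)
          (Ne.symm heq)))] with z hz _ h
        exact lt_asymm hz h.2
  filter_upwards [self_mem_nhdsWithin, nhdsWithin_le_nhds (Metric.ball_mem_nhds v₀ one_pos),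
    nhdsWithin_le_nhds hout] with z hz hz1 hzo
  obtain ⟨u, hu, hzu⟩ := hz
  obtain ⟨γ, hγ, rfl⟩ := Surface.proj_eq_iff.1 hzu
  have hv : γ • v₀ ∈ P := hP γ hγ (by
    have := dist_triangle (γ • v₀) (γ • z) z₀
    rw [dist_smul, dist_comm v₀ z] at this
    have h1 : dist z v₀ < 1 := hz1
    linarith [hu.2])
  have hτz : τ (γ • v₀) • z = γ • z :=
    Surface.smul_eq_smul_of_eq hΓ (hτ _ hv).1 hγ (hτ _ hv).2 z
  refine ⟨_, hv, ?_, by rw [hτz]; exact hu.2⟩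
  by_contra h
  refine hzo _ hv h ?_
  rw [hτz]
  exact hu

/-- The asymptotics of the density along the inner side of the boundary curve. -/
theorem isEquivalent_density_inner (hΓ : IsClosedSurfaceGroup Γ) (hB : 0 < B) (hE : 0 < E)
    (hEc : E < B ^ 2 / 2) (g : SL(2, ℝ)) {v₀ : ℍ}
    (hne : Surface.proj Γ v₀ ≠ Surface.proj Γ (g • UpperHalfPlane.I)) {P : Finset ℍ}
    {τ : ℍ → SL(2, ℝ)} (hτ : ∀ v ∈ P, τ v ∈ Γ ∧ τ v • v₀ = v)
    (hP : ∀ γ ∈ Γ, dist (γ • v₀) (g • UpperHalfPlane.I) ≤ radius B E + 1 → γ • v₀ ∈ P)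
    (hα : ∀ z, dist z v₀ < 1 →
      density B E (CotangentSurface.proj Γ (g • upward √(2 * E))) (Surface.proj Γ z) =
        ∑ v ∈ P, weight B E (dist (τ v • z) (g • UpperHalfPlane.I)))
    {ε : ℝ} (hε : ∀ v ∈ P, dist v (g • UpperHalfPlane.I) < radius B E →
      dist v (g • UpperHalfPlane.I) < radius B E - ε) {S : Surface Γ → ℝ}
    (hS : ∀ᶠ z in 𝓝 v₀, S (Surface.proj Γ z) =
      ∑ v ∈ P, if dist v (g • UpperHalfPlane.I) = radius B E then
        boundaryModel (radius B E) (dist (τ v • z) (g • UpperHalfPlane.I)) else 0) :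
    density B E (CotangentSurface.proj Γ (g • upward √(2 * E)))
      ~[𝓝[innerCollar Γ (g • UpperHalfPlane.I) (radius B E) ε] (Surface.proj Γ v₀)]
        fun x => boundaryConstant B E * S x := by
  set z₀ := g • UpperHalfPlane.I with hz₀
  have hC := boundaryConstant_pos hB hE hEc
  -- By the choice of `ε` no lift of the limit point lies in the open annulus, so the point is not
  -- in its own inner collar.
  have hle : 𝓝[Surface.proj Γ ⁻¹' innerCollar Γ z₀ (radius B E) ε] v₀ ≤ 𝓝[≠] v₀ := by
    refine nhdsWithin_mono _ ?_
    rintro z ⟨u, hu, hzu⟩ rfl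
    obtain ⟨γ, hγ, rfl⟩ := Surface.proj_eq_iff.1 hzu
    exact lt_asymm hu.1 (hε _ (hP γ hγ (by linarith [hu.2])) hu.2)
  have hsum : ∀ z, ∑ v ∈ P, (if dist v z₀ = 0 then √(2 / E) / dist (τ v • z) z₀ else 0) = 0 := by
    refine fun z => Finset.sum_eq_zero fun v hv => if_neg ?_
    intro h0
    apply hne
    rw [← dist_eq_zero.1 h0, ← (hτ v hv).2]
    exact (Surface.proj_smul (hτ v hv).1 v₀).symm
  refine isEquivalent_density hB hE hEc g hτ hα hle ?_ ?_
  · refine tendsto_atTop.2 fun K => ?_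
    -- Any circle lift that has moved inside contributes at least `K`. Which lift does so may depend
    -- on `z`, so the bound is made uniform over `P`.
    have hbig : ∀ᶠ z in 𝓝 v₀, ∀ v ∈ P, dist v z₀ = radius B E →
        dist (τ v • z) z₀ < radius B E →
          K ≤ boundaryConstant B E * boundaryModel (radius B E) (dist (τ v • z) z₀) := by
      refine (Filter.eventually_all_finset P).2 fun v hv => ?_
      by_cases hd : dist v z₀ = radius B E
      · have ht := tendsto_dist_smul (τ v) z₀ v₀
        rw [(hτ v hv).2, hd] at ht
        have hev := ((tendsto_boundaryModel (radius B E)).const_mul_atTop hC).eventually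
          (eventually_ge_atTop K)
        rw [eventually_nhdsWithin_iff] at hev
        filter_upwards [ht.eventually hev] with z hz _ h
        exact hz h
      · exact Eventually.of_forall fun z h => absurd h hd
    filter_upwards [nhdsWithin_le_nhds hbig, eventually_exists_inner_lift hΓ hτ hP hε]
      with z hz hex
    obtain ⟨v, hv, hvR, hvz⟩ := hex
    rw [← hz₀, sum_singularPart, hsum, zero_add, Finset.mul_sum]
    refine (hz v hv hvR hvz).trans ?_
    have h := Finset.single_le_sum (f := fun v => boundaryConstant B E *
      if dist v z₀ = radius B E then boundaryModel (radius B E) (dist (τ v • z) z₀) else 0)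
      (fun w _ => mul_nonneg hC.le (by
        split_ifs
        · exact boundaryModel_nonneg _ _
        · exact le_rfl)) hv
    simp only [if_pos hvR] at h
    exact h
  · filter_upwards [hS] with z hz _
    rw [← hz₀, sum_singularPart, hsum, zero_add, hz]

end MagneticTorus

/-! ### Supports of the density and of the measure -/

namespace MagneticTorus

variable {B E : ℝ} {Γ : Subgroup SL(2, ℝ)}

open CotangentPlane

theorem density_ne_zero_iff (hΓ : IsClosedSurfaceGroup Γ) (hE : 0 < E) (hEc : E < B ^ 2 / 2)
    (g : SL(2, ℝ)) (y : Surface Γ) :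
    density B E (CotangentSurface.proj Γ (g • upward √(2 * E))) y ≠ 0 ↔
      (interiorLifts B E (g • UpperHalfPlane.I) y).Nonempty := by
  have hf := finite_interiorLifts (B := B) (E := E) hΓ (g • UpperHalfPlane.I) y
  rw [density_eq_sum hΓ hE hEc g y (L := (Surface.finite_lifts hΓ y (g • UpperHalfPlane.I)
    (radius B E)).toFinset) (fun v hv => ((Finite.mem_toFinset _).1 hv).1)
    (fun v hv hd => (Finite.mem_toFinset _).2 ⟨hv, hd.le⟩)]
  constructor
  · intro h
    obtain ⟨v, hv, hne⟩ := Finset.exists_ne_zero_of_sum_ne_zero h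
    refine ⟨v, ((Finite.mem_toFinset _).1 hv).1, ?_⟩
    by_contra hd
    exact hne (weight_eq_zero hd)
  · rintro ⟨v, hv, h1, h2⟩
    refine ne_of_gt (Finset.sum_pos' (fun w _ => weight_nonneg hE _) ⟨v, ?_, weight_pos hE hEc h1 h2⟩)
    exact (Finite.mem_toFinset _).2 ⟨hv, h2.le⟩

theorem closure_support_density (hΓ : IsClosedSurfaceGroup Γ) (hE : 0 < E) (hEc : E < B ^ 2 / 2)
    (g : SL(2, ℝ)) :
    closure (Function.support (density B E (CotangentSurface.proj Γ (g • upward √(2 * E))))) =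
      Surface.disk (Surface.proj Γ (g • UpperHalfPlane.I)) (radius B E) := by
  have hR := radius_pos hE hEc
  apply Subset.antisymm
  · refine closure_minimal (fun y hy => ?_) (Surface.isClosed_disk hΓ _ _)
    obtain ⟨v, hv, -, hd⟩ := (density_ne_zero_iff hΓ hE hEc g y).1 hy
    rw [Surface.disk_eq_image hΓ]
    exact ⟨v, hd.le, hv⟩
  · rw [Surface.disk_eq_image hΓ]
    rintro _ ⟨u, hu, rfl⟩
    -- Along the geodesic from the center through `u`, the parameters in `(0, R_E)` give points of
    -- nonzero density; their closure reaches the center and the circle.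
    obtain ⟨c, hc, h0, h1⟩ := exists_isometry_through (g • UpperHalfPlane.I) u
    have hcl : dist u (g • UpperHalfPlane.I) ∈ closure (Ioo 0 (radius B E)) := by
      rw [closure_Ioo hR.ne]
      exact ⟨dist_nonneg, hu⟩
    have h := map_mem_closure (Surface.continuous_proj.comp hc.continuous) hcl
      (t := Function.support (density B E (CotangentSurface.proj Γ (g • upward √(2 * E)))))
      (fun s hs => (density_ne_zero_iff hΓ hE hEc g _).2 ⟨c s, rfl, by
        rw [← h0, hc.dist_eq, Real.dist_eq, sub_zero, abs_of_pos hs.1]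
        exact hs⟩)
    rwa [Function.comp_apply, h1] at h

/-- The density vanishes off the disk. Conversely, a point of nonzero density is the image of some
parameter, and an open set around that parameter meets the open rectangle in positive measure. The
closure of the rectangle enters because the angle may be `0`. -/
theorem support_map_footpoint_torusMeasure (hΓ : IsClosedSurfaceGroup Γ) (hE : 0 < E)
    (hEc : E < B ^ 2 / 2) (g : SL(2, ℝ)) :
    ((torusMeasure B E (CotangentSurface.proj Γ (g • upward √(2 * E)))).map
        CotangentSurface.footpoint).support =
      Surface.disk (Surface.proj Γ (g • UpperHalfPlane.I)) (radius B E) := by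
  have hT := period_pos hEc
  apply Subset.antisymm
  · have hcl := Surface.isClosed_disk hΓ (g • UpperHalfPlane.I) (radius B E)
    refine Measure.support_subset_of_isClosed hcl ?_
    rw [mem_ae_iff, map_footpoint_torusMeasure hΓ hE hEc, withDensity_apply _ hcl.measurableSet.compl,
      setLIntegral_eq_zero_iff hcl.measurableSet.compl
        (measurable_density hΓ hE hEc g).ennreal_ofReal]
    refine Eventually.of_forall fun y hy => ?_
    have h0 : density B E (CotangentSurface.proj Γ (g • upward √(2 * E))) y = 0 := by
      by_contra h
      apply hy
      rw [← closure_support_density hΓ hE hEc g]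
      exact subset_closure h
    rw [h0, ENNReal.ofReal_zero]
  · rw [← closure_support_density hΓ hE hEc g]
    refine closure_minimal (fun y hy => ?_) Measure.isClosed_support
    have hy' := (density_ne_zero_iff hΓ hE hEc g y).1 hy
    obtain ⟨v, hv⟩ := hy'
    obtain ⟨q, ⟨⟨hq1, hq2⟩, hqy⟩, -⟩ :=
      (bijOn_smul_orbitPoint hE hEc (bijOn_cos_first hEc) g y).surjOn hv
    rw [Measure.support_eq_forall_isOpen]
    intro U hyU hU
    have hcont := continuous_footpoint.comp (continuous_torusMap (Γ := Γ) hE hEc g)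
    rw [Measure.map_apply continuous_footpoint.measurable hU.measurableSet, torusMeasure,
      Measure.map_apply (continuous_torusMap hE hEc g).measurable
        (continuous_footpoint.measurable hU.measurableSet), ← preimage_comp,
      Measure.restrict_apply (hcont.measurable hU.measurableSet)]
    have hO := hU.preimage hcont
    have hqO : q ∈ (CotangentSurface.footpoint ∘
        torusMap B (CotangentSurface.proj Γ (g • upward √(2 * E)))) ⁻¹' U := by
      rw [mem_preimage, Function.comp_apply, footpoint_torusMap hE hEc, hqy]
      exact hyU
    have hqcl : q ∈ closure (Ioo 0 (2 * Real.pi) ×ˢ Ioo 0 (period B E)) := by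
      rw [closure_prod_eq, closure_Ioo Real.two_pi_pos.ne, closure_Ioo hT.ne]
      exact ⟨Ico_subset_Icc_self hq1, hq2.1.le, by linarith [hq2.2]⟩
    obtain ⟨q', hq'⟩ := mem_closure_iff.1 hqcl _ hO hqO
    refine ((hO.inter (isOpen_Ioo.prod isOpen_Ioo)).measure_pos volume ⟨q', hq'⟩).trans_le
      (measure_mono ?_)
    exact inter_subset_inter_right _ (prod_mono Ioo_subset_Icc_self Ioo_subset_Icc_self)

end MagneticTorus

/-! ### Assembly of the statement -/

open MagneticTorus

theorem proposition2p5 (Γ : Subgroup SL(2, ℝ)) (hΓ : IsClosedSurfaceGroup Γ)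
    (B E : ℝ) (hB : 0 < B) (hE : 0 < E) (hEc : E < B ^ 2 / 2)
    (x₀ : Surface Γ) (z₀ : ℍ) (hz₀ : Surface.proj Γ z₀ = x₀)
    (ξ₀ : CotangentSurface Γ) (hξ₀ : ξ₀.footpoint = x₀) (hξ₀E : ξ₀.energy = E) :
    let α : Surface Γ → ℝ := density B E ξ₀
    let ν : Measure (Surface Γ) := (torusMeasure B E ξ₀).map CotangentSurface.footpoint
    let R : ℝ := radius B E
    -- the sum that defines `α` is finite at every point, and `α` is the density of `ν`
    (∀ y, (preimages B E ξ₀ y).Finite) ∧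
    Integrable α (Surface.vol Γ) ∧
    ν = (Surface.vol Γ).withDensity (fun x => ENNReal.ofReal (α x)) ∧
    -- support and upper semicontinuity
    closure (Function.support α) = Surface.disk x₀ R ∧
    ν.support = Surface.disk x₀ R ∧
    UpperSemicontinuousOn α ({x₀} ∪ boundaryCurve Γ z₀ R)ᶜ ∧
    -- near `x₀`
    (x₀ ∉ boundaryCurve Γ z₀ R →
      α ~[𝓝[≠] x₀] fun x => √(2 / E) / Surface.sdist x₀ x) ∧
    (x₀ ∈ boundaryCurve Γ z₀ R → (boundaryLifts z₀ R x₀).Finite ∧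
      ∀ᶠ ε in 𝓝[>] (0 : ℝ), ∀ᶠ r in 𝓝[>] (0 : ℝ),
        α ~[𝓝[≠] x₀] fun x => √(2 / E) / Surface.sdist x₀ x +
          boundaryConstant B E * branchSum z₀ R ε r x₀ x) ∧
    -- near the points of the boundary curve
    (∀ y₀ ∈ boundaryCurve Γ z₀ R, y₀ ≠ x₀ → (boundaryLifts z₀ R y₀).Finite ∧
      ∀ᶠ ε in 𝓝[>] (0 : ℝ),
        (α =O[𝓝[outerCollar Γ z₀ R ε \ innerCollar Γ z₀ R ε] y₀] fun _ => (1 : ℝ)) ∧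
        ∀ᶠ r in 𝓝[>] (0 : ℝ),
          α ~[𝓝[innerCollar Γ z₀ R ε] y₀] fun x =>
            boundaryConstant B E * branchSum z₀ R ε r y₀ x) := by
  obtain ⟨g, rfl, rfl⟩ := exists_lift hE (hξ₀.trans hz₀.symm) hξ₀E
  subst hz₀
  intro α ν R
  have hR : 0 < R := radius_pos hE hEc
  refine ⟨finite_preimages hΓ hE hEc g, integrable_density hΓ hE hEc g,
    map_footpoint_torusMeasure hΓ hE hEc g, closure_support_density hΓ hE hEc g,
    support_map_footpoint_torusMeasure hΓ hE hEc g, ?_, ?_, ?_, ?_⟩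
  · intro y hy
    rw [mem_compl_iff, mem_union, mem_singleton_iff, not_or] at hy
    exact (continuousAt_density hΓ hE hEc g hy.1 hy.2).continuousWithinAt.upperSemicontinuousWithinAt
  · intro hx
    obtain ⟨P, τ, hτ, hP, hα⟩ := exists_local_lifts hΓ hE hEc g (g • UpperHalfPlane.I)
    -- Off the boundary curve no lift of the center is on the circle, so the branch sum may be
    -- replaced by zero.
    have h := isEquivalent_density_center hΓ hB hE hEc g hτ hP hα (S := fun _ => 0)
      (Eventually.of_forall fun z => (Finset.sum_eq_zero fun v hv => if_neg fun hd => hx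
        ⟨v, hd, by
          conv_lhs => rw [← (hτ v hv).2]
          exact Surface.proj_smul (hτ v hv).1 _⟩).symm)
    simpa only [mul_zero, add_zero] using h
  · intro _
    refine ⟨finite_boundaryLifts hΓ _ _ _, ?_⟩
    obtain ⟨P, τ, hτ, hP, hα⟩ := exists_local_lifts hΓ hE hEc g (g • UpperHalfPlane.I)
    filter_upwards [self_mem_nhdsWithin] with ε hε
    filter_upwards [eventually_branchSum_eq hΓ hτ hP hε] with r hr
    exact isEquivalent_density_center hΓ hB hE hEc g hτ hP hα hr
  · intro y₀ _ hne
    refine ⟨finite_boundaryLifts hΓ _ _ _, ?_⟩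
    obtain ⟨v₀, rfl⟩ := Surface.proj_surjective y₀
    obtain ⟨P, τ, hτ, hP, hα⟩ := exists_local_lifts hΓ hE hEc g v₀
    -- The condition on `ε` that depends on `y₀`: the annulus must avoid the finitely many lifts
    -- strictly inside the disk.
    have hsmall : ∀ᶠ ε in 𝓝[>] (0 : ℝ), ∀ v ∈ P, dist v (g • UpperHalfPlane.I) < R →
        dist v (g • UpperHalfPlane.I) < R - ε := by
      refine (Filter.eventually_all_finset P).2 fun v _ => ?_
      by_cases hd : dist v (g • UpperHalfPlane.I) < R
      · filter_upwards [nhdsWithin_le_nhds (gt_mem_nhds (sub_pos.2 hd))] with ε hε _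
        linarith
      · exact Eventually.of_forall fun ε h => absurd h hd
    filter_upwards [self_mem_nhdsWithin, hsmall] with ε hε hεP
    refine ⟨isBigO_density_outer hE hEc g hne hτ hα hε disjoint_sdiff_left, ?_⟩
    filter_upwards [eventually_branchSum_eq hΓ hτ hP hε] with r hr
    exact isEquivalent_density_inner hΓ hB hE hEc g hne hτ hP hα hεP hr
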